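/- Let $\gamma\in(0,1]$ and $a>0$, and let $\omega\subset\mathbb{R}^2$ be a (Lebesgue) measurable set which is $(\gamma,a)$-thick, that is, $$|\omega\cap(p+[0,a]^2)|\ \ge\ \gamma a^2\qquad\text{for every } p\in\mathbb{R}^2 .$$ Then the two-dimensional Kolmogorov equation, with state $y=y(t,x,z)$, $$y_t+z\,y_x-y_{zz}=u\mathbf 1_\omega\ \text{ in }(0,T)\times\mathbb{R}^2,\qquad y(0,\cdot)=y_0\ \text{ in }\mathbb{R}^2,$$ is small-time null controllable: for every $T>0$ and every real-valued $y_0\in L^2(\mathbb{R}^2)$ there exists a control $u\in L^1((0,T);L^2(\omega))$ such that the unique weak solution $y\in C^0([0,T];L^2(\mathbb{R}^2))$ associated with $y_0$ and $u$ satisfies $y(T)=0$. Here $y\in C^0([0,T];L^2(\mathbb{R}^2))$ is a weak solution when $y(0)=y_0$ and, for all $\varphi\in C_c^\infty(\mathbb{R}\times\mathbb{R}^2)$ and $\tau\in[0,T]$, $$\int_{\mathbb{R}^2} y(\tau)\varphi(\tau)-\int_{\mathbb{R}^2} y_0\,\varphi(0)=\int_0^\tau\!\!\int_{\mathbb{R}^2}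 y\,(\varphi_t+z\varphi_x+\varphi_{zz})\,dx\,dz\,ds+\int_0^\tau\!\!\int_\omega u\,\varphi\,dx\,dz\,ds .$$ -/

import Mathlib

open MeasureTheory Set
open scoped ENNReal

namespace KolmogorovControl

/-- The plane `ℝ²` with coordinates `p 0 = x` and `p 1 = z`. -/
abbrev Plane : Type := EuclideanSpace ℝ (Fin 2)

/-- The cube `x + [0,a]^d`. -/
def cube {d : ℕ} (x : EuclideanSpace ℝ (Fin d)) (a : ℝ) : Set (EuclideanSpace ℝ (Fin d)) :=
  {p | ∀ i, x i ≤ p i ∧ p i ≤ x i + a}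

/-- `ω ⊆ ℝ^d` is `(γ,a)`-thick: `|ω ∩ (x + [0,a]^d)| ≥ γ a^d` for every `x`. -/
def IsThick {d : ℕ} (γ a : ℝ) (ω : Set (EuclideanSpace ℝ (Fin d))) : Prop :=
  ∀ x : EuclideanSpace ℝ (Fin d), ENNReal.ofReal (γ * a ^ d) ≤ volume (ω ∩ cube x a)

/-- The state space `L²(ℝ²)`. -/
abbrev State : Type := Lp ℝ 2 (volume : Measure Plane)

/-- The control space `L²(ω)`. -/
abbrev Control (ω : Set Plane) : Type := Lp ℝ 2 ((volume : Measure Plane).restrict ω)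

/-- The unit direction of `t` in space-time `ℝ × ℝ²`. -/
noncomputable def dirT : ℝ × Plane := (1, 0)

/-- The unit direction of `x` in space-time `ℝ × ℝ²`. -/
noncomputable def dirX : ℝ × Plane := (0, EuclideanSpace.single 0 1)

/-- The unit direction of `z` in space-time `ℝ × ℝ²`. -/
noncomputable def dirZ : ℝ × Plane := (0, EuclideanSpace.single 1 1)

/-- The directional derivative of `φ` in the direction `v`. -/
noncomputable def partialD (v : ℝ × Plane) (φ : ℝ × Plane → ℝ) : ℝ × Plane → ℝ :=
  fun q => fderiv ℝ φ q v

/-- The formal adjoint of `∂_t + z ∂_x - ∂_zz`, with the opposite sign: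
`φ_t + z φ_x + φ_zz`. -/
noncomputable def adjointOp (φ : ℝ × Plane → ℝ) : ℝ × Plane → ℝ :=
  fun q => partialD dirT φ q + q.2 1 * partialD dirX φ q + partialD dirZ (partialD dirZ φ) q

/-- `y ∈ C⁰([0,T]; L²(ℝ²))` is a weak solution of `y_t + z y_x - y_zz = u 1_ω` in
`(0,T) × ℝ²` with `y(0) = y₀`.  Only the restriction of `y` to `[0,T]` and the class of `u`
on `(0,T)` matter. -/
structure IsSolution (T : ℝ) (ω : Set Plane) (y₀ : State) (u : ℝ → Control ω)
    (y : ℝ → State) : Prop where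
  continuousOn : ContinuousOn y (Icc 0 T)
  initial : y 0 = y₀
  weak : ∀ φ : ℝ × Plane → ℝ, ContDiff ℝ (⊤ : ℕ∞) φ → HasCompactSupport φ → ∀ τ ∈ Icc 0 T,
    (∫ p, y τ p * φ (τ, p)) - ∫ p, y₀ p * φ (0, p) =
      (∫ s in (0 : ℝ)..τ, ∫ p, y s p * adjointOp φ (s, p)) +
        ∫ s in (0 : ℝ)..τ, ∫ p in ω, u s p * φ (s, p)

/-- Small-time null controllability of `y_t + z y_x - y_zz = u 1_ω`: for every `T > 0` and
`y₀ ∈ L²(ℝ²)` there is a control `u ∈ L¹((0,T); L²(ω))` such that the (unique) solution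
associated with `y₀` and `u` vanishes at time `T`. -/
def SmallTimeNullControllable (ω : Set Plane) : Prop :=
  ∀ T : ℝ, 0 < T → ∀ y₀ : State,
    ∃ u : ℝ → Control ω, MemLp u 1 (volume.restrict (Ioo 0 T)) ∧
      ∃ y : ℝ → State, IsSolution T ω y₀ u y ∧ y T = 0 ∧
        ∀ y' : ℝ → State, IsSolution T ω y₀ u y' → EqOn y' y (Icc 0 T)

end KolmogorovControl

/-!
In the moving frame `(x, z) ↦ (x + t z, z)` the equation reads `w_t = Δ_t w + g`, where `Δ_t` is the
square of a first-order operator with constant coefficients in space, hence a Fourier multiplier.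
The time integral of `-Δ_t` over `[s, t] ⊆ [0, T]` has a symbol bounded below by
`c (t - s) ^ 3 |ζ| ^ 2`: free evolution damps the frequencies `|ζ| > K` by the factor
`exp (-c (t - s) ^ 3 K ^ 2)`.

For thick `ω`, functions `f` with frequencies in the ball of radius `K` satisfy the
Logvinenko–Sereda–Kovrijkine inequality `‖f‖ ^ 2 ≤ exp (C K) ‖1_ω f‖ ^ 2`. Indeed, on average over
all translates of the cube, `f` is close in `L²` to its Taylor polynomials, whose degree `n` is
taken of order `K`. For these the Remez inequality, applied one variable at a time, loses only a
factor exponential in `n`, while the error decays superexponentially. A Neumann series turns the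
inequality into a right inverse of the localization on `ω` at frequencies at most `K`, of norm of
order `exp (C K)`, and hence into a control at that cost which removes these frequencies in the
moving frame, since a shear by a bounded time dilates the frequency balls by a bounded factor only.

Alternating such controls with free evolution on intervals of length `T / 2 ^ (j + 1)`, with
frequencies `K j` of order `16 ^ j`, the dissipation exponent, of order `32 ^ j`, beats the cost
exponent, of order `16 ^ j`: the state tends to zero at time `T` while the controls stay bounded.

For uniqueness, mollify the difference of two solutions in the moving frame: the result solves in
`L²` an evolution equation whose right-hand side is bounded and dissipative, hence vanishes.
-/

namespace KolmogorovControl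

open Filter Topology

section DominatedConvergence

theorem tendsto_eLpNorm_sub_of_dominated {α E ι : Type*} [MeasurableSpace α] {μ : Measure α}
    [NormedAddCommGroup E] {p : ℝ≥0∞} (hp₀ : p ≠ 0) (hp : p ≠ ∞) {l : Filter ι}
    [l.IsCountablyGenerated] {F : ι → α → E} {f : α → E} {G : α → ℝ} (hG : MemLp G p μ)
    (hF : ∀ i, AEStronglyMeasurable (F i) μ) (hf : AEStronglyMeasurable f μ)
    (hFG : ∀ i, ∀ᵐ x ∂μ, ‖F i x - f x‖ ≤ G x)
    (h : ∀ᵐ x ∂μ, Tendsto (fun i => F i x) l (𝓝 (f x))) :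
    Tendsto (fun i => eLpNorm (F i - f) p μ) l (𝓝 0) := by
  have hpos : 0 < p.toReal := ENNReal.toReal_pos hp₀ hp
  have hInt : Tendsto (fun i => ∫⁻ x, ‖F i x - f x‖ₑ ^ p.toReal ∂μ) l (𝓝 0) := by
    refine (tendsto_lintegral_filter_of_dominated_convergence' (fun x => ‖G x‖ₑ ^ p.toReal)
      (f := fun _ => 0) (Eventually.of_forall fun i => ?_) (Eventually.of_forall fun i => ?_)
      (lintegral_rpow_enorm_lt_top_of_eLpNorm_lt_top hp₀ hp hG.2).ne ?_).trans_eq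
        (by rw [lintegral_zero])
    · exact ((hF i).sub hf).enorm.pow_const _
    · filter_upwards [hFG i] with x hx
      refine ENNReal.rpow_le_rpow ?_ hpos.le
      exact enorm_le_iff_norm_le.2 (hx.trans (le_abs_self _))
    · filter_upwards [h] with x hx
      simpa [hpos] using (hx.sub_const (f x)).enorm.ennrpow_const p.toReal
  simp_rw [eLpNorm_eq_lintegral_rpow_enorm_toReal hp₀ hp]
  simpa [hpos] using hInt.ennrpow_const (1 / p.toReal)

end DominatedConvergence

section Multiplication

variable {α 𝕜 E : Type*} [MeasurableSpace α] {μ : Measure α} [RCLike 𝕜]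
  [NormedAddCommGroup E] {p : ℝ≥0∞} [Fact (1 ≤ p)] {m n k : α → 𝕜}

section NormedSpace

variable [NormedSpace 𝕜 E]

/-- Multiplication by the essentially bounded function `m`, as an operator on `Lᵖ`. -/
noncomputable def mulOp (hm : MemLp m ∞ μ) : Lp E p μ →L[𝕜] Lp E p μ :=
  (ContinuousLinearMap.lsmul 𝕜 𝕜).holderL μ ∞ p p hm.toLp

theorem coeFn_mulOp (hm : MemLp m ∞ μ) (f : Lp E p μ) :
    mulOp hm f =ᵐ[μ] fun x => m x • f x := by
  filter_upwards [(ContinuousLinearMap.lsmul 𝕜 𝕜).coeFn_holder (r := p) hm.toLp f, hm.coeFn_toLp]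
    with x hx hmx
  exact hx.trans (by rw [ContinuousLinearMap.lsmul_apply, hmx])

theorem norm_mulOp_apply_le (hm : MemLp m ∞ μ) {c : ℝ} {f : Lp E p μ}
    (h : ∀ᵐ x ∂μ, ‖m x • f x‖ ≤ c * ‖f x‖) : ‖mulOp hm f‖ ≤ c * ‖f‖ := by
  refine Lp.norm_le_mul_norm_of_ae_le_mul ?_
  filter_upwards [coeFn_mulOp hm f, h] with x hx hx'
  rwa [hx]

theorem mulOp_mulOp (hm : MemLp m ∞ μ) (hn : MemLp n ∞ μ) (hk : MemLp k ∞ μ)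
    (h : ∀ᵐ x ∂μ, k x = m x * n x) (f : Lp E p μ) : mulOp hm (mulOp hn f) = mulOp hk f := by
  refine Lp.ext ?_
  filter_upwards [coeFn_mulOp hm (mulOp hn f), coeFn_mulOp hn f, coeFn_mulOp hk f, h]
    with x hmn hnf hkf hx
  rw [hmn, hnf, hkf, hx, mul_smul]

theorem mulOp_add_mulOp (hm : MemLp m ∞ μ) (hn : MemLp n ∞ μ)
    (h : ∀ᵐ x ∂μ, m x + n x = 1) (f : Lp E p μ) : mulOp hm f + mulOp hn f = f := by
  refine Lp.ext ?_
  filter_upwards [Lp.coeFn_add (mulOp hm f) (mulOp hn f), coeFn_mulOp hm f, coeFn_mulOp hn f, h]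
    with x hadd hmf hnf hx
  rw [hadd, Pi.add_apply, hmf, hnf, ← add_smul, hx, one_smul]

theorem tendsto_mulOp {ι : Type*} {l : Filter ι} [l.IsCountablyGenerated] (hp : p ≠ ∞)
    {M : ι → α → 𝕜} (hM : ∀ i, MemLp (M i) ∞ μ) (hm : MemLp m ∞ μ) {C : ℝ}
    (hC : ∀ i x, ‖M i x‖ ≤ C) (h : ∀ x, Tendsto (fun i => M i x) l (𝓝 (m x))) (f : Lp E p μ) :
    Tendsto (fun i => mulOp (hM i) f) l (𝓝 (mulOp hm f)) := by
  rcases l.eq_or_neBot with rfl | hl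
  · exact tendsto_bot
  have hmC : ∀ x, ‖m x‖ ≤ C := fun x =>
    le_of_tendsto (h x).norm (Eventually.of_forall fun i => hC i x)
  rw [Lp.tendsto_Lp_iff_tendsto_eLpNorm']
  refine (tendsto_eLpNorm_sub_of_dominated (zero_lt_one.trans_le Fact.out).ne' hp
    (F := fun i x => M i x • f x) (f := fun x => m x • f x)
    ((Lp.memLp f).norm.const_mul (C + C)) (fun i => (hM i).1.smul (Lp.aestronglyMeasurable f))
    (hm.1.smul (Lp.aestronglyMeasurable f)) (fun i => Eventually.of_forall fun x => ?_)
    (Eventually.of_forall fun x => (h x).smul_const (f x))).congr fun i => eLpNorm_congr_ae ?_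
  · rw [← sub_smul, norm_smul]
    gcongr
    exact (norm_sub_le _ _).trans (add_le_add (hC i x) (hmC x))
  · exact ((coeFn_mulOp (hM i) f).sub (coeFn_mulOp hm f)).symm

end NormedSpace

end Multiplication

section Fourier

open FourierTransform SchwartzMap
open scoped ContDiff

variable {V F : Type*} [NormedAddCommGroup V] [InnerProductSpace ℝ V] [FiniteDimensional ℝ V]
  [MeasurableSpace V] [BorelSpace V] [NormedAddCommGroup F]

section Integrable

variable [NormedSpace ℂ F] {f : V → F}

theorem continuous_fourier_of_integrable (hf : Integrable f) : Continuous (𝓕 f) :=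
  VectorFourier.fourierIntegral_continuous Real.continuous_fourierChar continuous_inner hf

theorem continuous_fourierInv_of_integrable (hf : Integrable f) : Continuous (𝓕⁻ f) := by
  simp only [funext (Real.fourierInv_eq_fourier_neg f)]
  exact (continuous_fourier_of_integrable hf).comp continuous_neg

theorem integral_fourier_smul_eq [CompleteSpace F] {g : V → ℂ} (hg : Integrable g)
    (hf : Integrable f) : ∫ x, 𝓕 g x • f x = ∫ x, g x • 𝓕 f x := by
  have h := VectorFourier.integral_fourierIntegral_smul_eq_flip (L := innerₗ V)
    Real.continuous_fourierChar continuous_inner hg hf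
  rwa [flip_innerₗ] at h

theorem integral_fourierInv_smul_eq [CompleteSpace F] {g : V → ℂ} (hg : Integrable g)
    (hf : Integrable f) : ∫ x, 𝓕⁻ g x • f x = ∫ x, g x • 𝓕⁻ f x := by
  calc ∫ x, 𝓕⁻ g x • f x = ∫ x, 𝓕 g x • f (-x) := by
        rw [← integral_neg_eq_self]
        simp only [Real.fourierInv_eq_fourier_neg, neg_neg]
    _ = ∫ x, g x • 𝓕 (fun y => f (-y)) x := integral_fourier_smul_eq hg hf.comp_neg
    _ = ∫ x, g x • 𝓕⁻ f x := by simp only [Real.fourierInv_eq_fourier_comp_neg]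

end Integrable

variable [InnerProductSpace ℂ F] [CompleteSpace F]

theorem integral_smul_coeFn_fourier (f : Lp F 2 (volume : Measure V)) (g : 𝓢(V, ℂ)) :
    ∫ x, g x • (𝓕 f : Lp F 2 volume) x = ∫ x, (𝓕 g) x • f x := by
  have h := congrArg (fun d : TemperedDistribution V F => d g)
    (Lp.fourier_toTemperedDistribution_eq f)
  simp only [TemperedDistribution.fourier_apply, Lp.toTemperedDistribution_apply] at h
  exact h.symm

theorem integral_smul_coeFn_fourierInv (f : Lp F 2 (volume : Measure V)) (g : 𝓢(V, ℂ)) :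
    ∫ x, g x • (𝓕⁻ f : Lp F 2 volume) x = ∫ x, (𝓕⁻ g) x • f x := by
  have h := congrArg (fun d : TemperedDistribution V F => d g)
    (Lp.fourierInv_toTemperedDistribution_eq f)
  simp only [TemperedDistribution.fourierInv_apply, Lp.toTemperedDistribution_apply] at h
  exact h.symm

theorem coeFn_fourier_of_integrable {f : Lp F 2 (volume : Measure V)} (hf : Integrable f) :
    (𝓕 f : Lp F 2 volume) =ᵐ[volume] 𝓕 (f : V → F) := by
  refine ae_eq_of_integral_contDiff_smul_eq
    ((Lp.memLp (𝓕 f : Lp F 2 volume)).locallyIntegrable one_le_two)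
    (continuous_fourier_of_integrable hf).locallyIntegrable fun g hg hc => ?_
  have hgc : HasCompactSupport (Complex.ofRealCLM ∘ g) := hc.comp_left rfl
  have hgd : ContDiff ℝ ∞ (Complex.ofRealCLM ∘ g) := by fun_prop
  have h := integral_smul_coeFn_fourier f (hgc.toSchwartzMap hgd)
  rw [fourier_coe, integral_fourier_smul_eq (SchwartzMap.integrable _) hf] at h
  simpa using h

theorem coeFn_fourierInv_of_integrable {f : Lp F 2 (volume : Measure V)} (hf : Integrable f) :
    (𝓕⁻ f : Lp F 2 volume) =ᵐ[volume] 𝓕⁻ (f : V → F) := by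
  refine ae_eq_of_integral_contDiff_smul_eq
    ((Lp.memLp (𝓕⁻ f : Lp F 2 volume)).locallyIntegrable one_le_two)
    (continuous_fourierInv_of_integrable hf).locallyIntegrable fun g hg hc => ?_
  have hgc : HasCompactSupport (Complex.ofRealCLM ∘ g) := hc.comp_left rfl
  have hgd : ContDiff ℝ ∞ (Complex.ofRealCLM ∘ g) := by fun_prop
  have h := integral_smul_coeFn_fourierInv f (hgc.toSchwartzMap hgd)
  rw [fourierInv_coe, integral_fourierInv_smul_eq (SchwartzMap.integrable _) hf] at h
  simpa using h

theorem norm_fourierInv_eq (f : Lp F 2 (volume : Measure V)) : ‖(𝓕⁻ f : Lp F 2 volume)‖ = ‖f‖ :=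
  (Lp.fourierTransformₗᵢ V F).symm.norm_map f

section Multiplier

variable {m n k : V → ℂ} (hm : MemLp m ∞ (volume : Measure V)) (hn : MemLp n ∞ volume)
  (hk : MemLp k ∞ volume)

/-- The Fourier multiplier with bounded symbol `m`, as an operator on `L²`. -/
noncomputable def fourierMultiplier :
    Lp F 2 (volume : Measure V) →L[ℂ] Lp F 2 (volume : Measure V) :=
  ((Lp.fourierTransformₗᵢ V F).symm : Lp F 2 volume →L[ℂ] Lp F 2 volume) ∘L mulOp hm ∘L
    (Lp.fourierTransformₗᵢ V F : Lp F 2 volume →L[ℂ] Lp F 2 volume)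

theorem fourierMultiplier_apply (f : Lp F 2 (volume : Measure V)) :
    fourierMultiplier hm f = 𝓕⁻ (mulOp hm (𝓕 f)) :=
  rfl

theorem fourier_fourierMultiplier (f : Lp F 2 (volume : Measure V)) :
    𝓕 (fourierMultiplier hm f) = mulOp hm (𝓕 f) := by
  rw [fourierMultiplier_apply, fourier_fourierInv_eq]

theorem norm_fourierMultiplier_apply_le_of_ae {c : ℝ} {f : Lp F 2 (volume : Measure V)}
    (h : ∀ᵐ ζ, ‖m ζ • (𝓕 f : Lp F 2 volume) ζ‖ ≤ c * ‖(𝓕 f : Lp F 2 volume) ζ‖) :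
    ‖fourierMultiplier hm f‖ ≤ c * ‖f‖ := by
  rw [fourierMultiplier_apply, norm_fourierInv_eq, ← Lp.norm_fourier_eq f]
  exact norm_mulOp_apply_le hm h

theorem norm_fourierMultiplier_apply_le {c : ℝ} (h : ∀ ζ, ‖m ζ‖ ≤ c)
    (f : Lp F 2 (volume : Measure V)) : ‖fourierMultiplier hm f‖ ≤ c * ‖f‖ := by
  refine norm_fourierMultiplier_apply_le_of_ae hm (Eventually.of_forall fun ζ => ?_)
  rw [norm_smul]
  gcongr
  exact h ζ

variable {hm hn} in
theorem fourierMultiplier_fourierMultiplier (h : ∀ᵐ ζ, k ζ = m ζ * n ζ)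
    (f : Lp F 2 (volume : Measure V)) :
    fourierMultiplier hm (fourierMultiplier hn f) = fourierMultiplier hk f := by
  rw [fourierMultiplier_apply, fourier_fourierMultiplier, mulOp_mulOp hm hn hk h,
    ← fourierMultiplier_apply]

theorem fourierMultiplier_apply_of_ae_eq_one (h : ∀ᵐ ζ, m ζ = 1)
    (f : Lp F 2 (volume : Measure V)) : fourierMultiplier hm f = f := by
  have hmul : mulOp hm (𝓕 f) = 𝓕 f := by
    refine Lp.ext ?_
    filter_upwards [coeFn_mulOp hm (𝓕 f), h] with ζ hζ hone
    rw [hζ, hone, one_smul]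
  rw [fourierMultiplier_apply, hmul, fourierInv_fourier_eq]

theorem fourierMultiplier_comm (f : Lp F 2 (volume : Measure V)) :
    fourierMultiplier hm (fourierMultiplier hn f) =
      fourierMultiplier hn (fourierMultiplier hm f) := by
  have hmn : MemLp (m * n) ∞ (volume : Measure V) := hn.mul hm
  rw [fourierMultiplier_fourierMultiplier hmn (Eventually.of_forall fun ζ => rfl),
    fourierMultiplier_fourierMultiplier hmn (Eventually.of_forall fun ζ => mul_comm _ _)]

theorem tendsto_fourierMultiplier {ι : Type*} {l : Filter ι} [l.IsCountablyGenerated]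
    {M : ι → V → ℂ} (hM : ∀ i, MemLp (M i) ∞ volume) {C : ℝ} (hC : ∀ i ζ, ‖M i ζ‖ ≤ C)
    (h : ∀ ζ, Tendsto (fun i => M i ζ) l (𝓝 (m ζ))) (f : Lp F 2 (volume : Measure V)) :
    Tendsto (fun i => fourierMultiplier (hM i) f) l (𝓝 (fourierMultiplier hm f)) :=
  ((Lp.fourierTransformₗᵢ V F).symm.continuous.tendsto _).comp
    (tendsto_mulOp ENNReal.ofNat_ne_top hM hm hC h (𝓕 f))

end Multiplier

theorem memLp_top_ofReal_of_continuous {q : V → ℝ} (hq : Continuous q) {C : ℝ}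
    (hC : ∀ ζ, |q ζ| ≤ C) : MemLp (fun ζ => (q ζ : ℂ)) ∞ (volume : Measure V) :=
  memLp_top_of_bound (by fun_prop : Continuous fun ζ => (q ζ : ℂ)).aestronglyMeasurable C
    (Eventually.of_forall fun ζ => by simpa using hC ζ)

end Fourier

section Separation

theorem exists_mem_lt_volume_inter_Ici {δ r : ℝ} (hδ : 0 ≤ δ) (hr : 0 ≤ r) {E : Set ℝ}
    (hb : BddBelow E) (h : ENNReal.ofReal (δ + r) < volume E) :
    ∃ y ∈ E, ENNReal.ofReal r < volume (E ∩ Ici (y + δ)) := by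
  obtain ⟨s, -, hs, hsE⟩ := ENNReal.lt_iff_exists_real_btwn.1 h
  have hrs : 0 < s - (δ + r) :=
    sub_pos.2 ((ENNReal.ofReal_lt_ofReal_iff_of_nonneg (by positivity)).1 hs)
  obtain ⟨y, hyE, hy⟩ := exists_lt_of_csInf_lt
    (nonempty_of_measure_ne_zero (ne_bot_of_gt h)) (lt_add_of_pos_right (sInf E) hrs)
  have hinf : sInf E ≤ y := csInf_le hb hyE
  refine ⟨y, hyE, not_le.1 fun hle => hsE.not_ge ?_⟩
  have hcover : E ⊆ Icc (sInf E) (y + δ) ∪ E ∩ Ici (y + δ) := fun z hz =>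
    (le_total z (y + δ)).imp (fun h => ⟨csInf_le hb hz, h⟩) fun h => ⟨hz, h⟩
  calc volume E ≤ volume (Icc (sInf E) (y + δ)) + volume (E ∩ Ici (y + δ)) :=
        (measure_mono hcover).trans (measure_union_le _ _)
    _ ≤ ENNReal.ofReal (y + δ - sInf E) + ENNReal.ofReal r := by
        rw [Real.volume_Icc]
        gcongr
    _ = ENNReal.ofReal (y + δ - sInf E + r) := (ENNReal.ofReal_add (by linarith) hr).symm
    _ ≤ ENNReal.ofReal s := ENNReal.ofReal_le_ofReal (by linarith)

theorem exists_separated_points {δ : ℝ} (hδ : 0 ≤ δ) (k : ℕ) {E : Set ℝ} (hb : BddBelow E)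
    (h : ENNReal.ofReal (k * δ) < volume E) :
    ∃ x : ℕ → ℝ, (∀ i ≤ k, x i ∈ E) ∧ ∀ i < k, x i + δ ≤ x (i + 1) := by
  induction k generalizing E with
  | zero =>
    obtain ⟨x, hx⟩ : E.Nonempty := nonempty_of_measure_ne_zero (ne_bot_of_gt h)
    exact ⟨fun _ => x, fun _ _ => hx, fun i hi => absurd hi (Nat.not_lt_zero i)⟩
  | succ k ih =>
    obtain ⟨y, hyE, hy⟩ := exists_mem_lt_volume_inter_Ici (r := k * δ) hδ (by positivity) hb
      (by convert h using 2; push_cast; ring)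
    obtain ⟨x, hxE, hx⟩ := ih (hb.mono inter_subset_left) hy
    refine ⟨fun i => Nat.casesOn i y x, fun i hi => ?_, fun i hi => ?_⟩
    · cases i with
      | zero => exact hyE
      | succ i => exact (hxE i (by lia)).1
    · cases i with
      | zero => exact (hxE 0 (by lia)).2
      | succ i => exact hx i (by lia)

theorem abs_sub_mul_le_of_separated {δ : ℝ} {n : ℕ} {x : ℕ → ℝ}
    (hx : ∀ i < n, x i + δ ≤ x (i + 1)) {i j : ℕ} (hi : i ≤ n) (hj : j ≤ n) :
    |(i : ℝ) - j| * δ ≤ |x i - x j| := by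
  wlog hij : i ≤ j generalizing i j
  · rw [abs_sub_comm, abs_sub_comm (x i)]
    exact this hj hi (le_of_not_ge hij)
  have hle : ((j : ℝ) - i) * δ ≤ x j - x i := by
    clear hi
    induction j, hij using Nat.le_induction with
    | base => simp
    | succ j _ ih =>
      push_cast
      linarith [ih (by lia), hx j (by lia)]
  rw [abs_sub_comm, abs_of_nonneg (sub_nonneg.2 (Nat.cast_le.2 hij)), abs_sub_comm]
  exact hle.trans (le_abs_self _)

end Separation

section Remez

theorem prod_range_erase_abs_sub {n i : ℕ} (hi : i ≤ n) :
    ∏ j ∈ (Finset.range (n + 1)).erase i, |(i : ℝ) - j| = i.factorial * (n - i).factorial := by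
  induction n, hi using Nat.le_induction with
  | base =>
    rw [Finset.range_add_one, Finset.erase_insert (by simp), Nat.sub_self, Nat.factorial_zero,
      Nat.cast_one, mul_one, ← Finset.prod_range_reflect, ← Finset.prod_range_add_one_eq_factorial]
    push_cast
    refine Finset.prod_congr rfl fun j hj => ?_
    have hji := Finset.mem_range.1 hj
    rw [show i - 1 - j = i - (j + 1) by lia, Nat.cast_sub (by lia), sub_sub_cancel]
    push_cast
    exact abs_of_nonneg (by positivity)
  | succ n hn ih =>
    have hin : (i : ℝ) ≤ n := Nat.cast_le.2 hn
    rw [Finset.range_add_one, Finset.erase_insert_of_ne (by lia), Finset.prod_insert (by simp), ih,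
      Nat.succ_sub hn, Nat.factorial_succ, abs_sub_comm, abs_of_nonneg (by push_cast; linarith)]
    push_cast [Nat.cast_sub hn]
    ring

variable {a b δ γ M : ℝ} {n : ℕ} {x : ℕ → ℝ} {p : Polynomial ℂ}

theorem norm_eval_lagrange_basis_le (hδ : 0 < δ) (hx : ∀ i < n, x i + δ ≤ x (i + 1))
    {y : ℝ} (hy : ∀ i ≤ n, |y - x i| ≤ a) {i : ℕ} (hi : i ≤ n) :
    ‖(Lagrange.basis (Finset.range (n + 1)) (fun i : ℕ => (x i : ℂ)) i).eval (y : ℂ)‖ ≤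
      (a / δ) ^ n / n.factorial * n.choose i := by
  have hfactor : ∀ j ∈ (Finset.range (n + 1)).erase i,
      ‖(Lagrange.basisDivisor (x i : ℂ) (x j : ℂ)).eval (y : ℂ)‖ ≤ a / δ * |(i : ℝ) - j|⁻¹ := by
    intro j hj
    obtain ⟨hji, hj⟩ := Finset.mem_erase.1 hj
    have hjn : j ≤ n := Finset.mem_range_succ_iff.1 hj
    have hpos : 0 < |(i : ℝ) - j| := abs_pos.2 (sub_ne_zero.2 (Nat.cast_injective.ne hji.symm))
    have hgap : |x i - x j|⁻¹ ≤ (|(i : ℝ) - j| * δ)⁻¹ :=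
      inv_anti₀ (by positivity) (abs_sub_mul_le_of_separated hx hi hjn)
    simp only [Lagrange.basisDivisor, Polynomial.eval_mul, Polynomial.eval_C,
      Polynomial.eval_sub, Polynomial.eval_X]
    rw [← Complex.ofReal_sub, ← Complex.ofReal_sub, ← Complex.ofReal_inv, ← Complex.ofReal_mul,
      Complex.norm_real, Real.norm_eq_abs, abs_mul, abs_inv]
    calc |x i - x j|⁻¹ * |y - x j| ≤ (|(i : ℝ) - j| * δ)⁻¹ * a :=
          mul_le_mul hgap (hy j hjn) (abs_nonneg _) (by positivity)
      _ = a / δ * |(i : ℝ) - j|⁻¹ := by rw [mul_inv]; ring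
  rw [Lagrange.basis, Polynomial.eval_prod, norm_prod]
  refine (Finset.prod_le_prod (fun _ _ => norm_nonneg _) hfactor).trans_eq ?_
  rw [Finset.prod_mul_distrib, Finset.prod_const,
    Finset.card_erase_of_mem (Finset.mem_range_succ_iff.2 hi), Finset.card_range,
    Finset.prod_inv_distrib, prod_range_erase_abs_sub hi, Nat.succ_sub_one, Nat.cast_choose ℝ hi]
  have := n.factorial_ne_zero
  field_simp

theorem norm_eval_le_of_separated (hδ : 0 < δ) (hx : ∀ i < n, x i + δ ≤ x (i + 1))
    (hp : p.degree < (n + 1 : ℕ)) (hM : ∀ i ≤ n, ‖p.eval (x i : ℂ)‖ ≤ M)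
    {y : ℝ} (hy : ∀ i ≤ n, |y - x i| ≤ a) :
    ‖p.eval (y : ℂ)‖ ≤ M * ((2 * a / δ) ^ n / n.factorial) := by
  have hinj : InjOn (fun i : ℕ => (x i : ℂ)) (Finset.range (n + 1)) := fun i hi j hj hij => by
    have hgap := abs_sub_mul_le_of_separated hx
      (Finset.mem_range_succ_iff.1 hi) (Finset.mem_range_succ_iff.1 hj)
    rw [Complex.ofReal_injective hij, sub_self, abs_zero] at hgap
    exact Nat.cast_injective (sub_eq_zero.1 (abs_nonpos_iff.1 (nonpos_of_mul_nonpos_left hgap hδ)))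
  have hM₀ : 0 ≤ M := (norm_nonneg _).trans (hM 0 n.zero_le)
  rw [Lagrange.eq_interpolate (f := p) hinj (by simpa using hp), Lagrange.interpolate_apply,
    Polynomial.eval_finsetSum]
  calc ‖∑ i ∈ Finset.range (n + 1), _‖
      ≤ ∑ i ∈ Finset.range (n + 1), M * ((a / δ) ^ n / n.factorial * n.choose i) := by
        refine norm_sum_le_of_le _ fun i hi => ?_
        have hin := Finset.mem_range_succ_iff.1 hi
        rw [Polynomial.eval_mul, Polynomial.eval_C, norm_mul]
        exact mul_le_mul (hM i hin) (norm_eval_lagrange_basis_le hδ hx hy hin) (norm_nonneg _) hM₀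
    _ = M * ((2 * a / δ) ^ n / n.factorial) := by
        rw [← Finset.mul_sum, ← Finset.mul_sum, ← Nat.cast_sum, Nat.sum_range_choose,
          mul_div_assoc 2 a δ, mul_pow 2 (a / δ)]
        push_cast
        ring

theorem norm_eval_le_of_volume_ge (ha : 0 < a) (hγ : 0 < γ) (hp : p.degree < (n + 1 : ℕ))
    {E : Set ℝ} (hE : E ⊆ Icc b (b + a)) (hvol : ENNReal.ofReal (γ * a) ≤ volume E)
    (hM : ∀ y ∈ E, ‖p.eval (y : ℂ)‖ ≤ M) {y : ℝ} (hy : y ∈ Icc b (b + a)) :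
    ‖p.eval (y : ℂ)‖ ≤ M * ((2 / γ) ^ n * Real.exp (n + 1)) := by
  set δ := γ * a / (n + 1) with hδ
  have hδ₀ : 0 < δ := by positivity
  obtain ⟨x, hxE, hx⟩ := exists_separated_points hδ₀.le n (bddBelow_Icc.mono hE) <| by
    refine ((ENNReal.ofReal_lt_ofReal_iff (by positivity)).2 ?_).trans_le hvol
    rw [hδ, mul_div_assoc', div_lt_iff₀ (by positivity)]
    nlinarith [mul_pos hγ ha]
  have hM₀ : 0 ≤ M := (norm_nonneg _).trans (hM _ (hxE 0 n.zero_le))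
  refine (norm_eval_le_of_separated (a := a) hδ₀ hx hp (fun i hi => hM _ (hxE i hi))
    fun i hi => ?_).trans (mul_le_mul_of_nonneg_left ?_ hM₀)
  · have := hE (hxE i hi)
    exact abs_le.2 ⟨by linarith [hy.1, this.2], by linarith [hy.2, this.1]⟩
  · rw [show 2 * a / δ = 2 / γ * (n + 1) by rw [hδ]; field_simp, mul_pow, mul_div_assoc]
    gcongr
    exact Real.pow_div_factorial_le_exp _ (by positivity) n

theorem le_measure_inter_setOf_le {α : Type*} [MeasurableSpace α] {μ : Measure α} {f : α → ℝ≥0∞}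
    (hf : Measurable f) {E : Set α} {c s t : ℝ≥0∞} (hc : c ≠ ∞) (hs : s ≠ ∞)
    (hI : ∫⁻ x in E, f x ∂μ ≤ c * s) (hE : s + t ≤ μ E) : t ≤ μ (E ∩ {x | f x ≤ c}) := by
  have hbad : μ ({x | c < f x} ∩ E) ≤ s := by
    rw [← Measure.restrict_apply (measurableSet_lt measurable_const hf)]
    rcases eq_or_ne c 0 with rfl | hc₀
    · rw [zero_mul, nonpos_iff_eq_zero, lintegral_eq_zero_iff hf] at hI
      exact (measure_mono_null (fun x hx => hx.ne') hI).trans_le zero_le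
    · refine (ENNReal.mul_le_mul_iff_right hc₀ hc).1 (le_trans ?_ hI)
      exact (mul_le_mul' le_rfl (measure_mono fun x (hx : c < f x) => hx.le)).trans
        (mul_meas_ge_le_lintegral hf c)
  refine (ENNReal.add_le_add_iff_left hs).1 (hE.trans ?_)
  refine (measure_mono fun x hx => ?_).trans
    ((measure_union_le _ _).trans (add_le_add hbad le_rfl))
  exact (lt_or_ge c (f x)).imp (fun h => ⟨h, hx⟩) fun h => ⟨hx, h⟩

/-- The constant in the `L²` Remez inequality for polynomials of degree at most `n` and sets of
relative density `γ`. -/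
noncomputable def remezConst (γ : ℝ) (n : ℕ) : ℝ≥0∞ :=
  ENNReal.ofReal (2 / γ * ((4 / γ) ^ n * Real.exp (n + 1)) ^ 2)

theorem lintegral_Icc_enorm_eval_sq_le (ha : 0 < a) (hγ : 0 < γ) (hp : p.degree < (n + 1 : ℕ))
    {E : Set ℝ} (hE : E ⊆ Icc b (b + a)) (hvol : ENNReal.ofReal (γ * a) ≤ volume E) :
    ∫⁻ y in Icc b (b + a), ‖p.eval (y : ℂ)‖ₑ ^ 2 ≤
      remezConst γ n * ∫⁻ y in E, ‖p.eval (y : ℂ)‖ₑ ^ 2 := by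
  set I := ∫⁻ y in E, ‖p.eval (y : ℂ)‖ₑ ^ 2
  set R := (4 / γ) ^ n * Real.exp (n + 1) with hR
  rcases eq_or_ne I ∞ with hI | hI
  · rw [hI, remezConst, ENNReal.mul_top (ENNReal.ofReal_pos.2 (by positivity)).ne']
    exact le_top
  -- By Chebyshev, `|p|² ≤ c` on at least half of `E`.
  set s := ENNReal.ofReal (γ / 2 * a) with hs
  have hs₀ : s ≠ 0 := (ENNReal.ofReal_pos.2 (by positivity)).ne'
  set c := I / s with hc
  have hc_top : c ≠ ∞ := ENNReal.div_ne_top hI hs₀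
  have hcont : Continuous fun y : ℝ => ‖p.eval (y : ℂ)‖ₑ ^ 2 := by
    have : Continuous fun y : ℝ => p.eval (y : ℂ) := p.continuous.comp Complex.continuous_ofReal
    fun_prop
  have hgood : s ≤ volume (E ∩ {y : ℝ | ‖p.eval (y : ℂ)‖ₑ ^ 2 ≤ c}) := by
    refine le_measure_inter_setOf_le hcont.measurable hc_top ENNReal.ofReal_ne_top
      (ENNReal.div_mul_cancel hs₀ ENNReal.ofReal_ne_top).ge (le_trans (le_of_eq ?_) hvol)
    rw [hs, ← ENNReal.ofReal_add (by positivity) (by positivity)]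
    ring_nf
  have hpointwise : ∀ y ∈ Icc b (b + a), ‖p.eval (y : ℂ)‖ₑ ^ 2 ≤ c * ENNReal.ofReal (R ^ 2) := by
    intro y hy
    have hle : ‖p.eval (y : ℂ)‖ ≤ √c.toReal * R := by
      rw [hR, show 4 / γ = 2 / (γ / 2) by field_simp; norm_num]
      refine norm_eval_le_of_volume_ge ha (half_pos hγ) hp (inter_subset_left.trans hE) hgood
        (fun z hz => Real.le_sqrt_of_sq_le ?_) hy
      simpa using ENNReal.toReal_mono hc_top hz.2
    rw [← ofReal_norm, ← ENNReal.ofReal_pow (norm_nonneg _), ← ENNReal.ofReal_toReal hc_top,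
      ← ENNReal.ofReal_mul ENNReal.toReal_nonneg, ← Real.sq_sqrt (ENNReal.toReal_nonneg (a := c)),
      ← mul_pow]
    gcongr
  calc ∫⁻ y in Icc b (b + a), ‖p.eval (y : ℂ)‖ₑ ^ 2
      ≤ ∫⁻ _ in Icc b (b + a), c * ENNReal.ofReal (R ^ 2) :=
        setLIntegral_mono' measurableSet_Icc hpointwise
    _ = c * ENNReal.ofReal (R ^ 2) * ENNReal.ofReal a := by
        rw [setLIntegral_const, Real.volume_Icc, add_sub_cancel_left]
    _ = remezConst γ n * I := by
        rw [hc, ENNReal.div_eq_inv_mul, ← ENNReal.ofReal_inv_of_pos (by positivity), mul_assoc,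
          mul_right_comm, ← ENNReal.ofReal_mul (by positivity),
          ← ENNReal.ofReal_mul (by positivity), remezConst, ← hR]
        congr 2
        field_simp

end Remez

section ProductSets

variable {α β : Type*} [MeasurableSpace α] [MeasurableSpace β] {μ : Measure α} {ν : Measure β}
  [SFinite ν] {A : Set α} {B : Set β} {E : Set (α × β)}

theorem le_measure_setOf_le_measure_slice (hA : MeasurableSet A) (hE : MeasurableSet E)
    (hEAB : E ⊆ A ×ˢ B) {s t : ℝ≥0∞} (hs : s * μ A ≠ ∞) (hB₀ : ν B ≠ 0) (hB : ν B ≠ ∞)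
    (h : ν B * t + s * μ A ≤ μ.prod ν E) : t ≤ μ {x ∈ A | s ≤ ν (Prod.mk x ⁻¹' E)} := by
  set F := {x ∈ A | s ≤ ν (Prod.mk x ⁻¹' E)}
  have hFm : MeasurableSet F :=
    hA.inter (measurableSet_le measurable_const (measurable_measure_prodMk_left hE))
  have hslice : ∀ x, ν (Prod.mk x ⁻¹' E) ≤
      F.indicator (fun _ => ν B) x + A.indicator (fun _ => s) x := fun x => by
    by_cases hxF : x ∈ F
    · rw [indicator_of_mem hxF]
      exact le_add_right (measure_mono fun y hy => (hEAB hy).2)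
    · rw [indicator_of_notMem hxF, zero_add]
      by_cases hxA : x ∈ A
      · rw [indicator_of_mem hxA]
        exact (not_le.1 fun h => hxF ⟨hxA, h⟩).le
      · rw [eq_empty_of_forall_notMem (s := Prod.mk x ⁻¹' E) fun y hy => hxA (hEAB hy).1,
          measure_empty]
        exact zero_le
  have hle : μ.prod ν E ≤ ν B * μ F + s * μ A := by
    rw [Measure.prod_apply hE]
    refine (lintegral_mono hslice).trans_eq ?_
    rw [lintegral_add_left (measurable_const.indicator hFm), lintegral_indicator_const hFm,
      lintegral_indicator_const hA]
  exact (ENNReal.mul_le_mul_iff_right hB₀ hB).1 ((ENNReal.add_le_add_iff_right hs).1 (h.trans hle))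

theorem setLIntegral_prod_le_of_slices [SFinite μ] {g : α × β → ℝ≥0∞} (hg : Measurable g)
    (hE : MeasurableSet E) {F : Set α} (hF : MeasurableSet F) {C D : ℝ≥0∞}
    (hfst : ∀ y, ∫⁻ x in A, g (x, y) ∂μ ≤ C * ∫⁻ x in F, g (x, y) ∂μ)
    (hsnd : ∀ x ∈ F, ∫⁻ y in B, g (x, y) ∂ν ≤ D * ∫⁻ y in Prod.mk x ⁻¹' E, g (x, y) ∂ν) :
    ∫⁻ q in A ×ˢ B, g q ∂(μ.prod ν) ≤ C * (D * ∫⁻ q in E, g q ∂(μ.prod ν)) := by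
  calc ∫⁻ q in A ×ˢ B, g q ∂(μ.prod ν)
      = ∫⁻ y in B, ∫⁻ x in A, g (x, y) ∂μ ∂ν := by
        rw [← Measure.prod_restrict, lintegral_prod_symm' _ hg]
    _ ≤ ∫⁻ y in B, C * ∫⁻ x in F, g (x, y) ∂μ ∂ν := lintegral_mono hfst
    _ = C * ∫⁻ x in F, ∫⁻ y in B, g (x, y) ∂ν ∂μ := by
        rw [lintegral_const_mul _ hg.lintegral_prod_left', lintegral_lintegral_swap]
        exact (hg.comp measurable_swap).aemeasurable
    _ ≤ C * ∫⁻ x, D * ∫⁻ y in Prod.mk x ⁻¹' E, g (x, y) ∂ν ∂μ := by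
        refine mul_le_mul' le_rfl ?_
        exact (setLIntegral_mono' hF hsnd).trans (setLIntegral_le_lintegral _ _)
    _ = C * (D * ∫⁻ q in E, g q ∂(μ.prod ν)) := by
        have hslice : ∀ x, ∫⁻ y in Prod.mk x ⁻¹' E, g (x, y) ∂ν =
            ∫⁻ y, E.indicator g (x, y) ∂ν := fun x => by
          rw [← lintegral_indicator (measurable_prodMk_left hE)]
          rfl
        simp_rw [hslice]
        rw [lintegral_const_mul _ (hg.indicator hE).lintegral_prod_right',
          ← lintegral_indicator hE, lintegral_prod _ (hg.indicator hE).aemeasurable]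

theorem lintegral_square_enorm_sq_le_of_polynomial {a γ : ℝ} (ha : 0 < a) (hγ : 0 < γ) {n : ℕ}
    {h : ℝ × ℝ → ℂ} (hm : Measurable h)
    (hfst : ∀ y, ∃ p : Polynomial ℂ, p.degree < (n + 1 : ℕ) ∧ ∀ x : ℝ, h (x, y) = p.eval (x : ℂ))
    (hsnd : ∀ x, ∃ p : Polynomial ℂ, p.degree < (n + 1 : ℕ) ∧ ∀ y : ℝ, h (x, y) = p.eval (y : ℂ))
    {E : Set (ℝ × ℝ)} (hE : E ⊆ Icc 0 a ×ˢ Icc 0 a) (hEm : MeasurableSet E)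
    (hvol : ENNReal.ofReal (γ * a ^ 2) ≤ volume E) :
    ∫⁻ q in Icc 0 a ×ˢ Icc 0 a, ‖h q‖ₑ ^ 2 ≤
      remezConst (γ / 2) n ^ 2 * ∫⁻ q in E, ‖h q‖ₑ ^ 2 := by
  have hvolI : volume (Icc 0 a) = ENNReal.ofReal a := by rw [Real.volume_Icc, sub_zero]
  have hγ₂ : 0 < γ / 2 := half_pos hγ
  have hremez : ∀ {p : Polynomial ℂ}, p.degree < (n + 1 : ℕ) → ∀ {S : Set ℝ}, S ⊆ Icc 0 a →
      ENNReal.ofReal (γ / 2 * a) ≤ volume S → ∫⁻ y in Icc 0 a, ‖p.eval (y : ℂ)‖ₑ ^ 2 ≤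
        remezConst (γ / 2) n * ∫⁻ y in S, ‖p.eval (y : ℂ)‖ₑ ^ 2 := fun {p} hp {S} hS hSvol => by
    simpa only [zero_add] using
      lintegral_Icc_enorm_eval_sq_le (b := 0) ha hγ₂ hp (by rwa [zero_add]) hSvol
  set F := {x ∈ Icc 0 a | ENNReal.ofReal (γ / 2 * a) ≤ volume (Prod.mk x ⁻¹' E)}
  have hFm : MeasurableSet F := measurableSet_Icc.inter
    (measurableSet_le measurable_const (measurable_measure_prodMk_left hEm))
  have hFvol : ENNReal.ofReal (γ / 2 * a) ≤ volume F := by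
    refine le_measure_setOf_le_measure_slice measurableSet_Icc hEm hE
      (ENNReal.mul_ne_top ENNReal.ofReal_ne_top measure_Icc_lt_top.ne) (by simpa [hvolI] using ha)
      measure_Icc_lt_top.ne (le_trans (le_of_eq ?_) hvol)
    rw [hvolI, ← ENNReal.ofReal_mul ha.le, ← ENNReal.ofReal_mul (by positivity),
      ← ENNReal.ofReal_add (by positivity) (by positivity)]
    ring_nf
  rw [sq, mul_assoc, Measure.volume_eq_prod]
  refine setLIntegral_prod_le_of_slices (by fun_prop) hEm hFm (fun y => ?_) fun x hx => ?_
  · obtain ⟨p, hp, hpe⟩ := hfst y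
    simp only [hpe]
    exact hremez hp (fun x hx => hx.1) hFvol
  · obtain ⟨p, hp, hpe⟩ := hsnd x
    simp only [hpe]
    exact hremez hp (fun y hy => (hE hy).2) hx.2

end ProductSets

section Plane

/-- The point of the plane with given coordinates. -/
noncomputable def toPlane (q : ℝ × ℝ) : Plane := !₂[q.1, q.2]

@[simp] theorem toPlane_zero (q : ℝ × ℝ) : toPlane q 0 = q.1 := rfl

@[simp] theorem toPlane_one (q : ℝ × ℝ) : toPlane q 1 = q.2 := rfl

@[fun_prop]
theorem continuous_toPlane : Continuous toPlane := by
  unfold toPlane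
  fun_prop

theorem measurePreserving_toPlane : MeasurePreserving toPlane volume volume := by
  convert! (PiLp.volume_preserving_toLp (Fin 2)).comp
    ((volume_preserving_finTwoArrow ℝ).symm MeasurableEquiv.finTwoArrow) using 1

theorem inner_plane (x y : Plane) : inner ℝ x y = x 0 * y 0 + x 1 * y 1 := by
  simp [PiLp.inner_apply, mul_comm]

theorem norm_sq_plane (x : Plane) : ‖x‖ ^ 2 = x 0 ^ 2 + x 1 ^ 2 := by
  simp [EuclideanSpace.norm_sq_eq]

theorem abs_apply_le_norm (x : Plane) (i : Fin 2) : |x i| ≤ ‖x‖ := PiLp.norm_apply_le x i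

end Plane

section BandLimited

open FourierTransform

theorem enorm_sq_eq_lintegral {α E : Type*} [MeasurableSpace α] {μ : Measure α}
    [NormedAddCommGroup E] (f : Lp E 2 μ) : ‖f‖ₑ ^ 2 = ∫⁻ x, ‖f x‖ₑ ^ 2 ∂μ := by
  rw [Lp.enorm_def]
  simpa using eLpNorm_nnreal_pow_eq_lintegral (f := f) (p := 2) (μ := μ) two_ne_zero

variable {V F : Type*} [NormedAddCommGroup V] [InnerProductSpace ℝ V] [FiniteDimensional ℝ V]
  [MeasurableSpace V] [BorelSpace V] [NormedAddCommGroup F] [InnerProductSpace ℂ F]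
  [CompleteSpace F]

/-- The spectrum of `f`, i.e. the support of its Fourier transform, lies in the closed ball of
radius `K`. -/
def BandLimited (K : ℝ) (f : Lp F 2 (volume : Measure V)) : Prop :=
  ∀ᵐ ζ, ζ ∉ Metric.closedBall 0 K → (𝓕 f : Lp F 2 volume) ζ = 0

namespace BandLimited

variable {K : ℝ} {f : Lp F 2 (volume : Measure V)} {m : V → ℂ}

theorem integrable_smul_fourier (hf : BandLimited K f) (hm : Continuous m) :
    Integrable fun ζ => m ζ • (𝓕 f : Lp F 2 volume) ζ := by
  have hcompact : IsCompact (Metric.closedBall (0 : V) K) := isCompact_closedBall 0 K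
  have hball : IntegrableOn (𝓕 f : Lp F 2 volume) (Metric.closedBall 0 K) :=
    ((Lp.memLp (𝓕 f : Lp F 2 volume)).locallyIntegrable one_le_two).integrableOn_isCompact
      hcompact
  refine (hball.continuousOn_smul hm.continuousOn hcompact).integrable_of_ae_notMem_eq_zero ?_
  filter_upwards [hf] with ζ hζ hball
  rw [hζ hball, smul_zero]

theorem integrable_fourier (hf : BandLimited K f) : Integrable (𝓕 f : Lp F 2 volume) := by
  simpa using hf.integrable_smul_fourier (m := fun _ => 1) continuous_const

theorem coeFn_ae_eq_fourierInv (hf : BandLimited K f) :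
    f =ᵐ[volume] 𝓕⁻ ((𝓕 f : Lp F 2 volume) : V → F) := by
  have h := coeFn_fourierInv_of_integrable hf.integrable_fourier
  rwa [fourierInv_fourier_eq] at h

theorem lintegral_fourierInv_smul_le (hf : BandLimited K f) (hm : Continuous m) {ε : ℝ}
    (hε : ∀ ζ ∈ Metric.closedBall 0 K, ‖m ζ‖ ≤ ε) :
    ∫⁻ c, ‖𝓕⁻ (fun ζ => m ζ • (𝓕 f : Lp F 2 volume) ζ) c‖ₑ ^ 2 ≤
      ENNReal.ofReal (ε ^ 2) * ∫⁻ x, ‖f x‖ₑ ^ 2 := by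
  have hmem : MemLp ((Metric.closedBall 0 K).indicator m) ∞ (volume : Measure V) := by
    refine memLp_top_of_bound
      (hm.aestronglyMeasurable.indicator Metric.isClosed_closedBall.measurableSet) (max ε 0)
      (Eventually.of_forall fun ζ => ?_)
    by_cases hζ : ζ ∈ Metric.closedBall 0 K
    · rw [indicator_of_mem hζ]
      exact (hε ζ hζ).trans (le_max_left _ _)
    · simp [hζ]
  have hcut : mulOp hmem (𝓕 f : Lp F 2 volume) =ᵐ[volume]
      fun ζ => m ζ • (𝓕 f : Lp F 2 volume) ζ := by
    filter_upwards [coeFn_mulOp hmem (𝓕 f : Lp F 2 volume), hf] with ζ hζ hout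
    rw [hζ]
    by_cases hball : ζ ∈ Metric.closedBall 0 K
    · rw [indicator_of_mem hball]
    · rw [hout hball, smul_zero, smul_zero]
  have hinv : fourierMultiplier hmem f =ᵐ[volume]
      𝓕⁻ (fun ζ => m ζ • (𝓕 f : Lp F 2 volume) ζ) := by
    refine (coeFn_fourierInv_of_integrable
      ((hf.integrable_smul_fourier hm).congr hcut.symm)).trans (Eventually.of_forall fun c => ?_)
    simp only [Real.fourierInv_eq']
    refine integral_congr_ae ?_
    filter_upwards [hcut] with ζ hζ
    rw [hζ]
  have hnorm : ‖fourierMultiplier hmem f‖ ≤ |ε| * ‖f‖ := by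
    refine norm_fourierMultiplier_apply_le_of_ae hmem ?_
    filter_upwards [hf] with ζ hout
    by_cases hball : ζ ∈ Metric.closedBall 0 K
    · rw [indicator_of_mem hball, norm_smul]
      gcongr
      exact (hε ζ hball).trans (le_abs_self ε)
    · simp [hout hball]
  calc ∫⁻ c, ‖𝓕⁻ (fun ζ => m ζ • (𝓕 f : Lp F 2 volume) ζ) c‖ₑ ^ 2
      = ‖fourierMultiplier hmem f‖ₑ ^ 2 := by
        rw [enorm_sq_eq_lintegral]
        exact lintegral_congr_ae (hinv.fun_comp (‖·‖ₑ ^ 2)).symm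
    _ ≤ ENNReal.ofReal (ε ^ 2) * ‖f‖ₑ ^ 2 := by
        rw [← ofReal_norm, ← ofReal_norm, ← ENNReal.ofReal_pow (norm_nonneg _),
          ← ENNReal.ofReal_pow (norm_nonneg _), ← ENNReal.ofReal_mul (sq_nonneg _), ← sq_abs ε,
          ← mul_pow]
        gcongr
    _ = ENNReal.ofReal (ε ^ 2) * ∫⁻ x, ‖f x‖ₑ ^ 2 := by rw [enorm_sq_eq_lintegral]

end BandLimited

end BandLimited

section Taylor

open FourierTransform

/-- The Taylor polynomial of degree `n` of `s ↦ exp (i s)`. -/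
noncomputable def taylorExp (n : ℕ) (s : ℝ) : ℂ :=
  ∑ k ∈ Finset.range (n + 1), ((s : ℂ) * Complex.I) ^ k / k.factorial

@[fun_prop]
theorem continuous_taylorExp (n : ℕ) : Continuous (taylorExp n) := by
  unfold taylorExp
  fun_prop

theorem norm_exp_sub_taylorExp_le {n : ℕ} {S s : ℝ} (hS : 2 * S ≤ n + 1) (hs : |s| ≤ S) :
    ‖Complex.exp (s * Complex.I) - taylorExp n s‖ ≤ 2 * (S ^ (n + 1) / (n + 1).factorial) := by
  have hnorm : ‖(s : ℂ) * Complex.I‖ = |s| := by simp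
  have h := Complex.exp_bound' (x := (s : ℂ) * Complex.I) (n := n + 1) (by
    rw [hnorm, div_le_iff₀ (by positivity)]
    push_cast
    linarith)
  rw [hnorm] at h
  refine h.trans ?_
  rw [mul_comm]
  gcongr

theorem norm_exp_add_sub_taylorExp_mul_le {n : ℕ} {S s t : ℝ} (hS : 2 * S ≤ n + 1)
    (hs : |s| ≤ S) (ht : |t| ≤ S) (hsmall : 2 * (S ^ (n + 1) / (n + 1).factorial) ≤ 1) :
    ‖Complex.exp ((s + t : ℝ) * Complex.I) - taylorExp n s * taylorExp n t‖ ≤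
      6 * (S ^ (n + 1) / (n + 1).factorial) := by
  set e := 2 * (S ^ (n + 1) / (n + 1).factorial)
  have hes : ‖Complex.exp (s * Complex.I) - taylorExp n s‖ ≤ e := norm_exp_sub_taylorExp_le hS hs
  have het : ‖Complex.exp (t * Complex.I) - taylorExp n t‖ ≤ e := norm_exp_sub_taylorExp_le hS ht
  have hT : ‖taylorExp n t‖ ≤ 2 := by
    have h := norm_sub_norm_le (taylorExp n t) (Complex.exp (t * Complex.I))
    rw [Complex.norm_exp_ofReal_mul_I, norm_sub_rev] at h
    linarith
  calc ‖Complex.exp ((s + t : ℝ) * Complex.I) - taylorExp n s * taylorExp n t‖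
      = ‖Complex.exp (s * Complex.I) * (Complex.exp (t * Complex.I) - taylorExp n t) +
          (Complex.exp (s * Complex.I) - taylorExp n s) * taylorExp n t‖ := by
        push_cast
        rw [add_mul, Complex.exp_add]
        ring_nf
    _ ≤ 1 * e + e * 2 := by
        refine (norm_add_le _ _).trans ?_
        rw [norm_mul, norm_mul, Complex.norm_exp_ofReal_mul_I]
        gcongr
        exact (norm_nonneg _).trans hes
    _ = 6 * (S ^ (n + 1) / (n + 1).factorial) := by ring

theorem taylorExp_mul (n : ℕ) (x u : ℝ) : taylorExp n (x * u) =
    ∑ k ∈ Finset.range (n + 1), (x : ℂ) ^ k * ((u * Complex.I) ^ k / k.factorial) := by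
  refine Finset.sum_congr rfl fun k _ => ?_
  push_cast
  ring

theorem exists_polynomial_sum_pow_mul (n : ℕ) (b : ℕ → ℂ) :
    ∃ p : Polynomial ℂ, p.degree < (n : ℕ) ∧
      ∀ x : ℂ, ∑ k ∈ Finset.range n, x ^ k * b k = p.eval x := by
  refine ⟨∑ k ∈ Finset.range n, Polynomial.C (b k) * Polynomial.X ^ k, ?_, fun x => ?_⟩
  · rw [← Polynomial.mem_degreeLT]
    refine Submodule.sum_mem _ fun k hk => Polynomial.mem_degreeLT.2 ?_
    exact (Polynomial.degree_C_mul_X_pow_le _ _).trans_lt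
      (by exact_mod_cast Finset.mem_range.1 hk)
  · simp [Polynomial.eval_finsetSum, mul_comm (x ^ _)]

theorem BandLimited.exists_polynomial_fourierInv_taylorExp {V : Type*} [NormedAddCommGroup V]
    [InnerProductSpace ℝ V] [FiniteDimensional ℝ V] [MeasurableSpace V] [BorelSpace V] {K : ℝ}
    {f : Lp ℂ 2 (volume : Measure V)} (hf : BandLimited K f) (n : ℕ) {m : V → ℂ}
    (hm : Continuous m) {u : V → ℝ} (hu : Continuous u) (c : V) :
    ∃ p : Polynomial ℂ, p.degree < (n + 1 : ℕ) ∧ ∀ x : ℝ,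
      𝓕⁻ (fun ζ => (taylorExp n (x * u ζ) * m ζ) • (𝓕 f : Lp ℂ 2 volume) ζ) c =
        p.eval (x : ℂ) := by
  obtain ⟨p, hp, hpeval⟩ := exists_polynomial_sum_pow_mul (n + 1) fun k =>
    𝓕⁻ (fun ζ => ((u ζ * Complex.I) ^ k / k.factorial * m ζ) • (𝓕 f : Lp ℂ 2 volume) ζ) c
  refine ⟨p, hp, fun x => ?_⟩
  rw [← hpeval]
  simp only [Real.fourierInv_eq', smul_eq_mul]
  simp_rw [← integral_const_mul]
  rw [← integral_finsetSum]
  · congr 1 with ζ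
    rw [taylorExp_mul, Finset.sum_mul, Finset.sum_mul, Finset.mul_sum]
    refine Finset.sum_congr rfl fun k _ => ?_
    ring
  · intro k _
    have h := hf.integrable_smul_fourier
      (m := fun ζ => Complex.exp (↑(2 * Real.pi * inner ℝ ζ c) * Complex.I) *
        ((u ζ * Complex.I) ^ k / k.factorial * m ζ)) (by fun_prop)
    simp only [smul_eq_mul, mul_assoc] at h ⊢
    exact h.const_mul _

end Taylor

section Averaging

theorem enorm_sq_le_two_mul_add {E : Type*} [NormedAddCommGroup E] (x y : E) :
    ‖x‖ₑ ^ 2 ≤ 2 * ‖y‖ₑ ^ 2 + 2 * ‖x - y‖ₑ ^ 2 := by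
  have hadd : ‖x‖ₑ ≤ ‖y‖ₑ + ‖x - y‖ₑ := by simpa using enorm_add_le y (x - y)
  have hpow := ENNReal.rpow_add_le_mul_rpow_add_rpow ‖y‖ₑ ‖x - y‖ₑ one_le_two
  norm_num at hpow
  rw [← mul_add]
  exact (pow_le_pow_left' hadd 2).trans hpow

variable {β E : Type*} [MeasurableSpace β] [NormedAddCommGroup E] [MeasurableSpace E]
  [BorelSpace E] [SecondCountableTopology E]

theorem lintegral_enorm_sq_le_two_mul_add (ν : Measure β) {f g : β → E} (hf : Measurable f)
    (hg : Measurable g) : ∫⁻ x, ‖f x‖ₑ ^ 2 ∂ν ≤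
      2 * (∫⁻ x, ‖g x‖ₑ ^ 2 ∂ν) + 2 * ∫⁻ x, ‖f x - g x‖ₑ ^ 2 ∂ν := by
  rw [← lintegral_const_mul _ (by fun_prop), ← lintegral_const_mul _ (by fun_prop),
    ← lintegral_add_left (by fun_prop)]
  exact lintegral_mono fun x => enorm_sq_le_two_mul_add _ _

theorem lintegral_enorm_sq_le_of_approx {ν : Measure β} {f g : β → E} (hf : Measurable f)
    (hg : Measurable g) {s : Set β} {C : ℝ≥0∞}
    (h : ∫⁻ x, ‖g x‖ₑ ^ 2 ∂ν ≤ C * ∫⁻ x in s, ‖g x‖ₑ ^ 2 ∂ν) :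
    ∫⁻ x, ‖f x‖ₑ ^ 2 ∂ν ≤ 4 * C * (∫⁻ x in s, ‖f x‖ₑ ^ 2 ∂ν) +
      (4 * C + 2) * ∫⁻ x, ‖f x - g x‖ₑ ^ 2 ∂ν := by
  have herror : ∫⁻ x in s, ‖g x - f x‖ₑ ^ 2 ∂ν ≤ ∫⁻ x, ‖f x - g x‖ₑ ^ 2 ∂ν := by
    simp_rw [enorm_sub_rev (g _)]
    exact setLIntegral_le_lintegral s _
  calc ∫⁻ x, ‖f x‖ₑ ^ 2 ∂ν
      ≤ 2 * (∫⁻ x, ‖g x‖ₑ ^ 2 ∂ν) + 2 * ∫⁻ x, ‖f x - g x‖ₑ ^ 2 ∂ν :=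
        lintegral_enorm_sq_le_two_mul_add ν hf hg
    _ ≤ 2 * (C * (2 * (∫⁻ x in s, ‖f x‖ₑ ^ 2 ∂ν) + 2 * ∫⁻ x, ‖f x - g x‖ₑ ^ 2 ∂ν)) +
          2 * ∫⁻ x, ‖f x - g x‖ₑ ^ 2 ∂ν := by
        gcongr
        refine h.trans ?_
        gcongr
        refine (lintegral_enorm_sq_le_two_mul_add _ hg hf).trans ?_
        gcongr
    _ = _ := by ring

variable {G : Type*} [AddGroup G] [MeasurableSpace G] [MeasurableAdd₂ G] {μ : Measure G}
  [SFinite μ] [μ.IsAddRightInvariant] {ν : Measure β} [SFinite ν] {φ : β → G}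

theorem lintegral_lintegral_add_right (hφ : Measurable φ) {g : G → ℝ≥0∞} (hg : Measurable g) :
    ∫⁻ c, ∫⁻ q, g (c + φ q) ∂ν ∂μ = ν univ * ∫⁻ x, g x ∂μ := by
  rw [lintegral_lintegral_swap (by fun_prop)]
  simp_rw [lintegral_add_right_eq_self, lintegral_const, mul_comm]

theorem lintegral_setLIntegral_add_right (hφ : Measurable φ) {s : Set G} (hs : MeasurableSet s)
    {g : G → ℝ≥0∞} (hg : Measurable g) :
    ∫⁻ c, ∫⁻ q in {q | c + φ q ∈ s}, g (c + φ q) ∂ν ∂μ = ν univ * ∫⁻ x in s, g x ∂μ := by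
  rw [← lintegral_indicator hs, ← lintegral_lintegral_add_right hφ (hg.indicator hs)]
  congr 1 with c
  have hpreimage : MeasurableSet {q | c + φ q ∈ s} := hφ.const_add c hs
  rw [← lintegral_indicator hpreimage]
  rfl

theorem lintegral_enorm_sq_le_of_translates_approx [IsFiniteMeasure ν] (hν : ν ≠ 0)
    (hφ : Measurable φ) {s : Set G} (hs : MeasurableSet s) {F : G → E} (hF : Measurable F)
    {A : G → β → E} (hA : Measurable (Function.uncurry A)) {C η : ℝ≥0∞} (hC : C ≠ ∞)
    (hlocal : ∀ c, ∫⁻ q, ‖A c q‖ₑ ^ 2 ∂ν ≤ C * ∫⁻ q in {q | c + φ q ∈ s}, ‖A c q‖ₑ ^ 2 ∂ν)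
    (herror : ∀ᵐ q ∂ν, ∫⁻ c, ‖F (c + φ q) - A c q‖ₑ ^ 2 ∂μ ≤ η) :
    ∫⁻ x, ‖F x‖ₑ ^ 2 ∂μ ≤ 4 * C * (∫⁻ x in s, ‖F x‖ₑ ^ 2 ∂μ) + (4 * C + 2) * η := by
  have hFφ : Measurable fun z : G × β => F (z.1 + φ z.2) := by fun_prop
  have hdiff : Measurable fun z : G × β => ‖F (z.1 + φ z.2) - A z.1 z.2‖ₑ ^ 2 :=
    (hFφ.sub hA).enorm.pow_const 2
  have hdiffInt : Measurable fun c => ∫⁻ q, ‖F (c + φ q) - A c q‖ₑ ^ 2 ∂ν :=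
    hdiff.lintegral_prod_right'
  have htotal : ∫⁻ c, ∫⁻ q, ‖F (c + φ q) - A c q‖ₑ ^ 2 ∂ν ∂μ ≤ ν univ * η := by
    rw [lintegral_lintegral_swap hdiff.aemeasurable, mul_comm, ← lintegral_const]
    exact lintegral_mono_ae herror
  refine (ENNReal.mul_le_mul_iff_right (Measure.measure_univ_ne_zero.2 hν)
    (measure_ne_top ν univ)).1 ?_
  calc ν univ * ∫⁻ x, ‖F x‖ₑ ^ 2 ∂μ
      = ∫⁻ c, ∫⁻ q, ‖F (c + φ q)‖ₑ ^ 2 ∂ν ∂μ :=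
        (lintegral_lintegral_add_right hφ (hF.enorm.pow_const 2)).symm
    _ ≤ ∫⁻ c, (4 * C * (∫⁻ q in {q | c + φ q ∈ s}, ‖F (c + φ q)‖ₑ ^ 2 ∂ν) +
          (4 * C + 2) * ∫⁻ q, ‖F (c + φ q) - A c q‖ₑ ^ 2 ∂ν) ∂μ :=
        lintegral_mono fun c => lintegral_enorm_sq_le_of_approx
          (hFφ.comp measurable_prodMk_left) (hA.comp measurable_prodMk_left) (hlocal c)
    _ ≤ 4 * C * (ν univ * ∫⁻ x in s, ‖F x‖ₑ ^ 2 ∂μ) + (4 * C + 2) * (ν univ * η) := by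
        rw [lintegral_add_right _ (hdiffInt.const_mul _), lintegral_const_mul _ hdiffInt,
          lintegral_const_mul' _ _ (ENNReal.mul_ne_top ENNReal.ofNat_ne_top hC),
          lintegral_setLIntegral_add_right hφ hs (hF.enorm.pow_const 2)]
        gcongr
    _ = _ := by ring

end Averaging

section Spectral

open FourierTransform

/-- The symbol approximating the translation by `q`, a polynomial in each coordinate of `q`. -/
noncomputable def taylorSymbol (n : ℕ) (q : ℝ × ℝ) (ζ : Plane) : ℂ :=
  taylorExp n (q.1 * (2 * Real.pi * ζ 0)) * taylorExp n (q.2 * (2 * Real.pi * ζ 1))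

/-- The Taylor approximation of `f (c + q)` for a band-limited `f`: on the Fourier side the
translation is replaced by `taylorSymbol n q`. -/
noncomputable def taylorApprox (n : ℕ) (f : Lp ℂ 2 (volume : Measure Plane)) (c : Plane)
    (q : ℝ × ℝ) : ℂ :=
  𝓕⁻ (fun ζ => taylorSymbol n q ζ • (𝓕 f : Lp ℂ 2 volume) ζ) c

variable {K : ℝ} {f : Lp ℂ 2 (volume : Measure Plane)} {n : ℕ} {γ a : ℝ} {ω : Set Plane}

theorem norm_exp_inner_sub_taylorSymbol_le {S : ℝ} (ha : 0 < a) (hS : 2 * S ≤ n + 1)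
    (hKS : 2 * Real.pi * (a * K) ≤ S) (hsmall : 2 * (S ^ (n + 1) / (n + 1).factorial) ≤ 1)
    {q : ℝ × ℝ} (hq : q ∈ Icc 0 a ×ˢ Icc 0 a) {ζ : Plane} (hζ : ζ ∈ Metric.closedBall 0 K) :
    ‖Complex.exp ((2 * Real.pi * inner ℝ ζ (toPlane q) : ℝ) * Complex.I) - taylorSymbol n q ζ‖ ≤
      6 * (S ^ (n + 1) / (n + 1).factorial) := by
  have hcoord : ∀ (x : ℝ) (i : Fin 2), x ∈ Icc 0 a → |x * (2 * Real.pi * ζ i)| ≤ S := by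
    intro x i hx
    calc |x * (2 * Real.pi * ζ i)| = 2 * Real.pi * (x * |ζ i|) := by
          rw [abs_mul, abs_mul, abs_of_nonneg Real.two_pi_pos.le, abs_of_nonneg hx.1]
          ring
      _ ≤ 2 * Real.pi * (a * K) := by
          have hζi : |ζ i| ≤ K := (abs_apply_le_norm ζ i).trans (mem_closedBall_zero_iff.1 hζ)
          gcongr
          exact hx.2
      _ ≤ S := hKS
  have hphase : 2 * Real.pi * inner ℝ ζ (toPlane q) =
      q.1 * (2 * Real.pi * ζ 0) + q.2 * (2 * Real.pi * ζ 1) := by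
    rw [inner_plane, toPlane_zero, toPlane_one]
    ring
  rw [hphase]
  exact norm_exp_add_sub_taylorExp_mul_le hS (hcoord q.1 0 hq.1) (hcoord q.2 1 hq.2) hsmall

theorem measurable_taylorApprox (n : ℕ) (f : Lp ℂ 2 (volume : Measure Plane)) :
    Measurable (Function.uncurry (taylorApprox n f)) := by
  simp only [Function.uncurry_def, taylorApprox, taylorSymbol, Real.fourierInv_eq']
  refine (StronglyMeasurable.integral_prod_right ?_).measurable
  have hf : Measurable fun z : (Plane × ℝ × ℝ) × Plane => (𝓕 f : Lp ℂ 2 volume) z.2 :=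
    (Lp.stronglyMeasurable _).measurable.comp measurable_snd
  have hsymbol : Continuous fun z : (Plane × ℝ × ℝ) × Plane =>
      Complex.exp ((2 * Real.pi * inner ℝ z.2 z.1.1 : ℝ) * Complex.I) *
        (taylorExp n (z.1.2.1 * (2 * Real.pi * z.2 0)) *
          taylorExp n (z.1.2.2 * (2 * Real.pi * z.2 1))) := by fun_prop
  simp only [Function.uncurry_def, ← mul_smul]
  exact (hsymbol.measurable.smul hf).stronglyMeasurable

theorem fourierInv_add_sub_taylorApprox (hf : BandLimited K f) (n : ℕ) (c : Plane) (q : ℝ × ℝ) :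
    𝓕⁻ ((𝓕 f : Lp ℂ 2 volume) : Plane → ℂ) (c + toPlane q) - taylorApprox n f c q =
      𝓕⁻ (fun ζ => (Complex.exp ((2 * Real.pi * inner ℝ ζ (toPlane q) : ℝ) * Complex.I) -
        taylorSymbol n q ζ) • (𝓕 f : Lp ℂ 2 volume) ζ) c := by
  simp only [taylorApprox, Real.fourierInv_eq']
  rw [← integral_sub]
  · congr 1 with ζ
    rw [inner_add_right, mul_add, Complex.ofReal_add, add_mul, Complex.exp_add]
    simp only [smul_eq_mul]
    ring
  · exact hf.integrable_smul_fourier (by fun_prop)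
  · simp only [← mul_smul, taylorSymbol]
    exact hf.integrable_smul_fourier (by fun_prop)

theorem lintegral_fourierInv_sub_taylorApprox_le {S : ℝ} (ha : 0 < a) (hS : 2 * S ≤ n + 1)
    (hKS : 2 * Real.pi * (a * K) ≤ S) (hsmall : 2 * (S ^ (n + 1) / (n + 1).factorial) ≤ 1)
    (hf : BandLimited K f) {q : ℝ × ℝ} (hq : q ∈ Icc 0 a ×ˢ Icc 0 a) :
    ∫⁻ c, ‖𝓕⁻ ((𝓕 f : Lp ℂ 2 volume) : Plane → ℂ) (c + toPlane q) -
        taylorApprox n f c q‖ₑ ^ 2 ≤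
      ENNReal.ofReal ((6 * (S ^ (n + 1) / (n + 1).factorial)) ^ 2) * ∫⁻ x, ‖f x‖ₑ ^ 2 := by
  simp_rw [fourierInv_add_sub_taylorApprox hf n]
  refine hf.lintegral_fourierInv_smul_le ?_ fun ζ hζ =>
    norm_exp_inner_sub_taylorSymbol_le ha hS hKS hsmall hq hζ
  unfold taylorSymbol
  fun_prop

theorem measurableSet_cube {d : ℕ} (x : EuclideanSpace ℝ (Fin d)) (a : ℝ) :
    MeasurableSet (cube x a) := by
  refine MeasurableSet.congr (s := ⋂ i, {p | x i ≤ p i} ∩ {p | p i ≤ x i + a})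
    (MeasurableSet.iInter fun i => ?_) (by ext p; simp [cube])
  exact (measurableSet_le (by fun_prop) (by fun_prop)).inter
    (measurableSet_le (by fun_prop) (by fun_prop))

theorem IsThick.le_volume_translate (hthick : IsThick γ a ω) (hω : MeasurableSet ω) (c : Plane) :
    ENNReal.ofReal (γ * a ^ 2) ≤
      volume ({q : ℝ × ℝ | c + toPlane q ∈ ω} ∩ Icc 0 a ×ˢ Icc 0 a) := by
  have htranslate : MeasurePreserving (fun q : ℝ × ℝ => c + toPlane q) volume volume :=
    (measurePreserving_add_left volume c).comp measurePreserving_toPlane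
  refine (hthick c).trans (le_of_eq ?_)
  rw [← htranslate.measure_preimage (hω.inter (measurableSet_cube c a)).nullMeasurableSet]
  congr 1
  ext ⟨x, y⟩
  simp [cube, Fin.forall_fin_two, and_and_and_comm]

theorem lintegral_taylorApprox_le (hγ : 0 < γ) (ha : 0 < a) (hω : MeasurableSet ω)
    (hthick : IsThick γ a ω) (hf : BandLimited K f) (n : ℕ) (c : Plane) :
    ∫⁻ q in Icc 0 a ×ˢ Icc 0 a, ‖taylorApprox n f c q‖ₑ ^ 2 ≤ remezConst (γ / 2) n ^ 2 *
      ∫⁻ q in {q : ℝ × ℝ | c + toPlane q ∈ ω} ∩ Icc 0 a ×ˢ Icc 0 a,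
        ‖taylorApprox n f c q‖ₑ ^ 2 := by
  have hpreimage : MeasurableSet {q : ℝ × ℝ | c + toPlane q ∈ ω} :=
    (continuous_toPlane.measurable.const_add c) hω
  refine lintegral_square_enorm_sq_le_of_polynomial ha hγ
    ((measurable_taylorApprox n f).comp measurable_prodMk_left) (fun y => ?_) (fun x => ?_)
    inter_subset_right (hpreimage.inter (measurableSet_Icc.prod measurableSet_Icc))
    (hthick.le_volume_translate hω c)
  · exact hf.exists_polynomial_fourierInv_taylorExp n
      (m := fun ζ => taylorExp n (y * (2 * Real.pi * ζ 1)))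
      (u := fun ζ => 2 * Real.pi * ζ 0) (by fun_prop) (by fun_prop) c
  · obtain ⟨p, hp, hpeval⟩ := hf.exists_polynomial_fourierInv_taylorExp n
      (m := fun ζ => taylorExp n (x * (2 * Real.pi * ζ 0)))
      (u := fun ζ => 2 * Real.pi * ζ 1) (by fun_prop) (by fun_prop) c
    refine ⟨p, hp, fun y => ?_⟩
    rw [← hpeval y]
    simp only [Function.comp_apply, Function.uncurry_apply_pair, taylorApprox, taylorSymbol,
      mul_comm (taylorExp n (x * _))]

theorem lintegral_le_of_bandLimited {S : ℝ} (hγ : 0 < γ) (ha : 0 < a) (hω : MeasurableSet ω)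
    (hthick : IsThick γ a ω) (hS : 2 * S ≤ n + 1) (hKS : 2 * Real.pi * (a * K) ≤ S)
    (hsmall : 2 * (S ^ (n + 1) / (n + 1).factorial) ≤ 1) (hf : BandLimited K f) :
    ∫⁻ x, ‖f x‖ₑ ^ 2 ≤ 4 * remezConst (γ / 2) n ^ 2 * (∫⁻ x in ω, ‖f x‖ₑ ^ 2) +
      (4 * remezConst (γ / 2) n ^ 2 + 2) *
        (ENNReal.ofReal ((6 * (S ^ (n + 1) / (n + 1).factorial)) ^ 2) * ∫⁻ x, ‖f x‖ₑ ^ 2) := by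
  have hF : Continuous (𝓕⁻ ((𝓕 f : Lp ℂ 2 volume) : Plane → ℂ)) :=
    continuous_fourierInv_of_integrable hf.integrable_fourier
  have hFf : (‖f ·‖ₑ ^ 2) =ᵐ[volume] fun x => ‖𝓕⁻ ((𝓕 f : Lp ℂ 2 volume) : Plane → ℂ) x‖ₑ ^ 2 :=
    hf.coeFn_ae_eq_fourierInv.fun_comp (‖·‖ₑ ^ 2)
  have hQm : MeasurableSet (Icc 0 a ×ˢ Icc 0 a) := measurableSet_Icc.prod measurableSet_Icc
  have hQ : volume (Icc 0 a ×ˢ Icc 0 a) = ENNReal.ofReal a * ENNReal.ofReal a := by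
    rw [Measure.volume_eq_prod, Measure.prod_prod, Real.volume_Icc, sub_zero]
  have : IsFiniteMeasure ((volume : Measure (ℝ × ℝ)).restrict (Icc 0 a ×ˢ Icc 0 a)) :=
    isFiniteMeasure_restrict.2 (by rw [hQ]; finiteness)
  have hmain := lintegral_enorm_sq_le_of_translates_approx (μ := (volume : Measure Plane))
    (ν := (volume : Measure (ℝ × ℝ)).restrict (Icc 0 a ×ˢ Icc 0 a)) (s := ω) (φ := toPlane)
    (C := remezConst (γ / 2) n ^ 2)
    (Measure.restrict_eq_zero.not.2 (by rw [hQ]; simp [ha])) continuous_toPlane.measurable hω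
    hF.measurable (measurable_taylorApprox n f)
    (ENNReal.pow_ne_top ENNReal.ofReal_ne_top) (fun c => ?_)
    ((ae_restrict_iff' hQm).2 (Eventually.of_forall fun q hq =>
      lintegral_fourierInv_sub_taylorApprox_le ha hS hKS hsmall hf hq))
  · have hFω := lintegral_congr_ae (ae_restrict_of_ae (s := ω) hFf)
    rwa [← hFω, ← lintegral_congr_ae hFf] at hmain
  · have hpreimage : MeasurableSet {q : ℝ × ℝ | c + toPlane q ∈ ω} :=
      continuous_toPlane.measurable.const_add c hω
    rw [Measure.restrict_restrict hpreimage]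
    exact lintegral_taylorApprox_le hγ ha hω hthick hf n c

end Spectral

section CutOff

variable {α E : Type*} [MeasurableSpace α] {μ : Measure α} [NormedAddCommGroup E]
  [NormedSpace ℂ E] {s : Set α}

theorem memLp_top_indicator_one (hs : NullMeasurableSet s μ) :
    MemLp (s.indicator fun _ => (1 : ℂ)) ∞ μ := by
  refine memLp_top_of_bound (aestronglyMeasurable_const.indicator₀ hs) 1
    (Eventually.of_forall fun x => ?_)
  by_cases hx : x ∈ s <;> simp [hx]

/-- Multiplication by the indicator function of `s`, as an operator on `Lᵖ`. -/
noncomputable def cutOp {p : ℝ≥0∞} [Fact (1 ≤ p)] (hs : NullMeasurableSet s μ) :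
    Lp E p μ →L[ℂ] Lp E p μ :=
  mulOp (memLp_top_indicator_one hs)

theorem coeFn_cutOp {p : ℝ≥0∞} [Fact (1 ≤ p)] (hs : NullMeasurableSet s μ) (f : Lp E p μ) :
    cutOp hs f =ᵐ[μ] s.indicator f := by
  refine (coeFn_mulOp _ f).trans (Eventually.of_forall fun x => ?_)
  by_cases hx : x ∈ s <;> simp [hx]

theorem enorm_cutOp_sq (hs : NullMeasurableSet s μ) (f : Lp E 2 μ) :
    ‖cutOp hs f‖ₑ ^ 2 = ∫⁻ x in s, ‖f x‖ₑ ^ 2 ∂μ := by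
  rw [enorm_sq_eq_lintegral, ← lintegral_indicator₀ hs]
  refine lintegral_congr_ae ?_
  filter_upwards [coeFn_cutOp hs f] with x hx
  rw [hx]
  by_cases hs : x ∈ s <;> simp [hs]

end CutOff

section SpectralInequality

theorem IsThick.congr_ae {d : ℕ} {γ a : ℝ} {s t : Set (EuclideanSpace ℝ (Fin d))}
    (h : IsThick γ a s) (hst : t =ᵐ[volume] s) : IsThick γ a t := fun x =>
  (h x).trans (measure_congr (ae_eq_set_inter hst.symm (ae_eq_refl _))).le

/-- The base of the exponential bound `remezConst_le` for the Remez constant. -/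
noncomputable def remezBase (γ : ℝ) : ℝ := 8 * Real.exp 1 / γ

theorem one_lt_remezBase {γ : ℝ} (hγ : 0 < γ) (hγ₁ : γ ≤ 1) : 1 < remezBase γ := by
  rw [remezBase, lt_div_iff₀ hγ]
  linarith [Real.add_one_le_exp 1]

theorem remezConst_le {γ : ℝ} (hγ : 0 < γ) (hγ₁ : γ ≤ 1) (n : ℕ) :
    remezConst (γ / 2) n ≤ ENNReal.ofReal (remezBase γ ^ (3 * (n + 1))) := by
  have hbase : 1 ≤ remezBase γ := (one_lt_remezBase hγ hγ₁).le
  have hfirst : 2 / (γ / 2) ≤ remezBase γ ^ (n + 1) := by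
    calc 2 / (γ / 2) = 4 / γ := by field_simp; norm_num
      _ ≤ remezBase γ := by
        rw [remezBase]
        gcongr
        linarith [Real.add_one_le_exp 1]
      _ ≤ remezBase γ ^ (n + 1) := le_self_pow₀ hbase n.succ_ne_zero
  have hsecond : (4 / (γ / 2)) ^ n * Real.exp (n + 1) ≤ remezBase γ ^ (n + 1) := by
    have hexp : Real.exp (n + 1) = Real.exp 1 ^ (n + 1) := by
      rw [← Real.exp_nat_mul]
      push_cast
      ring_nf
    have hone : 1 ≤ 8 / γ := by
      rw [le_div_iff₀ hγ]
      linarith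
    calc (4 / (γ / 2)) ^ n * Real.exp (n + 1) = (8 / γ) ^ n * Real.exp 1 ^ (n + 1) := by
          rw [hexp]
          congr 2
          field_simp
          norm_num
      _ ≤ (8 / γ) ^ (n + 1) * Real.exp 1 ^ (n + 1) := by
          gcongr
          exact n.le_succ
      _ = remezBase γ ^ (n + 1) := by rw [remezBase, mul_div_right_comm, mul_pow]
  refine ENNReal.ofReal_le_ofReal ?_
  calc 2 / (γ / 2) * ((4 / (γ / 2)) ^ n * Real.exp (n + 1)) ^ 2
      ≤ remezBase γ ^ (n + 1) * (remezBase γ ^ (n + 1)) ^ 2 := by gcongr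
    _ = remezBase γ ^ (3 * (n + 1)) := by ring

theorem pow_div_factorial_le {l S : ℝ} {n : ℕ} (hl : 0 < l) (hS : 0 ≤ S) (h : l * S ≤ n) :
    S ^ n / n.factorial ≤ (Real.exp 1 / l) ^ n := by
  calc S ^ n / n.factorial ≤ (n / l) ^ n / n.factorial := by
        gcongr
        rwa [le_div_iff₀ hl, mul_comm]
    _ = (n : ℝ) ^ n / n.factorial / l ^ n := by rw [div_pow, div_right_comm]
    _ ≤ Real.exp n / l ^ n := by
        gcongr
        exact Real.pow_div_factorial_le_exp _ n.cast_nonneg n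
    _ = (Real.exp 1 / l) ^ n := by rw [div_pow, ← Real.exp_nat_mul, mul_one]

variable {γ a K : ℝ} {ω : Set Plane} {f : Lp ℂ 2 (volume : Measure Plane)} {n : ℕ}

theorem norm_sq_le_add_of_bandLimited {S θ : ℝ} (hγ : 0 < γ) (ha : 0 < a)
    (hω : NullMeasurableSet ω volume) (hthick : IsThick γ a ω) (hS : 2 * S ≤ n + 1)
    (hKS : 2 * Real.pi * (a * K) ≤ S) (hsmall : 2 * (S ^ (n + 1) / (n + 1).factorial) ≤ 1)
    (hθ : 0 ≤ θ) (hremez : remezConst (γ / 2) n ≤ ENNReal.ofReal θ) (hf : BandLimited K f) :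
    ‖f‖ ^ 2 ≤ 4 * θ ^ 2 * ‖cutOp hω f‖ ^ 2 +
      (4 * θ ^ 2 + 2) * ((6 * (S ^ (n + 1) / (n + 1).factorial)) ^ 2 * ‖f‖ ^ 2) := by
  obtain ⟨ω', -, hω', hωω'⟩ := hω.exists_measurable_subset_ae_eq
  have h := lintegral_le_of_bandLimited hγ ha hω' (hthick.congr_ae hωω') hS hKS hsmall hf
  rw [← enorm_sq_eq_lintegral, Measure.restrict_congr_set hωω', ← enorm_cutOp_sq hω] at h
  refine (ENNReal.ofReal_le_ofReal_iff (by positivity)).1 ?_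
  rw [ENNReal.ofReal_add (by positivity) (by positivity), ENNReal.ofReal_mul (by positivity),
    ENNReal.ofReal_mul (by positivity), ENNReal.ofReal_mul (p := 4 * θ ^ 2 + 2) (by positivity),
    ENNReal.ofReal_mul (q := ‖f‖ ^ 2) (by positivity),
    ENNReal.ofReal_add (by positivity) (by positivity),
    ENNReal.ofReal_mul (q := θ ^ 2) (by positivity), ENNReal.ofReal_pow (norm_nonneg f),
    ENNReal.ofReal_pow (norm_nonneg (cutOp hω f)), ENNReal.ofReal_pow hθ, ofReal_norm, ofReal_norm,
    ENNReal.ofReal_ofNat, ENNReal.ofReal_ofNat]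
  refine h.trans ?_
  gcongr

theorem norm_sq_le_of_bandLimited (hγ : 0 < γ) (hγ₁ : γ ≤ 1) (ha : 0 < a)
    (hω : NullMeasurableSet ω volume) (hthick : IsThick γ a ω) (hK : 0 ≤ K)
    (hn : 32 * Real.exp 1 * remezBase γ ^ 3 * (2 * Real.pi * (a * K)) ≤ n)
    (hf : BandLimited K f) :
    ‖f‖ ^ 2 ≤ 8 * (remezBase γ ^ (3 * (n + 1))) ^ 2 * ‖cutOp hω f‖ ^ 2 := by
  set R := remezBase γ
  set θ := R ^ (3 * (n + 1)) with hθ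
  set S := 2 * Real.pi * (a * K)
  set q := S ^ (n + 1) / (n + 1).factorial
  have hR : 1 < R := one_lt_remezBase hγ hγ₁
  have hθ₁ : 1 ≤ θ := one_le_pow₀ hR.le
  have hS : 0 ≤ S := by positivity
  have : 0 ≤ q := by positivity
  have hq : q ≤ 1 / (32 * θ) := by
    calc q ≤ (Real.exp 1 / (32 * Real.exp 1 * R ^ 3)) ^ (n + 1) :=
          pow_div_factorial_le (by positivity) hS (by push_cast; linarith)
      _ = 1 / (32 ^ (n + 1) * θ) := by
          rw [hθ, pow_mul, ← mul_pow, ← one_div_pow]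
          field_simp
      _ ≤ 1 / (32 * θ) := by
          gcongr
          exact le_self_pow₀ (by norm_num) n.succ_ne_zero
  have hq₁ : 2 * q ≤ 1 := by
    have : 1 / (32 * θ) ≤ 1 / 2 := by
      gcongr
      linarith
    linarith
  have hSn : 2 * S ≤ n + 1 := by
    have hl : 2 ≤ 32 * Real.exp 1 * R ^ 3 := by
      nlinarith [Real.add_one_le_exp 1, one_le_pow₀ hR.le (n := 3)]
    nlinarith
  have herror : (4 * θ ^ 2 + 2) * (6 * q) ^ 2 ≤ 1 / 2 := by
    calc (4 * θ ^ 2 + 2) * (6 * q) ^ 2 ≤ (4 * θ ^ 2 + 2) * (6 * (1 / (32 * θ))) ^ 2 := by gcongr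
      _ = (144 + 72 / θ ^ 2) / 1024 := by field_simp; ring
      _ ≤ 1 / 2 := by
        have : 72 / θ ^ 2 ≤ 72 := div_le_self (by norm_num) (one_le_pow₀ hθ₁)
        linarith
  have hmain := norm_sq_le_add_of_bandLimited hγ ha hω hthick hSn le_rfl hq₁
    (by positivity) (remezConst_le hγ hγ₁ n) hf
  have habsorb := mul_le_mul_of_nonneg_right herror (sq_nonneg ‖f‖)
  linarith

theorem spectral_inequality (hγ : 0 < γ) (hγ₁ : γ ≤ 1) (ha : 0 < a)
    (hω : NullMeasurableSet ω volume) (hthick : IsThick γ a ω) :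
    ∃ C : ℝ, 0 < C ∧ ∀ K : ℝ, 1 ≤ K → ∀ f : Lp ℂ 2 (volume : Measure Plane), BandLimited K f →
      ‖f‖ ^ 2 ≤ Real.exp (C * K) * ‖cutOp hω f‖ ^ 2 := by
  set R := remezBase γ
  set L := 32 * Real.exp 1 * R ^ 3 * (2 * Real.pi * a)
  have hR : 1 < R := one_lt_remezBase hγ hγ₁
  have hlogR : 0 < Real.log R := Real.log_pos hR
  have : 0 < L := by positivity
  refine ⟨8 + 6 * Real.log R * (L + 2), by positivity, fun K hK f hf => ?_⟩
  set n := ⌈L * K⌉₊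
  have hn : (n : ℝ) + 1 ≤ (L + 2) * K := by
    have : (n : ℝ) < L * K + 1 := Nat.ceil_lt_add_one (by positivity)
    linarith
  refine (norm_sq_le_of_bandLimited (n := n) hγ hγ₁ ha hω hthick (by linarith) ?_ hf).trans ?_
  · refine le_trans (le_of_eq ?_) (Nat.le_ceil (L * K))
    ring
  gcongr
  calc 8 * (R ^ (3 * (n + 1))) ^ 2 ≤ Real.exp 8 * Real.exp (6 * Real.log R * (n + 1)) := by
        gcongr
        · linarith [Real.add_one_le_exp 8]
        · rw [← pow_mul, ← Real.rpow_natCast, Real.rpow_def_of_pos (by linarith)]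
          refine (congrArg Real.exp ?_).le
          push_cast
          ring
    _ = Real.exp (8 + 6 * Real.log R * (n + 1)) := (Real.exp_add _ _).symm
    _ ≤ Real.exp (8 * K + 6 * Real.log R * ((L + 2) * K)) := by
        gcongr
        linarith
    _ = Real.exp ((8 + 6 * Real.log R * (L + 2)) * K) := by ring_nf

end SpectralInequality

section LowPass

open FourierTransform

variable {V F : Type*} [NormedAddCommGroup V] [InnerProductSpace ℝ V] [FiniteDimensional ℝ V]
  [MeasurableSpace V] [BorelSpace V] [NormedAddCommGroup F] [InnerProductSpace ℂ F]
  [CompleteSpace F]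

theorem nullMeasurableSet_closedBall (K : ℝ) :
    NullMeasurableSet (Metric.closedBall (0 : V) K) volume :=
  Metric.isClosed_closedBall.measurableSet.nullMeasurableSet

/-- The spectral projection on the frequencies in the closed ball of radius `K`. -/
noncomputable def lowPass (K : ℝ) :
    Lp F 2 (volume : Measure V) →L[ℂ] Lp F 2 (volume : Measure V) :=
  fourierMultiplier (memLp_top_indicator_one (nullMeasurableSet_closedBall K))

variable (K : ℝ) (f : Lp F 2 (volume : Measure V))

theorem fourier_lowPass : (𝓕 (lowPass K f) : Lp F 2 (volume : Measure V)) =ᵐ[volume]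
    (Metric.closedBall (0 : V) K).indicator (𝓕 f : Lp F 2 volume) := by
  rw [lowPass, fourier_fourierMultiplier]
  exact coeFn_cutOp (nullMeasurableSet_closedBall K) (𝓕 f)

theorem bandLimited_lowPass : BandLimited K (lowPass K f) := by
  filter_upwards [fourier_lowPass K f] with ζ hζ hζK
  rw [hζ, indicator_of_notMem hζK]

theorem norm_lowPass_apply_le : ‖lowPass K f‖ ≤ ‖f‖ := by
  rw [← one_mul ‖f‖]
  exact norm_fourierMultiplier_apply_le _
    (fun ζ => (norm_indicator_le_norm_self _ ζ).trans norm_one.le) f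

theorem lowPass_lowPass : lowPass K (lowPass K f) = lowPass K f := by
  refine fourierMultiplier_fourierMultiplier _ (Eventually.of_forall fun ζ => ?_) f
  by_cases hζ : ζ ∈ Metric.closedBall (0 : V) K <;> simp [hζ]

theorem norm_fourierMultiplier_sub_lowPass_le {m : V → ℂ} (hm : MemLp m ∞ volume) {c : ℝ}
    (hc : 0 ≤ c) (h : ∀ ζ, K < ‖ζ‖ → ‖m ζ‖ ≤ c) :
    ‖fourierMultiplier hm f - lowPass K (fourierMultiplier hm f)‖ ≤ c * ‖f‖ := by
  rw [← Lp.norm_fourier_eq, ← Lp.norm_fourier_eq f, sub_eq_add_neg, FourierTransform.fourier_add,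
    FourierTransform.fourier_neg, ← sub_eq_add_neg]
  refine Lp.norm_le_mul_norm_of_ae_le_mul ?_
  have hmul := coeFn_mulOp hm (𝓕 f)
  rw [← fourier_fourierMultiplier] at hmul
  filter_upwards [
    Lp.coeFn_sub (𝓕 (fourierMultiplier hm f)) (𝓕 (lowPass K (fourierMultiplier hm f))),
    fourier_lowPass K (fourierMultiplier hm f), hmul] with ζ hsub hlow hζ
  rw [hsub, Pi.sub_apply, hlow]
  by_cases hζK : ζ ∈ Metric.closedBall (0 : V) K
  · rw [indicator_of_mem hζK, sub_self, norm_zero]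
    positivity
  · rw [indicator_of_notMem hζK, sub_zero, hζ, norm_smul]
    rw [mem_closedBall_zero_iff, not_le] at hζK
    gcongr
    exact h ζ hζK

end LowPass

section CutOffSplitting

variable {α E : Type*} [MeasurableSpace α] {μ : Measure α} [NormedAddCommGroup E]
  [NormedSpace ℂ E] {s : Set α} (hs : NullMeasurableSet s μ)

theorem cutOp_add_cutOp_compl {p : ℝ≥0∞} [Fact (1 ≤ p)] (f : Lp E p μ) :
    cutOp hs f + cutOp hs.compl f = f := by
  refine mulOp_add_mulOp _ _ (Eventually.of_forall fun x => ?_) f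
  by_cases hx : x ∈ s <;> simp [hx]

theorem norm_cutOp_sq_add (f : Lp E 2 μ) :
    ‖cutOp hs f‖ ^ 2 + ‖cutOp hs.compl f‖ ^ 2 = ‖f‖ ^ 2 := by
  have henorm : ‖cutOp hs f‖ₑ ^ 2 + ‖cutOp hs.compl f‖ₑ ^ 2 = ‖f‖ₑ ^ 2 := by
    rw [enorm_cutOp_sq, enorm_cutOp_sq, enorm_sq_eq_lintegral, ← lintegral_add_measure,
      ← Measure.restrict_union₀ disjoint_compl_right.aedisjoint hs.compl, union_compl_self,
      Measure.restrict_univ]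
  have htoReal := congrArg ENNReal.toReal henorm
  rwa [ENNReal.toReal_add (by finiteness) (by finiteness), ENNReal.toReal_pow, ENNReal.toReal_pow,
    ENNReal.toReal_pow, toReal_enorm, toReal_enorm, toReal_enorm] at htoReal

theorem norm_cutOp_apply_le (f : Lp E 2 μ) : ‖cutOp hs f‖ ≤ ‖f‖ :=
  le_of_sq_le_sq (by linarith [norm_cutOp_sq_add hs f, sq_nonneg ‖cutOp hs.compl f‖])
    (norm_nonneg f)

end CutOffSplitting

section Lift

theorem exists_sub_apply_eq_of_opNorm_le {𝕜 E : Type*} [NontriviallyNormedField 𝕜]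
    [NormedAddCommGroup E] [NormedSpace 𝕜 E] [CompleteSpace E] {X : E →L[𝕜] E} {r : ℝ}
    (hX : ‖X‖ ≤ r) (hr : r < 1) :
    ∃ N : E →L[𝕜] E, (∀ f, N f - X (N f) = f) ∧ ∀ f, ‖N f‖ ≤ (1 - r)⁻¹ * ‖f‖ := by
  have hX₁ : ‖X‖ < 1 := hX.trans_lt hr
  refine ⟨∑' i : ℕ, X ^ i, fun f => ?_, fun f => ContinuousLinearMap.le_of_opNorm_le _ ?_ f⟩
  · simpa using congrArg (fun Y : E →L[𝕜] E => Y f) (mul_neg_geom_series X hX₁)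
  · have hone : ‖(1 : E →L[𝕜] E)‖ ≤ 1 := ContinuousLinearMap.norm_id_le
    have hinv : (1 - ‖X‖)⁻¹ ≤ (1 - r)⁻¹ := inv_anti₀ (sub_pos.2 hr) (by linarith)
    linarith [tsum_geometric_le_of_norm_lt_one X hX₁]

variable {V F : Type*} [NormedAddCommGroup V] [InnerProductSpace ℝ V] [FiniteDimensional ℝ V]
  [MeasurableSpace V] [BorelSpace V] [NormedAddCommGroup F] [InnerProductSpace ℂ F]
  [CompleteSpace F] {ω : Set V} (hω : NullMeasurableSet ω volume) {K B : ℝ}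

theorem norm_cutOp_compl_lowPass_le (hB : 1 ≤ B)
    (h : ∀ f : Lp F 2 (volume : Measure V), BandLimited K f → ‖f‖ ^ 2 ≤ B * ‖cutOp hω f‖ ^ 2)
    (f : Lp F 2 (volume : Measure V)) :
    ‖cutOp hω.compl (lowPass K f)‖ ≤ (1 - 1 / (2 * B)) * ‖f‖ := by
  have hB₀ : 0 < B := one_pos.trans_le hB
  have hr : 0 ≤ 1 - 1 / (2 * B) := by
    rw [sub_nonneg, div_le_one (by positivity)]
    linarith
  have hcut : 1 / B * ‖lowPass K f‖ ^ 2 ≤ ‖cutOp hω (lowPass K f)‖ ^ 2 := by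
    rw [one_div, inv_mul_le_iff₀ hB₀]
    exact h _ (bandLimited_lowPass K f)
  have hsq : 1 - 1 / B ≤ (1 - 1 / (2 * B)) ^ 2 := by
    have hexpand : (1 - 1 / (2 * B)) ^ 2 = 1 - 1 / B + (1 / (2 * B)) ^ 2 := by field_simp; ring
    linarith [sq_nonneg (1 / (2 * B))]
  refine le_of_sq_le_sq ?_ (by positivity)
  calc ‖cutOp hω.compl (lowPass K f)‖ ^ 2
      ≤ (1 - 1 / B) * ‖lowPass K f‖ ^ 2 := by
        linarith [norm_cutOp_sq_add hω (lowPass K f)]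
    _ ≤ (1 - 1 / (2 * B)) ^ 2 * ‖f‖ ^ 2 := by
        gcongr
        exact norm_lowPass_apply_le K f
    _ = ((1 - 1 / (2 * B)) * ‖f‖) ^ 2 := by rw [mul_pow]

-- On the range of the projection `P`, the compression `P 1_ω P = P - P 1_{ωᶜ} P` is invertible by a
-- Neumann series, since the spectral inequality makes `P 1_{ωᶜ} P` a strict contraction.
theorem exists_lift_of_spectral (hB : 1 ≤ B)
    (h : ∀ f : Lp F 2 (volume : Measure V), BandLimited K f → ‖f‖ ^ 2 ≤ B * ‖cutOp hω f‖ ^ 2) :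
    ∃ L : Lp F 2 (volume : Measure V) →L[ℂ] Lp F 2 (volume : Measure V),
      (∀ f, lowPass K (cutOp hω (L f)) = lowPass K f) ∧ ∀ f, ‖L f‖ ≤ 2 * B * ‖f‖ := by
  have : 0 < B := one_pos.trans_le hB
  have hinv : 0 < 1 / (2 * B) := by positivity
  have hinv₁ : 1 / (2 * B) ≤ 1 := by
    rw [div_le_one (by positivity)]
    linarith
  have hX : ‖lowPass K ∘L cutOp hω.compl ∘L lowPass (F := F) K‖ ≤ 1 - 1 / (2 * B) := by
    refine ContinuousLinearMap.opNorm_le_bound _ (sub_nonneg.2 hinv₁) fun f => ?_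
    rw [ContinuousLinearMap.comp_apply, ContinuousLinearMap.comp_apply]
    exact (norm_lowPass_apply_le K _).trans (norm_cutOp_compl_lowPass_le hω hB h f)
  obtain ⟨N, hN, hNnorm⟩ := exists_sub_apply_eq_of_opNorm_le hX (sub_lt_self 1 hinv)
  refine ⟨lowPass K ∘L N, fun f => ?_, fun f => ?_⟩
  · have hNf := congrArg (lowPass K) (hN f)
    have hsplit := congrArg (lowPass K) (cutOp_add_cutOp_compl hω (lowPass K (N f)))
    simp only [map_sub, map_add, ContinuousLinearMap.comp_apply, lowPass_lowPass] at hNf hsplit ⊢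
    rw [← hNf]
    exact eq_sub_of_add_eq hsplit
  · calc ‖lowPass K (N f)‖ ≤ ‖N f‖ := norm_lowPass_apply_le K _
      _ ≤ (1 - (1 - 1 / (2 * B)))⁻¹ * ‖f‖ := hNnorm f
      _ = 2 * B * ‖f‖ := by rw [sub_sub_cancel, one_div, inv_inv]

end Lift

section FourierChangeOfVariables

open FourierTransform SchwartzMap

variable {V F : Type*} [NormedAddCommGroup V] [InnerProductSpace ℝ V] [FiniteDimensional ℝ V]
  [MeasurableSpace V] [BorelSpace V] [NormedAddCommGroup F] {A B : V → V}

theorem fourier_comp_of_inner_eq [NormedSpace ℂ F] (hA : MeasurePreserving A volume volume)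
    (hemb : MeasurableEmbedding A) (hAB : ∀ x ζ, inner ℝ (A x) (B ζ) = inner ℝ x ζ) (f : V → F)
    (ζ : V) : 𝓕 (fun x => f (A x)) ζ = 𝓕 f (B ζ) := by
  rw [Real.fourier_eq', Real.fourier_eq', ← hA.integral_comp hemb fun x =>
    Complex.exp (↑(-2 * Real.pi * inner ℝ x (B ζ)) * Complex.I) • f x]
  simp_rw [hAB]

variable [InnerProductSpace ℂ F] [CompleteSpace F]

theorem fourier_compMeasurePreserving_of_inner_eq (hA : MeasurePreserving A volume volume)
    (hemb : MeasurableEmbedding A) (hB : MeasurePreserving B volume volume)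
    (hAB : ∀ x ζ, inner ℝ (A x) (B ζ) = inner ℝ x ζ) (f : Lp F 2 (volume : Measure V)) :
    𝓕 (Lp.compMeasurePreserving A hA f) = Lp.compMeasurePreserving B hB (𝓕 f) := by
  refine (denseRange_toLpCLM (E := V) (F := F) (p := 2) (μ := volume)
    ENNReal.ofNat_ne_top).induction_on f (isClosed_eq ?_ ?_) fun g =>
      (Lp.ext ?_ : 𝓕 (Lp.compMeasurePreserving A hA (g.toLp 2)) = _)
  · exact (Lp.fourierTransformₗᵢ V F).continuous.comp
      (Lp.compMeasurePreservingₗᵢ ℂ A hA).continuous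
  · exact (Lp.compMeasurePreservingₗᵢ ℂ B hB).continuous.comp
      (Lp.fourierTransformₗᵢ V F).continuous
  have hcomp : Lp.compMeasurePreserving A hA (g.toLp 2) =ᵐ[volume] fun x => g (A x) :=
    (Lp.coeFn_compMeasurePreserving _ hA).trans
      (hA.quasiMeasurePreserving.ae_eq_comp (g.coeFn_toLp 2 volume))
  have hInt : Integrable (Lp.compMeasurePreserving A hA (g.toLp 2)) volume :=
    (hA.integrable_comp_of_integrable g.integrable).congr hcomp.symm
  have hfourier : 𝓕 (Lp.compMeasurePreserving A hA (g.toLp 2) : V → F) = 𝓕 fun x => g (A x) := by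
    funext ζ
    rw [Real.fourier_eq', Real.fourier_eq']
    exact integral_congr_ae (by filter_upwards [hcomp] with x hx; rw [hx])
  filter_upwards [coeFn_fourier_of_integrable hInt,
    Lp.coeFn_compMeasurePreserving (𝓕 (g.toLp 2) : Lp F 2 volume) hB,
    hB.quasiMeasurePreserving.ae_eq_comp ((𝓕 g).coeFn_toLp 2 volume)] with ζ hleft hright hg
  refine hleft.trans (Eq.trans ?_ hright.symm)
  rw [hfourier, toLp_fourier_eq, hg, Function.comp_apply, fourier_coe,
    fourier_comp_of_inner_eq hA hemb hAB]

end FourierChangeOfVariables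

section Shear

open FourierTransform

/-- The complexified state space. -/
noncomputable abbrev CState := Lp ℂ 2 (volume : Measure Plane)

/-- The shear `(x, z) ↦ (x + t z, z)`, the flow of the transport field `z ∂_x`. -/
noncomputable def shearMap (t : ℝ) (p : Plane) : Plane := toPlane (p 0 + t * p 1, p 1)

/-- The transpose `(ξ, η) ↦ (ξ, η + t ξ)` of the shear, acting on frequencies. -/
noncomputable def coshearMap (t : ℝ) (p : Plane) : Plane := toPlane (p 0, p 1 + t * p 0)

@[simp] theorem shearMap_zero (t : ℝ) (p : Plane) : shearMap t p 0 = p 0 + t * p 1 := rfl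

@[simp] theorem shearMap_one (t : ℝ) (p : Plane) : shearMap t p 1 = p 1 := rfl

@[simp] theorem coshearMap_zero (t : ℝ) (p : Plane) : coshearMap t p 0 = p 0 := rfl

@[simp] theorem coshearMap_one (t : ℝ) (p : Plane) : coshearMap t p 1 = p 1 + t * p 0 := rfl

theorem continuous_shearMap : Continuous fun z : ℝ × Plane => shearMap z.1 z.2 := by
  unfold shearMap
  fun_prop

theorem continuous_shearMap_apply (t : ℝ) : Continuous (shearMap t) :=
  continuous_shearMap.comp (by fun_prop : Continuous fun p : Plane => (t, p))

theorem shearMap_neg_shearMap (t : ℝ) (p : Plane) : shearMap (-t) (shearMap t p) = p := by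
  ext i
  fin_cases i <;> simp

theorem shearMap_shearMap_neg (t : ℝ) (p : Plane) : shearMap t (shearMap (-t) p) = p := by
  simpa using shearMap_neg_shearMap (-t) p

theorem inner_shearMap_coshearMap_neg (t : ℝ) (p ζ : Plane) :
    inner ℝ (shearMap t p) (coshearMap (-t) ζ) = inner ℝ p ζ := by
  simp only [inner_plane, shearMap_zero, shearMap_one, coshearMap_zero, coshearMap_one]
  ring

theorem norm_coshearMap_le (t : ℝ) (ζ : Plane) : ‖coshearMap t ζ‖ ≤ (1 + |t|) * ‖ζ‖ := by
  have hsplit : coshearMap t ζ = ζ + toPlane (0, t * ζ 0) := by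
    ext i
    fin_cases i <;> simp
  have hshift : ‖toPlane (0, t * ζ 0)‖ = |t| * |ζ 0| := by
    rw [← abs_mul, ← abs_norm, ← sq_eq_sq_iff_abs_eq_abs, norm_sq_plane]
    simp
  rw [hsplit, one_add_mul]
  refine (norm_add_le _ _).trans ?_
  rw [hshift]
  gcongr
  exact abs_apply_le_norm ζ 0

theorem measurePreserving_toEuclideanLin {ι : Type*} [Fintype ι] [DecidableEq ι]
    {M : Matrix ι ι ℝ} (hM : M.det = 1) :
    MeasurePreserving (Matrix.toEuclideanLin M) (volume : Measure (EuclideanSpace ℝ ι)) volume := by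
  have hdet : LinearMap.det (Matrix.toEuclideanLin M) = 1 := by
    rw [LinearMap.det_toLpLin, hM]
  refine ⟨(Matrix.toEuclideanLin M).continuous_of_finiteDimensional.measurable, ?_⟩
  rw [Measure.map_linearMap_addHaar_eq_smul_addHaar volume (by rw [hdet]; exact one_ne_zero), hdet]
  simp

theorem measurePreserving_shearMap (t : ℝ) : MeasurePreserving (shearMap t) volume volume := by
  convert! measurePreserving_toEuclideanLin (M := !![1, t; 0, 1]) (by simp) using 1
  funext p
  ext i
  fin_cases i <;> simp [Matrix.toLpLin_apply, Matrix.vecHead, Matrix.vecTail]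

theorem measurePreserving_coshearMap (t : ℝ) : MeasurePreserving (coshearMap t) volume volume := by
  convert! measurePreserving_toEuclideanLin (M := !![1, 0; t, 1]) (by simp) using 1
  funext p
  ext i
  fin_cases i <;> simp [Matrix.toLpLin_apply, Matrix.vecHead, Matrix.vecTail]
  ring

theorem measurableEmbedding_shearMap (t : ℝ) : MeasurableEmbedding (shearMap t) :=
  (MeasurableEquiv.mk
    ⟨shearMap t, shearMap (-t), shearMap_neg_shearMap t, shearMap_shearMap_neg t⟩
    (continuous_shearMap_apply t).measurable
    (continuous_shearMap_apply (-t)).measurable).measurableEmbedding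

/-- Composition with the shear `shearMap t`, as an isometry of `L²`. -/
noncomputable def shearOp (t : ℝ) : CState →ₗᵢ[ℂ] CState :=
  Lp.compMeasurePreservingₗᵢ ℂ (shearMap t) (measurePreserving_shearMap t)

theorem coeFn_shearOp (t : ℝ) (f : CState) : shearOp t f =ᵐ[volume] fun p => f (shearMap t p) :=
  Lp.coeFn_compMeasurePreserving f (measurePreserving_shearMap t)

theorem shearOp_shearOp_neg (t : ℝ) (f : CState) : shearOp t (shearOp (-t) f) = f := by
  refine Lp.ext ?_
  filter_upwards [coeFn_shearOp t (shearOp (-t) f), (measurePreserving_shearMap t)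
    |>.quasiMeasurePreserving.ae (coeFn_shearOp (-t) f)] with p hp hneg
  rw [hp, hneg, shearMap_neg_shearMap]

theorem shearOp_neg_shearOp (t : ℝ) (f : CState) : shearOp (-t) (shearOp t f) = f := by
  simpa using shearOp_shearOp_neg (-t) f

theorem continuous_shearOp : Continuous fun z : ℝ × CState => shearOp z.1 z.2 := by
  have hshear : Continuous fun z : ℝ × CState =>
      (⟨shearMap z.1, continuous_shearMap_apply z.1⟩ : C(Plane, Plane)) :=
    ContinuousMap.continuous_of_continuous_uncurry _
      (continuous_shearMap.comp (by fun_prop : Continuous fun q : (ℝ × CState) × Plane =>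
        (q.1.1, q.2)))
  exact Continuous.compMeasurePreservingLp continuous_snd hshear
    (fun z => measurePreserving_shearMap z.1) ENNReal.ofNat_ne_top

theorem continuous_shearOp_comp {X : Type*} [TopologicalSpace X] {t : X → ℝ} {f : X → CState}
    (ht : Continuous t) (hf : Continuous f) : Continuous fun x => shearOp (t x) (f x) :=
  Continuous.comp (g := fun z : ℝ × CState => shearOp z.1 z.2) (f := fun x => (t x, f x))
    continuous_shearOp (ht.prodMk hf)

theorem fourier_shearOp (t : ℝ) (f : CState) : (𝓕 (shearOp t f) : CState) =ᵐ[volume]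
    fun ζ => (𝓕 f : CState) (coshearMap (-t) ζ) := by
  have hcomp := fourier_compMeasurePreserving_of_inner_eq (measurePreserving_shearMap t)
    (measurableEmbedding_shearMap t) (measurePreserving_coshearMap (-t))
    (inner_shearMap_coshearMap_neg t) f
  change (𝓕 (Lp.compMeasurePreserving _ _ f) : CState) =ᵐ[volume] _
  rw [hcomp]
  exact Lp.coeFn_compMeasurePreserving _ _

theorem lowPass_shearOp_lowPass {T K K' t : ℝ} (ht : |t| ≤ T) (hK : (1 + T) * K ≤ K')
    (f : CState) : lowPass K (shearOp t (lowPass K' f)) = lowPass K (shearOp t f) := by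
  refine (Lp.fourierTransformₗᵢ Plane ℂ).injective (Lp.ext ?_)
  filter_upwards [fourier_lowPass K (shearOp t (lowPass K' f)), fourier_lowPass K (shearOp t f),
    fourier_shearOp t f, fourier_shearOp t (lowPass K' f), (measurePreserving_coshearMap (-t))
      |>.quasiMeasurePreserving.ae (fourier_lowPass K' f)] with ζ hleft hright hf hlow hlow_shear
  refine hleft.trans (Eq.trans ?_ hright.symm)
  by_cases hζ : ζ ∈ Metric.closedBall (0 : Plane) K
  · have hmem : coshearMap (-t) ζ ∈ Metric.closedBall (0 : Plane) K' := by
      rw [mem_closedBall_zero_iff] at hζ ⊢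
      calc ‖coshearMap (-t) ζ‖ ≤ (1 + |t|) * ‖ζ‖ := by
            simpa using norm_coshearMap_le (-t) ζ
        _ ≤ (1 + T) * K := by
            have hT : 0 ≤ T := (abs_nonneg t).trans ht
            gcongr
        _ ≤ K' := hK
    rw [indicator_of_mem hζ, indicator_of_mem hζ, hf, hlow, hlow_shear, indicator_of_mem hmem]
  · rw [indicator_of_notMem hζ, indicator_of_notMem hζ]

end Shear

section Evolution

/-- The exponent `4π² ∫₀ᵗ (η - r ξ)² dr` of the free evolution in the moving frame. -/
noncomputable def phase (t : ℝ) (ζ : Plane) : ℝ :=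
  4 * Real.pi ^ 2 * (t * ζ 1 ^ 2 - t ^ 2 * (ζ 1 * ζ 0) + t ^ 3 / 3 * ζ 0 ^ 2)

theorem phase_sub_phase (s t : ℝ) (ζ : Plane) : phase t ζ - phase s ζ =
    4 * Real.pi ^ 2 * ((t - s) * ((ζ 1 - (s + t) / 2 * ζ 0) ^ 2 + (t - s) ^ 2 / 12 * ζ 0 ^ 2)) := by
  unfold phase
  ring

theorem phase_mono {s t : ℝ} (h : s ≤ t) (ζ : Plane) : phase s ζ ≤ phase t ζ := by
  rw [← sub_nonneg, phase_sub_phase]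
  have := sub_nonneg.2 h
  positivity

theorem sq_div_mul_add_sq_le {d m T : ℝ} (hd : d ^ 2 ≤ T ^ 2) (hm : m ^ 2 ≤ T ^ 2) (ξ η : ℝ) :
    d ^ 2 / (2 * T ^ 2 + 1) * (ξ ^ 2 + η ^ 2) ≤
      12 * ((η - m * ξ) ^ 2 + d ^ 2 / 12 * ξ ^ 2) := by
  have hη : η ^ 2 ≤ 2 * (η - m * ξ) ^ 2 + 2 * T ^ 2 * ξ ^ 2 := by
    have hmξ : m ^ 2 * ξ ^ 2 ≤ T ^ 2 * ξ ^ 2 := by gcongr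
    nlinarith [sq_nonneg (η - 2 * m * ξ)]
  rw [div_mul_eq_mul_div, div_le_iff₀ (by positivity)]
  have hdη := mul_le_mul_of_nonneg_left hη (sq_nonneg d)
  have hdm := mul_le_mul_of_nonneg_right hd (sq_nonneg (η - m * ξ))
  nlinarith [sq_nonneg (η - m * ξ), sq_nonneg (T * (η - m * ξ))]

theorem le_phase_sub_phase {s t T : ℝ} (hs : 0 ≤ s) (hst : s ≤ t) (htT : t ≤ T) (ζ : Plane) :
    (t - s) ^ 3 / (2 * T ^ 2 + 1) * ‖ζ‖ ^ 2 ≤ phase t ζ - phase s ζ := by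
  have hd : 0 ≤ t - s := sub_nonneg.2 hst
  have hdT : (t - s) ^ 2 ≤ T ^ 2 := pow_le_pow_left₀ hd (by linarith) 2
  have hmT : ((s + t) / 2) ^ 2 ≤ T ^ 2 := pow_le_pow_left₀ (by linarith) (by linarith) 2
  have hpi : 12 ≤ 4 * Real.pi ^ 2 := by nlinarith [Real.pi_gt_three]
  have hquad := sq_div_mul_add_sq_le hdT hmT (ζ 0) (ζ 1)
  rw [phase_sub_phase, norm_sq_plane]
  set Q := (ζ 1 - (s + t) / 2 * ζ 0) ^ 2 + (t - s) ^ 2 / 12 * ζ 0 ^ 2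
  calc (t - s) ^ 3 / (2 * T ^ 2 + 1) * (ζ 0 ^ 2 + ζ 1 ^ 2)
      = (t - s) * ((t - s) ^ 2 / (2 * T ^ 2 + 1) * (ζ 0 ^ 2 + ζ 1 ^ 2)) := by ring
    _ ≤ (t - s) * (12 * Q) := by gcongr
    _ = 12 * ((t - s) * Q) := by ring
    _ ≤ 4 * Real.pi ^ 2 * ((t - s) * Q) := by gcongr

/-- The symbol of the free evolution from time `s` to time `t` in the moving frame. The absolute
value makes it bounded for all `s` and `t`; only the case `s ≤ t` has a meaning. -/
noncomputable def evoSymbol (s t : ℝ) (ζ : Plane) : ℝ := Real.exp (-|phase t ζ - phase s ζ|)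

theorem continuous_evoSymbol : Continuous fun z : ℝ × ℝ × Plane => evoSymbol z.1 z.2.1 z.2.2 := by
  unfold evoSymbol phase
  fun_prop

theorem continuous_evoSymbol_apply (s t : ℝ) : Continuous (evoSymbol s t) :=
  continuous_evoSymbol.comp (by fun_prop : Continuous fun ζ : Plane => (s, t, ζ))

theorem abs_evoSymbol_le (s t : ℝ) (ζ : Plane) : |evoSymbol s t ζ| ≤ 1 := by
  rw [evoSymbol, abs_of_pos (Real.exp_pos _), Real.exp_le_one_iff, neg_nonpos]
  exact abs_nonneg _

theorem evoSymbol_of_le {s t : ℝ} (hst : s ≤ t) (ζ : Plane) :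
    evoSymbol s t ζ = Real.exp (phase s ζ - phase t ζ) := by
  rw [evoSymbol, abs_of_nonneg (sub_nonneg.2 (phase_mono hst ζ)), neg_sub]

theorem evoSymbol_mul {s r t : ℝ} (hsr : s ≤ r) (hrt : r ≤ t) (ζ : Plane) :
    evoSymbol s t ζ = evoSymbol r t ζ * evoSymbol s r ζ := by
  rw [evoSymbol_of_le (hsr.trans hrt), evoSymbol_of_le hrt, evoSymbol_of_le hsr, ← Real.exp_add]
  ring_nf

theorem memLp_top_evoSymbol (s t : ℝ) :
    MemLp (fun ζ => (evoSymbol s t ζ : ℂ)) ∞ (volume : Measure Plane) :=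
  memLp_top_ofReal_of_continuous (continuous_evoSymbol_apply s t) (abs_evoSymbol_le s t)

/-- The free evolution from time `s` to time `t` in the moving frame. -/
noncomputable def evo (s t : ℝ) : CState →L[ℂ] CState := fourierMultiplier (memLp_top_evoSymbol s t)

theorem norm_evo_apply_le (s t : ℝ) (f : CState) : ‖evo s t f‖ ≤ ‖f‖ := by
  rw [← one_mul ‖f‖]
  exact norm_fourierMultiplier_apply_le _ (fun ζ => by simpa using abs_evoSymbol_le s t ζ) f

theorem evo_self (t : ℝ) (f : CState) : evo t t f = f :=
  fourierMultiplier_apply_of_ae_eq_one _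
    (Eventually.of_forall fun ζ => by simp [evoSymbol_of_le le_rfl]) f

theorem evo_evo {s r t : ℝ} (hsr : s ≤ r) (hrt : r ≤ t) (f : CState) :
    evo r t (evo s r f) = evo s t f :=
  fourierMultiplier_fourierMultiplier _
    (Eventually.of_forall fun ζ => by rw [evoSymbol_mul hsr hrt, Complex.ofReal_mul]) f

theorem lowPass_evo (K s t : ℝ) (f : CState) : lowPass K (evo s t f) = evo s t (lowPass K f) :=
  fourierMultiplier_comm _ _ f

theorem norm_evo_sub_lowPass_le {s t T K : ℝ} (hs : 0 ≤ s) (hst : s ≤ t) (htT : t ≤ T)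
    (hK : 0 ≤ K) (f : CState) : ‖evo s t f - lowPass K (evo s t f)‖ ≤
      Real.exp (-((t - s) ^ 3 / (2 * T ^ 2 + 1) * K ^ 2)) * ‖f‖ := by
  refine norm_fourierMultiplier_sub_lowPass_le _ _ _ (Real.exp_pos _).le fun ζ hζ => ?_
  rw [Complex.norm_real, Real.norm_eq_abs, evoSymbol_of_le hst, abs_of_pos (Real.exp_pos _),
    Real.exp_le_exp, ← neg_sub, neg_le_neg_iff]
  refine le_trans ?_ (le_phase_sub_phase hs hst htT ζ)
  have := sub_nonneg.2 hst
  gcongr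

theorem continuous_evo_apply (f : CState) : Continuous fun z : ℝ × ℝ => evo z.1 z.2 f := by
  refine continuous_iff_continuousAt.2 fun z =>
    tendsto_fourierMultiplier _ _ (C := 1) (fun y ζ => ?_) (fun ζ => ?_) f
  · simpa using abs_evoSymbol_le y.1 y.2 ζ
  · exact ((Complex.continuous_ofReal.comp continuous_evoSymbol).comp
      (by fun_prop : Continuous fun y : ℝ × ℝ => (y.1, y.2, ζ))).tendsto z

theorem continuous_uncurry_of_norm_apply_le {𝕜 X E F : Type*} [TopologicalSpace X]
    [NontriviallyNormedField 𝕜] [NormedAddCommGroup E] [NormedSpace 𝕜 E] [NormedAddCommGroup F]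
    [NormedSpace 𝕜 F] {A : X → E →L[𝕜] F} {C : ℝ} (hC : ∀ x f, ‖A x f‖ ≤ C * ‖f‖)
    (hA : ∀ f, Continuous fun x => A x f) : Continuous fun z : X × E => A z.1 z.2 := by
  refine continuous_iff_continuousAt.2 fun ⟨x, f⟩ => ?_
  have hsplit : (fun z : X × E => A z.1 z.2) = fun z => A z.1 (z.2 - f) + A z.1 f := by
    funext z
    rw [map_sub, sub_add_cancel]
  have hdiff : Tendsto (fun z : X × E => A z.1 (z.2 - f)) (𝓝 (x, f)) (𝓝 0) := by
    refine squeeze_zero_norm (fun z => hC z.1 (z.2 - f)) ?_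
    have hcont : Continuous fun z : X × E => C * ‖z.2 - f‖ := by fun_prop
    simpa using hcont.tendsto (x, f)
  have hfixed := ((hA f).comp continuous_fst).tendsto ((x, f) : X × E)
  simpa only [ContinuousAt, hsplit, sub_self, map_zero, zero_add, Function.comp_apply]
    using hdiff.add hfixed

theorem continuous_evo : Continuous fun z : (ℝ × ℝ) × CState => evo z.1.1 z.1.2 z.2 := by
  refine continuous_uncurry_of_norm_apply_le (C := 1) (fun z f => ?_) continuous_evo_apply
  rw [one_mul]
  exact norm_evo_apply_le z.1 z.2 f

theorem continuous_evo_comp {X : Type*} [TopologicalSpace X] {s t : X → ℝ} {f : X → CState}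
    (hs : Continuous s) (ht : Continuous t) (hf : Continuous f) :
    Continuous fun x => evo (s x) (t x) (f x) :=
  Continuous.comp (g := fun z : (ℝ × ℝ) × CState => evo z.1.1 z.1.2 z.2)
    (f := fun x => ((s x, t x), f x)) continuous_evo ((hs.prodMk ht).prodMk hf)

end Evolution

section Duhamel

variable {g : ℝ → CState} {M : ℝ}

theorem stronglyMeasurable_evo_apply (hg : StronglyMeasurable g) (t : ℝ) :
    StronglyMeasurable fun s => evo s t (g s) :=
  Continuous.comp_stronglyMeasurable (g := fun z : ℝ × CState => evo z.1 t z.2)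
    (f := fun s => (s, g s)) (continuous_evo_comp continuous_fst continuous_const continuous_snd)
    (stronglyMeasurable_id.prodMk hg)

theorem intervalIntegrable_evo_apply (hg : StronglyMeasurable g) (hM : ∀ s, ‖g s‖ ≤ M)
    (t a b : ℝ) : IntervalIntegrable (fun s => evo s t (g s)) volume a b :=
  (intervalIntegrable_const (c := M)).mono_fun
    (stronglyMeasurable_evo_apply hg t).aestronglyMeasurable (Eventually.of_forall fun s =>
      (norm_evo_apply_le _ _ _).trans ((hM s).trans (le_abs_self M)))

/-- The state at time `t` in the moving frame when the state at time `r` is `w` and the source is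
`g`, given by Duhamel's formula. -/
noncomputable def duhamel (r : ℝ) (w : CState) (g : ℝ → CState) (t : ℝ) : CState :=
  evo r t w + ∫ s in r..t, evo s t (g s)

theorem duhamel_self (r : ℝ) (w : CState) (g : ℝ → CState) : duhamel r w g r = w := by
  rw [duhamel, evo_self, intervalIntegral.integral_same, add_zero]

theorem duhamel_congr {g' : ℝ → CState} {r t : ℝ} (hrt : r ≤ t) (h : EqOn g g' (Ico r t))
    (w : CState) : duhamel r w g t = duhamel r w g' t := by
  rw [duhamel, duhamel, intervalIntegral.integral_of_le hrt, intervalIntegral.integral_of_le hrt,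
    ← integral_Ico_eq_integral_Ioc, ← integral_Ico_eq_integral_Ioc]
  exact congrArg _ (setIntegral_congr_fun measurableSet_Ico fun s hs => by rw [h hs])

theorem duhamel_eq_evo {r t : ℝ} (hrt : r ≤ t) (h : ∀ s ∈ Ico r t, g s = 0) (w : CState) :
    duhamel r w g t = evo r t w := by
  rw [duhamel_congr (g' := 0) hrt h w]
  simp [duhamel]

theorem norm_duhamel_le (hM : ∀ s, ‖g s‖ ≤ M) {r t : ℝ} (hrt : r ≤ t) (w : CState) :
    ‖duhamel r w g t‖ ≤ ‖w‖ + (t - r) * M := by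
  refine (norm_add_le _ _).trans (add_le_add (norm_evo_apply_le _ _ _) ?_)
  rw [← abs_of_nonneg (sub_nonneg.2 hrt), mul_comm]
  exact intervalIntegral.norm_integral_le_of_norm_le_const fun s _ =>
    (norm_evo_apply_le _ _ _).trans (hM s)

theorem duhamel_duhamel (hg : StronglyMeasurable g) (hM : ∀ s, ‖g s‖ ≤ M) {q r t : ℝ}
    (hqr : q ≤ r) (hrt : r ≤ t) (w : CState) :
    duhamel r (duhamel q w g r) g t = duhamel q w g t := by
  have hflow : ∫ s in q..r, evo r t (evo s r (g s)) = ∫ s in q..r, evo s t (g s) := by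
    refine intervalIntegral.integral_congr fun s hs => ?_
    rw [uIcc_of_le hqr] at hs
    exact evo_evo hs.2 hrt _
  rw [duhamel, duhamel, map_add, evo_evo hqr hrt, add_assoc,
    ← ContinuousLinearMap.intervalIntegral_comp_comm _ (intervalIntegrable_evo_apply hg hM r q r),
    hflow, intervalIntegral.integral_add_adjacent_intervals
    (intervalIntegrable_evo_apply hg hM t q r) (intervalIntegrable_evo_apply hg hM t r t), duhamel]

theorem continuous_duhamel (hg : StronglyMeasurable g) (hM : ∀ s, ‖g s‖ ≤ M) (r : ℝ)
    (w : CState) : Continuous (duhamel r w g) := by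
  refine (continuous_evo_comp continuous_const continuous_id continuous_const).add
    (continuous_iff_continuousAt.2 fun t₀ => ?_)
  have hintegral : ContinuousAt (fun z : ℝ × ℝ => ∫ s in r..z.2, evo s z.1 (g s)) (t₀, t₀) :=
    intervalIntegral.continuousAt_parametric_primitive_of_dominated
      (a := min r t₀ - 1) (b := max r t₀ + 1) (fun _ => M)
      (fun t => (stronglyMeasurable_evo_apply hg t).aestronglyMeasurable)
      (Eventually.of_forall fun t => Eventually.of_forall fun s =>
        (norm_evo_apply_le _ _ _).trans (hM s))
      intervalIntegrable_const
      (Eventually.of_forall fun s =>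
        (continuous_evo_comp continuous_const continuous_id continuous_const).continuousAt)
      ⟨by linarith [min_le_left r t₀], by linarith [le_max_left r t₀]⟩
      ⟨by linarith [min_le_right r t₀], by linarith [le_max_right r t₀]⟩ (measure_singleton t₀)
  exact ContinuousAt.comp (f := fun t : ℝ => (t, t)) hintegral (by fun_prop)

end Duhamel

section TestFunctions

open FourierTransform

theorem exists_abs_le_indicator_closedBall {X V : Type*} [NormedAddCommGroup X]
    [NormedAddCommGroup V] {Φ : X × V → ℝ} (hc : Continuous Φ) (hs : HasCompactSupport Φ) :
    ∃ C R : ℝ, ∀ x p, |Φ (x, p)| ≤ (Metric.closedBall (0 : V) R).indicator (fun _ => C) p := by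
  obtain ⟨C, hC⟩ := hc.bounded_above_of_compact_support hs
  obtain ⟨R, hR⟩ := hs.isCompact.isBounded.subset_closedBall (0 : X × V)
  refine ⟨C, R, fun x p => ?_⟩
  by_cases h : p ∈ Metric.closedBall (0 : V) R
  · rw [indicator_of_mem h]
    exact hC (x, p)
  · have hz : Φ (x, p) = 0 := image_eq_zero_of_notMem_tsupport fun hp => h <| by
      have := hR hp
      rw [mem_closedBall_zero_iff] at this ⊢
      exact (norm_snd_le (x, p)).trans this
    rw [indicator_of_notMem h, hz, abs_zero]

/-- The shear of space-time, which follows the characteristics of `∂ₜ + z ∂ₓ`. -/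
noncomputable def spaceTimeShear : ℝ × Plane ≃ₜ ℝ × Plane where
  toFun q := (q.1, shearMap q.1 q.2)
  invFun q := (q.1, shearMap (-q.1) q.2)
  left_inv q := by simp [shearMap_neg_shearMap]
  right_inv q := by simp [shearMap_shearMap_neg]
  continuous_toFun := continuous_fst.prodMk continuous_shearMap
  continuous_invFun := continuous_fst.prodMk (continuous_shearMap.comp
    (by fun_prop : Continuous fun q : ℝ × Plane => (-q.1, q.2)))

/-- A test function in the moving frame. -/
noncomputable def sheared (Φ : ℝ × Plane → ℝ) : ℝ × Plane → ℝ := Φ ∘ spaceTimeShear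

theorem sheared_apply (Φ : ℝ × Plane → ℝ) (t : ℝ) (p : Plane) :
    sheared Φ (t, p) = Φ (t, shearMap t p) := rfl

/-- The partial Fourier transform in space of a test function in the moving frame. It is the
inverse transform, so that `∫ f φ = ∫ 𝓕 f · 𝓕⁻ φ` carries no complex conjugate. -/
noncomputable def testTransform (Φ : ℝ × Plane → ℝ) (t : ℝ) : Plane → ℂ :=
  𝓕⁻ (fun p => (sheared Φ (t, p) : ℂ))

theorem testTransform_eq (Φ : ℝ × Plane → ℝ) (t : ℝ) (ζ : Plane) : testTransform Φ t ζ =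
    ∫ p, Complex.exp (↑(2 * Real.pi * inner ℝ p ζ) * Complex.I) * sheared Φ (t, p) := by
  rw [testTransform, Real.fourierInv_eq']
  rfl

section Slice

variable {Φ : ℝ × Plane → ℝ} (hc : Continuous Φ) (hs : HasCompactSupport Φ)

include hc in
theorem continuous_sheared : Continuous (sheared Φ) := hc.comp spaceTimeShear.continuous

include hs in
theorem hasCompactSupport_sheared : HasCompactSupport (sheared Φ) :=
  hs.comp_homeomorph spaceTimeShear

include hc in
theorem continuous_slice (t : ℝ) : Continuous fun p => (Φ (t, p) : ℂ) := by fun_prop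

include hs in
theorem hasCompactSupport_slice (t : ℝ) : HasCompactSupport fun p => (Φ (t, p) : ℂ) := by
  have hemb : IsClosedEmbedding fun p : Plane => (t, p) :=
    Function.LeftInverse.isClosedEmbedding (f := Prod.snd) (fun _ => rfl) (by fun_prop)
      (by fun_prop)
  exact (hs.comp_isClosedEmbedding hemb).comp_left Complex.ofReal_zero

include hc hs in
theorem memLp_slice (t : ℝ) (p : ℝ≥0∞) : MemLp (fun x => (Φ (t, x) : ℂ)) p volume :=
  (continuous_slice hc t).memLp_of_hasCompactSupport (hasCompactSupport_slice hs t)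

/-- The slice at time `t` of a test function, as an element of `L²`. -/
noncomputable def slice (t : ℝ) : CState := (memLp_slice hc hs t 2).toLp _

theorem coeFn_slice (t : ℝ) : slice hc hs t =ᵐ[volume] fun p => (Φ (t, p) : ℂ) :=
  MemLp.coeFn_toLp _

theorem integrable_coeFn_slice (t : ℝ) : Integrable (slice hc hs t) volume :=
  (memLp_one_iff_integrable.1 (memLp_slice hc hs t 1)).congr (coeFn_slice hc hs t).symm

theorem exists_norm_slice_le : ∃ D : ℝ, 0 ≤ D ∧ ∀ t, ‖slice hc hs t‖ ≤ D := by
  obtain ⟨C, R, hCR⟩ := exists_abs_le_indicator_closedBall hc hs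
  let G : CState := indicatorConstLp 2 (s := Metric.closedBall (0 : Plane) R)
    Metric.isClosed_closedBall.measurableSet measure_closedBall_lt_top.ne (C : ℂ)
  have hG : G =ᵐ[volume] (Metric.closedBall (0 : Plane) R).indicator fun _ => (C : ℂ) :=
    indicatorConstLp_coeFn
  refine ⟨‖G‖, norm_nonneg _, fun t => Lp.norm_le_norm_of_ae_le ?_⟩
  filter_upwards [coeFn_slice hc hs t, hG] with p hΦp hGp
  rw [hΦp, hGp, Complex.norm_real, norm_indicator_eq_indicator_norm]
  exact (hCR t p).trans (indicator_le_indicator ((le_abs_self C).trans_eq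
    (Complex.norm_real C).symm))

theorem integral_mul_slice (t : ℝ) (f : CState) :
    ∫ p, f p * Φ (t, p) = inner ℂ (slice hc hs t) f := by
  rw [L2.inner_def]
  refine integral_congr_ae ?_
  filter_upwards [coeFn_slice hc hs t] with p hp
  rw [hp, RCLike.inner_apply, Complex.conj_ofReal]

theorem shearOp_slice (t : ℝ) : shearOp t (slice hc hs t) =
    slice (continuous_sheared hc) (hasCompactSupport_sheared hs) t := by
  refine Lp.ext ?_
  filter_upwards [coeFn_shearOp t (slice hc hs t),
    (measurePreserving_shearMap t).quasiMeasurePreserving.ae (coeFn_slice hc hs t),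
    coeFn_slice (continuous_sheared hc) (hasCompactSupport_sheared hs) t] with p hop hΦ hsh
  rw [hop, hΦ, hsh, sheared_apply]

theorem conj_fourier_shearOp_slice (t : ℝ) : ∀ᵐ ζ : Plane,
    starRingEnd ℂ ((𝓕 (shearOp t (slice hc hs t)) : CState) ζ) = testTransform Φ t ζ := by
  have hc' := continuous_sheared hc
  have hs' := hasCompactSupport_sheared hs
  rw [shearOp_slice]
  filter_upwards [coeFn_fourier_of_integrable (integrable_coeFn_slice hc' hs' t)] with ζ hζ
  rw [hζ, testTransform_eq, Real.fourier_eq', ← integral_conj]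
  refine integral_congr_ae ?_
  filter_upwards [coeFn_slice hc' hs' t] with p hp
  rw [hp, smul_eq_mul, map_mul, Complex.conj_ofReal, ← Complex.exp_conj, map_mul,
    Complex.conj_ofReal, Complex.conj_I]
  congr 2
  push_cast
  ring

theorem lintegral_enorm_testTransform_sq (t : ℝ) :
    ∫⁻ ζ, ‖testTransform Φ t ζ‖ₑ ^ 2 = ‖slice hc hs t‖ₑ ^ 2 := by
  have hnorm : ‖slice hc hs t‖ = ‖(𝓕 (shearOp t (slice hc hs t)) : CState)‖ := by
    rw [Lp.norm_fourier_eq, LinearIsometry.norm_map]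
  rw [← ofReal_norm, hnorm, ofReal_norm, enorm_sq_eq_lintegral]
  refine lintegral_congr_ae ?_
  filter_upwards [conj_fourier_shearOp_slice hc hs t] with ζ hζ
  rw [← hζ, RCLike.enorm_conj]

include hc hs in
theorem memLp_testTransform (t : ℝ) : MemLp (testTransform Φ t) 2 volume := by
  have hconj := conj_fourier_shearOp_slice hc hs t
  exact (memLp_congr_ae hconj).1 (Lp.memLp (𝓕 (shearOp t (slice hc hs t)) : CState)).star

include hc in
theorem stronglyMeasurable_testTransform :
    StronglyMeasurable fun z : ℝ × Plane => testTransform Φ z.1 z.2 := by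
  have hc' := continuous_sheared hc
  simp only [testTransform_eq]
  refine StronglyMeasurable.integral_prod_right (f := fun (z : ℝ × Plane) (p : Plane) =>
    Complex.exp (↑(2 * Real.pi * inner ℝ p z.2) * Complex.I) * sheared Φ (z.1, p))
    (Continuous.stronglyMeasurable ?_)
  simp only [Function.uncurry_def]
  fun_prop

include hc hs in
theorem integrable_exp_mul_slice (t : ℝ) (ζ : Plane) : Integrable fun p : Plane =>
    Complex.exp (↑(2 * Real.pi * inner ℝ p ζ) * Complex.I) * Φ (t, p) :=
  (memLp_one_iff_integrable.1 (memLp_slice hc hs t 1)).bdd_mul (c := 1) (by fun_prop)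
    (Eventually.of_forall fun p => (Complex.norm_exp_ofReal_mul_I _).le)

end Slice

section Derivatives

variable {φ : ℝ × Plane → ℝ}

theorem contDiff_partialD (hφ : ContDiff ℝ (⊤ : ℕ∞) φ) (v : ℝ × Plane) :
    ContDiff ℝ (⊤ : ℕ∞) (partialD v φ) :=
  (hφ.fderiv_right (m := (⊤ : ℕ∞)) (by simp)).clm_apply contDiff_const

theorem hasCompactSupport_partialD (hs : HasCompactSupport φ) (v : ℝ × Plane) :
    HasCompactSupport (partialD v φ) := hs.fderiv_apply ℝ v

/-- The transport part `φ_t + z φ_x` of the adjoint operator. -/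
noncomputable def transportOp (φ : ℝ × Plane → ℝ) : ℝ × Plane → ℝ :=
  fun q => partialD dirT φ q + q.2 1 * partialD dirX φ q

theorem continuous_transportOp (hφ : ContDiff ℝ (⊤ : ℕ∞) φ) : Continuous (transportOp φ) := by
  have hT := (contDiff_partialD hφ dirT).continuous
  have hX := (contDiff_partialD hφ dirX).continuous
  unfold transportOp
  fun_prop

theorem hasCompactSupport_transportOp (hs : HasCompactSupport φ) :
    HasCompactSupport (transportOp φ) :=
  (hasCompactSupport_partialD hs dirT).add (hasCompactSupport_partialD hs dirX).mul_left

theorem adjointOp_eq (φ : ℝ × Plane → ℝ) :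
    adjointOp φ = fun q => transportOp φ q + partialD dirZ (partialD dirZ φ) q := rfl

theorem continuous_adjointOp (hφ : ContDiff ℝ (⊤ : ℕ∞) φ) : Continuous (adjointOp φ) :=
  (continuous_transportOp hφ).add (contDiff_partialD (contDiff_partialD hφ _) _).continuous

theorem hasCompactSupport_adjointOp (hs : HasCompactSupport φ) :
    HasCompactSupport (adjointOp φ) :=
  (hasCompactSupport_transportOp hs).add
    (hasCompactSupport_partialD (hasCompactSupport_partialD hs _) _)

theorem hasDerivAt_shearMap (t : ℝ) (p : Plane) : HasDerivAt (fun t => shearMap t p)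
    (p 1 • EuclideanSpace.single (0 : Fin 2) (1 : ℝ)) t := by
  have haffine : (fun t : ℝ => shearMap t p) =
      fun t => p + t • (p 1 • EuclideanSpace.single (0 : Fin 2) (1 : ℝ)) := by
    funext t
    ext i
    fin_cases i <;> simp
  rw [haffine]
  simpa using ((hasDerivAt_id t).smul_const
    (p 1 • EuclideanSpace.single (0 : Fin 2) (1 : ℝ))).const_add p

theorem hasDerivAt_sheared (hφ : ContDiff ℝ (⊤ : ℕ∞) φ) (t : ℝ) (p : Plane) :
    HasDerivAt (fun t => sheared φ (t, p)) (sheared (transportOp φ) (t, p)) t := by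
  have hcurve : HasDerivAt (fun t : ℝ => (t, shearMap t p)) (dirT + p 1 • dirX) t := by
    convert! (hasDerivAt_id t).prodMk (hasDerivAt_shearMap t p) using 1
    simp [dirT, dirX]
  convert! (hφ.differentiable (by simp) (t, shearMap t p)).hasFDerivAt.comp_hasDerivAt t hcurve
    using 1
  simp [sheared_apply, transportOp, partialD]

theorem hasDerivAt_testTransform (hφ : ContDiff ℝ (⊤ : ℕ∞) φ) (hs : HasCompactSupport φ)
    (t : ℝ) (ζ : Plane) :
    HasDerivAt (fun t => testTransform φ t ζ) (testTransform (transportOp φ) t ζ) t := by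
  have hc := continuous_sheared hφ.continuous
  have hc' := continuous_sheared (continuous_transportOp hφ)
  have hs' := hasCompactSupport_sheared (hasCompactSupport_transportOp hs)
  obtain ⟨C, R, hCR⟩ := exists_abs_le_indicator_closedBall hc' hs'
  simp only [testTransform_eq]
  refine (hasDerivAt_integral_of_dominated_loc_of_deriv_le univ_mem
    (bound := (Metric.closedBall (0 : Plane) R).indicator fun _ => C)
    (Eventually.of_forall fun t => ?_)
    (integrable_exp_mul_slice hc (hasCompactSupport_sheared hs) t ζ)
    (integrable_exp_mul_slice hc' hs' t ζ).aestronglyMeasurable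
    (Eventually.of_forall fun p t _ => ?_) ?_
    (Eventually.of_forall fun p t _ => (hasDerivAt_sheared hφ t p).ofReal_comp.const_mul _)).2
  · exact (integrable_exp_mul_slice hc (hasCompactSupport_sheared hs) t ζ).aestronglyMeasurable
  · rw [norm_mul, Complex.norm_exp_ofReal_mul_I, one_mul, Complex.norm_real]
    exact hCR t p
  · exact (integrable_indicator_iff Metric.isClosed_closedBall.measurableSet).2
      (integrableOn_const measure_closedBall_lt_top.ne)

theorem hasLineDerivAt_exp_inner (p v ζ : Plane) : HasLineDerivAt ℝ
    (fun p : Plane => Complex.exp (↑(2 * Real.pi * inner ℝ p ζ) * Complex.I))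
    (2 * Real.pi * (inner ℝ v ζ : ℝ) * Complex.I *
      Complex.exp (↑(2 * Real.pi * inner ℝ p ζ) * Complex.I)) p v := by
  have hlin : HasDerivAt (fun s : ℝ => 2 * Real.pi * inner ℝ (p + s • v) ζ)
      (2 * Real.pi * inner ℝ v ζ) 0 := by
    simp only [inner_add_left, inner_smul_left, conj_trivial]
    simpa using (((hasDerivAt_id (0 : ℝ)).mul_const (inner ℝ v ζ)).const_add
      (inner ℝ p ζ)).const_mul (2 * Real.pi)
  rw [HasLineDerivAt]
  convert! (hlin.ofReal_comp.mul_const Complex.I).cexp using 1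
  simp only [zero_smul, add_zero]
  push_cast
  ring

theorem hasLineDerivAt_sheared (hφ : ContDiff ℝ (⊤ : ℕ∞) φ) (t : ℝ) (p : Plane) :
    HasLineDerivAt ℝ (fun p => sheared φ (t, p)) (sheared (partialD dirZ φ) (t, p)) p
      (toPlane (-t, 1)) := by
  have hshear (s : ℝ) :
      (t, shearMap t (p + s • toPlane (-t, 1))) = (t, shearMap t p) + s • dirZ := by
    refine Prod.ext (by simp [dirZ]) ?_
    ext i
    fin_cases i <;> simp [dirZ]
    ring
  have hdiff := (hφ.differentiable (by simp) (t, shearMap t p)).hasFDerivAt.hasLineDerivAt dirZ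
  simpa only [HasLineDerivAt, sheared_apply, hshear, partialD] using hdiff

theorem testTransform_partialD_dirZ (hφ : ContDiff ℝ (⊤ : ℕ∞) φ) (hs : HasCompactSupport φ)
    (t : ℝ) (ζ : Plane) : testTransform (partialD dirZ φ) t ζ =
      -(2 * Real.pi * (ζ 1 - t * ζ 0) * Complex.I * testTransform φ t ζ) := by
  have hinner : ((inner ℝ (toPlane (-t, 1)) ζ : ℝ) : ℂ) = ζ 1 - t * ζ 0 := by
    rw [inner_plane, toPlane_zero, toPlane_one]
    push_cast
    ring
  have hInt := integrable_exp_mul_slice (continuous_sheared hφ.continuous)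
    (hasCompactSupport_sheared hs) t ζ
  have hparts := integral_bilinear_hasLineDerivAt_right_eq_neg_left_of_integrable (μ := volume)
    (B := ContinuousLinearMap.mul ℝ ℂ) (v := toPlane (-t, 1))
    (g := fun p => (sheared φ (t, p) : ℂ)) ?_
    (integrable_exp_mul_slice (continuous_sheared (contDiff_partialD hφ dirZ).continuous)
      (hasCompactSupport_sheared (hasCompactSupport_partialD hs dirZ)) t ζ) hInt
    (fun p _ => hasLineDerivAt_exp_inner p (toPlane (-t, 1)) ζ)
    (fun p _ => HasDerivAt.ofReal_comp (hasLineDerivAt_sheared hφ t p))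
  · simp only [ContinuousLinearMap.mul_apply', mul_assoc, integral_const_mul, hinner] at hparts
    simpa only [testTransform_eq, mul_assoc] using hparts
  · simpa only [ContinuousLinearMap.mul_apply', mul_assoc] using
      hInt.const_mul (2 * Real.pi * (inner ℝ (toPlane (-t, 1)) ζ : ℝ) * Complex.I)

end Derivatives

end TestFunctions

section WeakForm

open FourierTransform

theorem contDiff_adjointOp {φ : ℝ × Plane → ℝ} (hφ : ContDiff ℝ (⊤ : ℕ∞) φ) :
    ContDiff ℝ (⊤ : ℕ∞) (adjointOp φ) := by
  have hz : ContDiff ℝ (⊤ : ℕ∞) fun q : ℝ × Plane => q.2 1 :=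
    (EuclideanSpace.proj (𝕜 := ℝ) (1 : Fin 2)).contDiff.comp contDiff_snd
  exact ((contDiff_partialD hφ dirT).add (hz.mul (contDiff_partialD hφ dirX))).add
    (contDiff_partialD (contDiff_partialD hφ dirZ) dirZ)

theorem continuous_testTransform {φ : ℝ × Plane → ℝ} (hφ : ContDiff ℝ (⊤ : ℕ∞) φ)
    (hs : HasCompactSupport φ) (ζ : Plane) : Continuous fun t => testTransform φ t ζ :=
  continuous_iff_continuousAt.2 fun t => (hasDerivAt_testTransform hφ hs t ζ).continuousAt

theorem testTransform_add {Φ Ψ : ℝ × Plane → ℝ} (hΦ : Continuous Φ) (hΦs : HasCompactSupport Φ)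
    (hΨ : Continuous Ψ) (hΨs : HasCompactSupport Ψ) (t : ℝ) (ζ : Plane) :
    testTransform (fun q => Φ q + Ψ q) t ζ = testTransform Φ t ζ + testTransform Ψ t ζ := by
  simp only [testTransform_eq]
  rw [← integral_add
    (integrable_exp_mul_slice (continuous_sheared hΦ) (hasCompactSupport_sheared hΦs) t ζ)
    (integrable_exp_mul_slice (continuous_sheared hΨ) (hasCompactSupport_sheared hΨs) t ζ)]
  simp only [sheared_apply, Complex.ofReal_add, mul_add]

theorem testTransform_adjointOp {φ : ℝ × Plane → ℝ} (hφ : ContDiff ℝ (⊤ : ℕ∞) φ)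
    (hs : HasCompactSupport φ) (t : ℝ) (ζ : Plane) : testTransform (adjointOp φ) t ζ =
      testTransform (transportOp φ) t ζ -
        ((4 * Real.pi ^ 2 * (ζ 1 - t * ζ 0) ^ 2 : ℝ) : ℂ) * testTransform φ t ζ := by
  have hZ := contDiff_partialD hφ dirZ
  have hZs := hasCompactSupport_partialD hs dirZ
  rw [adjointOp_eq, testTransform_add (continuous_transportOp hφ) (hasCompactSupport_transportOp hs)
    (contDiff_partialD hZ dirZ).continuous (hasCompactSupport_partialD hZs dirZ),
    testTransform_partialD_dirZ hZ hZs, testTransform_partialD_dirZ hφ hs]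
  push_cast
  linear_combination (4 * (Real.pi : ℂ) ^ 2 * (ζ 1 - t * ζ 0) ^ 2 * testTransform φ t ζ) *
    Complex.I_sq

theorem hasDerivAt_phase (t : ℝ) (ζ : Plane) :
    HasDerivAt (fun t => phase t ζ) (4 * Real.pi ^ 2 * (ζ 1 - t * ζ 0) ^ 2) t := by
  unfold phase
  convert! ((((hasDerivAt_id t).mul_const (ζ 1 ^ 2)).sub
    ((hasDerivAt_pow 2 t).mul_const (ζ 1 * ζ 0))).add
    (((hasDerivAt_pow 3 t).div_const 3).mul_const (ζ 0 ^ 2))).const_mul (4 * Real.pi ^ 2) using 1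
  simp
  ring

theorem hasDerivAt_exp_phase_mul_testTransform {φ : ℝ × Plane → ℝ} (hφ : ContDiff ℝ (⊤ : ℕ∞) φ)
    (hs : HasCompactSupport φ) (s r : ℝ) (ζ : Plane) :
    HasDerivAt (fun r => (Real.exp (phase s ζ - phase r ζ) : ℂ) * testTransform φ r ζ)
      ((Real.exp (phase s ζ - phase r ζ) : ℂ) * testTransform (adjointOp φ) r ζ) r := by
  have hexp : HasDerivAt (fun r => (Real.exp (phase s ζ - phase r ζ) : ℂ)) _ r :=
    ((hasDerivAt_phase r ζ).const_sub (phase s ζ)).exp.ofReal_comp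
  convert! hexp.mul (hasDerivAt_testTransform hφ hs r ζ) using 1
  rw [testTransform_adjointOp hφ hs]
  push_cast
  ring

theorem evoSymbol_mul_testTransform_sub {φ : ℝ × Plane → ℝ} (hφ : ContDiff ℝ (⊤ : ℕ∞) φ)
    (hs : HasCompactSupport φ) {s t : ℝ} (hst : s ≤ t) (ζ : Plane) :
    (evoSymbol s t ζ : ℂ) * testTransform φ t ζ - testTransform φ s ζ =
      ∫ r in s..t, (evoSymbol s r ζ : ℂ) * testTransform (adjointOp φ) r ζ := by
  have hphase : Continuous fun r => phase r ζ :=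
    continuous_iff_continuousAt.2 fun r => (hasDerivAt_phase r ζ).continuousAt
  have htest := continuous_testTransform (contDiff_adjointOp hφ) (hasCompactSupport_adjointOp hs) ζ
  have hftc := intervalIntegral.integral_eq_sub_of_hasDerivAt (a := s) (b := t)
    (fun r _ => hasDerivAt_exp_phase_mul_testTransform hφ hs s r ζ)
    (Continuous.intervalIntegrable (by fun_prop) _ _)
  rw [sub_self, Real.exp_zero, Complex.ofReal_one, one_mul] at hftc
  rw [evoSymbol_of_le hst, ← hftc]
  refine intervalIntegral.integral_congr fun r hr => ?_
  rw [uIcc_of_le hst] at hr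
  simp only [evoSymbol_of_le hr.1]

section Pairing

variable {Φ : ℝ × Plane → ℝ} (hc : Continuous Φ) (hs : HasCompactSupport Φ)

theorem continuous_slice_toLp : Continuous (slice hc hs) := by
  obtain ⟨C, R, hCR⟩ := exists_abs_le_indicator_closedBall hc hs
  refine continuous_iff_continuousAt.2 fun t₀ =>
    (Lp.tendsto_Lp_iff_tendsto_eLpNorm'' _ _ _ _).2 ?_
  have hG : MemLp ((Metric.closedBall (0 : Plane) R).indicator fun _ => 2 * C) 2 volume :=
    memLp_indicator_const 2 Metric.isClosed_closedBall.measurableSet _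
      (Or.inr measure_closedBall_lt_top.ne)
  refine tendsto_eLpNorm_sub_of_dominated (by simp) (by simp) hG
    (fun t => (continuous_slice hc t).aestronglyMeasurable)
    (continuous_slice hc t₀).aestronglyMeasurable
    (fun t => Eventually.of_forall fun p => ?_) (Eventually.of_forall fun p => ?_)
  · rw [← Complex.ofReal_sub, Complex.norm_real, two_mul, indicator_add]
    exact (abs_sub _ _).trans (add_le_add (hCR t p) (hCR t₀ p))
  · exact Continuous.tendsto (by fun_prop) t₀

/-- The pairing `∫ y(t) Φ(t)` of a test function with the state `y(t) = shearOp (-t) f`, seen as a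
linear form in the moving-frame state `f`. -/
noncomputable def pairing (t : ℝ) : CState →L[ℂ] ℂ :=
  innerSL ℂ (slice hc hs t) ∘L (shearOp (-t)).toContinuousLinearMap

theorem pairing_apply (t : ℝ) (f : CState) :
    pairing hc hs t f = inner ℂ (slice hc hs t) (shearOp (-t) f) := rfl

theorem pairing_eq_integral (t : ℝ) (f : CState) :
    pairing hc hs t f = ∫ p, (shearOp (-t) f) p * Φ (t, p) := (integral_mul_slice hc hs t _).symm

theorem pairing_eq_integral_fourier (t : ℝ) (f : CState) :
    pairing hc hs t f = ∫ ζ, (𝓕 f : CState) ζ * testTransform Φ t ζ := by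
  rw [pairing_apply, ← (shearOp t).inner_map_map, shearOp_shearOp_neg, ← Lp.inner_fourier_eq,
    L2.inner_def]
  refine integral_congr_ae ?_
  filter_upwards [conj_fourier_shearOp_slice hc hs t] with ζ hζ
  rw [RCLike.inner_apply, hζ]

theorem norm_pairing_apply_le (t : ℝ) (f : CState) :
    ‖pairing hc hs t f‖ ≤ ‖slice hc hs t‖ * ‖f‖ := by
  rw [pairing_apply, ← (shearOp (-t)).norm_map f]
  exact norm_inner_le_norm _ _

theorem continuous_pairing : Continuous fun z : ℝ × CState => pairing hc hs z.1 z.2 :=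
  ((continuous_slice_toLp hc hs).comp continuous_fst).inner
    (continuous_shearOp_comp continuous_fst.neg continuous_snd)

theorem pairing_evo_eq_integral (s t : ℝ) (f : CState) : pairing hc hs t (evo s t f) =
    ∫ ζ, (𝓕 f : CState) ζ * ((evoSymbol s t ζ : ℂ) * testTransform Φ t ζ) := by
  rw [pairing_eq_integral_fourier, evo, fourier_fourierMultiplier]
  refine integral_congr_ae ?_
  filter_upwards [coeFn_mulOp (memLp_top_evoSymbol s t) (𝓕 f : CState)] with ζ hζ
  rw [hζ, smul_eq_mul]
  ring

include hc hs in
theorem memLp_evoSymbol_mul_testTransform (s t : ℝ) :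
    MemLp (fun ζ => (evoSymbol s t ζ : ℂ) * testTransform Φ t ζ) 2 volume :=
  (memLp_testTransform hc hs t).mul (memLp_top_evoSymbol s t)

include hc hs in
theorem memLp_testTransform_prod (s t : ℝ) :
    MemLp (fun z : ℝ × Plane => testTransform Φ z.1 z.2) 2
      ((volume.restrict (Ioc s t)).prod volume) := by
  obtain ⟨D, -, hD⟩ := exists_norm_slice_le hc hs
  have hmeas := stronglyMeasurable_testTransform hc
  have hslice (r : ℝ) : ∫⁻ ζ, ‖testTransform Φ r ζ‖ₑ ^ 2 ≤ ENNReal.ofReal D ^ 2 := by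
    rw [lintegral_enorm_testTransform_sq hc hs, ← ofReal_norm]
    gcongr
    exact hD r
  refine ⟨hmeas.aestronglyMeasurable, ?_⟩
  rw [eLpNorm_lt_top_iff_lintegral_rpow_enorm_lt_top (by simp) (by simp), ENNReal.toReal_ofNat]
  simp only [ENNReal.rpow_ofNat]
  rw [lintegral_prod _ (hmeas.measurable.enorm.pow_const 2).aemeasurable]
  refine (lintegral_mono hslice).trans_lt ?_
  rw [setLIntegral_const]
  exact ENNReal.mul_lt_top (ENNReal.pow_lt_top ENNReal.ofReal_lt_top) measure_Ioc_lt_top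

include hc hs in
theorem integrable_prod_fourier_mul_testTransform (s t : ℝ) (f : CState) :
    Integrable (fun z : ℝ × Plane =>
      (𝓕 f : CState) z.2 * ((evoSymbol s z.1 z.2 : ℂ) * testTransform Φ z.1 z.2))
      ((volume.restrict (Ioc s t)).prod volume) := by
  have hsymbol : Continuous fun z : ℝ × Plane => (evoSymbol s z.1 z.2 : ℂ) :=
    Complex.continuous_ofReal.comp (continuous_evoSymbol.comp
      (by fun_prop : Continuous fun z : ℝ × Plane => (s, z.1, z.2)))
  refine ((Lp.memLp (𝓕 f : CState)).comp_snd _).integrable_mul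
    ((memLp_testTransform_prod hc hs s t).mono (hsymbol.aestronglyMeasurable.mul
      (stronglyMeasurable_testTransform hc).aestronglyMeasurable)
      (Eventually.of_forall fun z => ?_))
  rw [norm_mul, Complex.norm_real]
  exact mul_le_of_le_one_left (norm_nonneg _) (abs_evoSymbol_le s z.1 z.2)

theorem intervalIntegrable_pairing {h : ℝ → CState} {a b N : ℝ}
    (hh : AEStronglyMeasurable h (volume.restrict (uIoc a b))) (hN : ∀ s ∈ uIoc a b, ‖h s‖ ≤ N) :
    IntervalIntegrable (fun s => pairing hc hs s (h s)) volume a b := by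
  obtain ⟨D, hD0, hD⟩ := exists_norm_slice_le hc hs
  have hmeas := Continuous.comp_aestronglyMeasurable
    (g := fun z : ℝ × CState => pairing hc hs z.1 z.2) (f := fun s => (s, h s))
    (continuous_pairing hc hs) (aestronglyMeasurable_id.prodMk hh)
  refine intervalIntegrable_iff.2 (IntegrableOn.of_bound (by simp [uIoc]) hmeas (D * N) ?_)
  filter_upwards [ae_restrict_mem measurableSet_uIoc] with s hsab
  exact (norm_pairing_apply_le hc hs _ _).trans
    (mul_le_mul (hD _) (hN s hsab) (norm_nonneg _) hD0)

theorem intervalIntegrable_pairing_of_continuousOn {h : ℝ → CState} {a b : ℝ}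
    (hh : ContinuousOn h (uIcc a b)) :
    IntervalIntegrable (fun s => pairing hc hs s (h s)) volume a b := by
  obtain ⟨N, hN⟩ := isCompact_uIcc.exists_bound_of_continuousOn hh
  exact intervalIntegrable_pairing hc hs
    ((hh.mono uIoc_subset_uIcc).aestronglyMeasurable measurableSet_uIoc)
    fun s hsab => hN s (uIoc_subset_uIcc hsab)

end Pairing

theorem pairing_evo_sub {φ : ℝ × Plane → ℝ} (hφ : ContDiff ℝ (⊤ : ℕ∞) φ)
    (hs : HasCompactSupport φ) {s t : ℝ} (hst : s ≤ t) (f : CState) :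
    pairing hφ.continuous hs t (evo s t f) - pairing hφ.continuous hs s f =
      ∫ r in s..t, pairing (continuous_adjointOp hφ) (hasCompactSupport_adjointOp hs) r
        (evo s r f) := by
  have hf := Lp.memLp (𝓕 f : CState)
  have hevo := hf.integrable_mul
    (memLp_evoSymbol_mul_testTransform hφ.continuous hs s t)
  have hself := hf.integrable_mul (memLp_testTransform hφ.continuous hs s)
  simp only [Pi.mul_def] at hevo hself
  simp_rw [pairing_evo_eq_integral, pairing_eq_integral_fourier]
  rw [← integral_sub hevo hself, intervalIntegral.integral_of_le hst, integral_integral_swap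
    (integrable_prod_fourier_mul_testTransform (continuous_adjointOp hφ)
      (hasCompactSupport_adjointOp hs) s t f)]
  refine integral_congr_ae (Eventually.of_forall fun ζ => ?_)
  simp only [← mul_sub]
  rw [integral_const_mul, ← intervalIntegral.integral_of_le hst,
    evoSymbol_mul_testTransform_sub hφ hs hst ζ]

theorem integral_integral_triangle_swap {E : Type*} [NormedAddCommGroup E] [NormedSpace ℝ E]
    {a b : ℝ} (hab : a ≤ b) {F : ℝ → ℝ → E} (hF : Integrable (Function.uncurry F)
      ((volume.restrict (Ioc a b)).prod (volume.restrict (Ioc a b)))) :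
    ∫ s in a..b, ∫ r in s..b, F s r = ∫ r in a..b, ∫ s in a..r, F s r := by
  have hinner_right : ∀ s ∈ Ioc a b, ∫ r in s..b, F s r =
      ∫ r in Ioc a b, {z : ℝ × ℝ | z.1 < z.2}.indicator (Function.uncurry F) (s, r) := by
    intro s hs
    have hind : (fun r => {z : ℝ × ℝ | z.1 < z.2}.indicator (Function.uncurry F) (s, r)) =
        (Ioi s).indicator (F s) := rfl
    rw [intervalIntegral.integral_of_le hs.2, hind, setIntegral_indicator measurableSet_Ioi,
      Ioc_inter_Ioi, sup_of_le_right hs.1.le]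
  have hinner_left : ∀ r ∈ Ioc a b, ∫ s in a..r, F s r =
      ∫ s in Ioc a b, {z : ℝ × ℝ | z.1 < z.2}.indicator (Function.uncurry F) (s, r) := by
    intro r hr
    have hind : (fun s => {z : ℝ × ℝ | z.1 < z.2}.indicator (Function.uncurry F) (s, r)) =
        (Iio r).indicator fun s => F s r := rfl
    have hIoo : Ioc a b ∩ Iio r = Ioo a r := by
      ext s
      exact ⟨fun h => ⟨h.1.1, h.2⟩, fun h => ⟨⟨h.1, h.2.le.trans hr.2⟩, h.2⟩⟩
    rw [intervalIntegral.integral_of_le hr.1.le, hind, setIntegral_indicator measurableSet_Iio,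
      hIoo, integral_Ioc_eq_integral_Ioo]
  rw [intervalIntegral.integral_of_le hab, intervalIntegral.integral_of_le hab,
    setIntegral_congr_fun measurableSet_Ioc hinner_right,
    setIntegral_congr_fun measurableSet_Ioc hinner_left, integral_integral_swap]
  exact hF.indicator (measurableSet_lt measurable_fst measurable_snd)

section Forcing

variable {g : ℝ → CState} {M : ℝ} (hg : StronglyMeasurable g) (hM : ∀ s, ‖g s‖ ≤ M)

include hg hM in
theorem integrable_prod_pairing_evo {Φ : ℝ × Plane → ℝ} (hc : Continuous Φ)
    (hs : HasCompactSupport Φ) (a b : ℝ) :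
    Integrable (Function.uncurry fun s r => pairing hc hs r (evo s r (g s)))
      ((volume.restrict (Ioc a b)).prod (volume.restrict (Ioc a b))) := by
  obtain ⟨D, hD0, hD⟩ := exists_norm_slice_le hc hs
  have hevo : Continuous fun y : (ℝ × ℝ) × CState => evo y.1.1 y.1.2 y.2 :=
    continuous_evo_comp (by fun_prop) (by fun_prop) (by fun_prop)
  have hpair : Continuous fun y : (ℝ × ℝ) × CState => pairing hc hs y.1.2 (evo y.1.1 y.1.2 y.2) :=
    Continuous.comp (g := fun z : ℝ × CState => pairing hc hs z.1 z.2)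
      (f := fun y : (ℝ × ℝ) × CState => (y.1.2, evo y.1.1 y.1.2 y.2)) (continuous_pairing hc hs)
      ((by fun_prop : Continuous fun y : (ℝ × ℝ) × CState => y.1.2).prodMk hevo)
  have hmeas : StronglyMeasurable fun z : ℝ × ℝ => pairing hc hs z.2 (evo z.1 z.2 (g z.1)) :=
    Continuous.comp_stronglyMeasurable
      (g := fun y : (ℝ × ℝ) × CState => pairing hc hs y.1.2 (evo y.1.1 y.1.2 y.2))
      (f := fun z : ℝ × ℝ => (z, g z.1)) hpair
      (stronglyMeasurable_id.prodMk (hg.comp_measurable measurable_fst))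
  refine Integrable.of_bound (C := D * M) hmeas.aestronglyMeasurable
    (Eventually.of_forall fun z => (norm_pairing_apply_le hc hs _ _).trans ?_)
  exact mul_le_mul (hD _) ((norm_evo_apply_le _ _ _).trans (hM _)) (norm_nonneg _) hD0

include hg hM in
theorem integral_integral_pairing_evo_swap {Φ : ℝ × Plane → ℝ} (hc : Continuous Φ)
    (hs : HasCompactSupport Φ) {τ : ℝ} (hτ : 0 ≤ τ) :
    ∫ s in (0 : ℝ)..τ, ∫ r in s..τ, pairing hc hs r (evo s r (g s)) =
      ∫ r in (0 : ℝ)..τ, pairing hc hs r (∫ s in (0 : ℝ)..r, evo s r (g s)) := by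
  rw [integral_integral_triangle_swap hτ (integrable_prod_pairing_evo hg hM hc hs 0 τ)]
  exact intervalIntegral.integral_congr fun r _ =>
    ContinuousLinearMap.intervalIntegral_comp_comm _ (intervalIntegrable_evo_apply hg hM r 0 r)

variable {φ : ℝ × Plane → ℝ} (hφ : ContDiff ℝ (⊤ : ℕ∞) φ) (hs : HasCompactSupport φ)

include hg hM in
theorem pairing_integral_evo {τ : ℝ} (hτ : 0 ≤ τ) :
    pairing hφ.continuous hs τ (∫ s in (0 : ℝ)..τ, evo s τ (g s)) =
      (∫ s in (0 : ℝ)..τ, pairing hφ.continuous hs s (g s)) +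
        ∫ r in (0 : ℝ)..τ, pairing (continuous_adjointOp hφ) (hasCompactSupport_adjointOp hs) r
          (∫ s in (0 : ℝ)..r, evo s r (g s)) := by
  have hevo := intervalIntegrable_evo_apply hg hM τ 0 τ
  have hend : IntervalIntegrable (fun s => pairing hφ.continuous hs τ (evo s τ (g s)))
      volume 0 τ :=
    ⟨(pairing hφ.continuous hs τ).integrable_comp hevo.1,
      (pairing hφ.continuous hs τ).integrable_comp hevo.2⟩
  have hstart : IntervalIntegrable (fun s => pairing hφ.continuous hs s (g s)) volume 0 τ :=
    intervalIntegrable_pairing _ _ hg.aestronglyMeasurable fun s _ => hM s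
  rw [← integral_integral_pairing_evo_swap hg hM _ _ hτ,
    ← ContinuousLinearMap.intervalIntegral_comp_comm _ hevo, ← sub_eq_iff_eq_add',
    ← intervalIntegral.integral_sub hend hstart]
  refine intervalIntegral.integral_congr fun s hsτ => ?_
  rw [uIcc_of_le hτ] at hsτ
  exact pairing_evo_sub hφ hs hsτ.2 (g s)

include hg hM in
theorem pairing_duhamel_sub (w₀ : CState) {τ : ℝ} (hτ : 0 ≤ τ) :
    pairing hφ.continuous hs τ (duhamel 0 w₀ g τ) - pairing hφ.continuous hs 0 w₀ =
      (∫ r in (0 : ℝ)..τ, pairing (continuous_adjointOp hφ) (hasCompactSupport_adjointOp hs) r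
        (duhamel 0 w₀ g r)) + ∫ s in (0 : ℝ)..τ, pairing hφ.continuous hs s (g s) := by
  have hc' := continuous_adjointOp hφ
  have hs' := hasCompactSupport_adjointOp hs
  have hfree : IntervalIntegrable (fun r => pairing hc' hs' r (evo 0 r w₀)) volume 0 τ :=
    intervalIntegrable_pairing_of_continuousOn _ _
      (continuous_evo_comp continuous_const continuous_id continuous_const).continuousOn
  have hfull : IntervalIntegrable (fun r => pairing hc' hs' r (duhamel 0 w₀ g r)) volume 0 τ :=
    intervalIntegrable_pairing_of_continuousOn _ _ (continuous_duhamel hg hM 0 w₀).continuousOn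
  have hforced : ∫ r in (0 : ℝ)..τ, pairing hc' hs' r (∫ s in (0 : ℝ)..r, evo s r (g s)) =
      (∫ r in (0 : ℝ)..τ, pairing hc' hs' r (duhamel 0 w₀ g r)) -
        ∫ r in (0 : ℝ)..τ, pairing hc' hs' r (evo 0 r w₀) := by
    rw [← intervalIntegral.integral_sub hfull hfree]
    refine intervalIntegral.integral_congr fun r _ => ?_
    rw [← map_sub, duhamel, add_sub_cancel_left]
  rw [duhamel, map_add, pairing_integral_evo hg hM hφ hs hτ, hforced]
  linear_combination pairing_evo_sub hφ hs hτ w₀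

end Forcing

end WeakForm

section Existence

open FourierTransform

/-- The real part of a complex state. -/
noncomputable def reState : CState →L[ℝ] State := Complex.reCLM.compLpL 2 volume

/-- The complexification of a real state. -/
noncomputable def ofRealState : State →L[ℝ] CState := Complex.ofRealCLM.compLpL 2 volume

theorem coeFn_reState (f : CState) : reState f =ᵐ[volume] fun p => (f p).re :=
  ContinuousLinearMap.coeFn_compLpL _ f

theorem coeFn_ofRealState (f : State) : ofRealState f =ᵐ[volume] fun p => (f p : ℂ) :=
  ContinuousLinearMap.coeFn_compLpL _ f

theorem reState_ofRealState (f : State) : reState (ofRealState f) = f := by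
  refine Lp.ext ?_
  filter_upwards [coeFn_reState (ofRealState f), coeFn_ofRealState f] with p hre hof
  rw [hre, hof, Complex.ofReal_re]

theorem shearOp_zero_apply (f : CState) : shearOp 0 f = f := by
  refine Lp.ext ?_
  filter_upwards [coeFn_shearOp 0 f] with p hp
  have hid : shearMap 0 p = p := by
    ext i
    fin_cases i <;> simp
  rw [hp, hid]

theorem integral_reState_mul {Φ : ℝ × Plane → ℝ} (hc : Continuous Φ) (hs : HasCompactSupport Φ)
    (t : ℝ) (f : CState) :
    ∫ p, reState (shearOp (-t) f) p * Φ (t, p) = (pairing hc hs t f).re := by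
  have hInt : Integrable (fun p => (shearOp (-t) f) p * Φ (t, p)) volume :=
    (Lp.memLp (shearOp (-t) f)).integrable_mul (memLp_slice hc hs t 2)
  rw [pairing_eq_integral, ← Complex.reCLM_apply, ← ContinuousLinearMap.integral_comp_comm _ hInt]
  refine integral_congr_ae ?_
  filter_upwards [coeFn_reState (shearOp (-t) f)] with p hp
  rw [hp, Complex.reCLM_apply, Complex.re_mul_ofReal]

/-- The real control on `ω` defined by a complex state. -/
noncomputable def controlOf (ω : Set Plane) : CState →L[ℝ] Control ω :=
  (LpToLpRestrictCLM Plane ℝ ℝ volume 2 ω) ∘L reState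

variable {ω : Set Plane}

theorem coeFn_controlOf (f : CState) :
    controlOf ω f =ᵐ[volume.restrict ω] fun p => (f p).re := by
  filter_upwards [LpToLpRestrictCLM_coeFn ℝ ω (reState f), ae_restrict_of_ae (coeFn_reState f)]
    with p hrestrict hre
  rw [controlOf, ContinuousLinearMap.comp_apply, hrestrict, hre]

theorem integral_controlOf_mul (hω : NullMeasurableSet ω volume) {Φ : ℝ × Plane → ℝ}
    (hc : Continuous Φ) (hs : HasCompactSupport Φ) (t : ℝ) (f : CState) :
    ∫ p in ω, controlOf ω f p * Φ (t, p) = (pairing hc hs t (shearOp t (cutOp hω f))).re := by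
  have hre : ∫ p in ω, controlOf ω f p * Φ (t, p) = ∫ p in ω, (f p).re * Φ (t, p) := by
    refine integral_congr_ae ?_
    filter_upwards [coeFn_controlOf f] with p hp
    rw [hp]
  rw [← integral_reState_mul hc hs, shearOp_neg_shearOp, hre, ← integral_indicator₀ hω]
  refine integral_congr_ae ?_
  filter_upwards [coeFn_reState (cutOp hω f), coeFn_cutOp hω f] with p hcut hind
  rw [hcut, hind]
  by_cases h : p ∈ ω
  · rw [indicator_of_mem h, indicator_of_mem h]
  · rw [indicator_of_notMem h, indicator_of_notMem h, Complex.zero_re, zero_mul]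

/-- The source `v 𝟙_ω` of the equation, in the moving frame. -/
noncomputable def source (hω : NullMeasurableSet ω volume) (v : ℝ → CState) (s : ℝ) : CState :=
  shearOp s (cutOp hω (v s))

variable {v : ℝ → CState} {M : ℝ}

theorem stronglyMeasurable_source (hω : NullMeasurableSet ω volume) (hv : StronglyMeasurable v) :
    StronglyMeasurable (source hω v) :=
  Continuous.comp_stronglyMeasurable (g := fun z : ℝ × CState => shearOp z.1 z.2)
    (f := fun s => (s, cutOp hω (v s))) continuous_shearOp
    (stronglyMeasurable_id.prodMk ((cutOp hω).continuous.comp_stronglyMeasurable hv))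

theorem norm_source_le (hω : NullMeasurableSet ω volume) (hM : ∀ s, ‖v s‖ ≤ M) (s : ℝ) :
    ‖source hω v s‖ ≤ M := by
  rw [source, LinearIsometry.norm_map]
  exact (norm_cutOp_apply_le hω _).trans (hM s)

theorem eqOn_source (hω : NullMeasurableSet ω volume) {v' : ℝ → CState} {I : Set ℝ}
    (h : EqOn v v' I) : EqOn (source hω v) (source hω v') I := fun s hs => by
  rw [source, source, h hs]

theorem memLp_controlOf (hv : StronglyMeasurable v) (hM : ∀ s, ‖v s‖ ≤ M) (T : ℝ) :
    MemLp (fun s => controlOf ω (v s)) 1 (volume.restrict (Ioo 0 T)) :=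
  MemLp.of_bound ((controlOf ω).continuous.comp_stronglyMeasurable hv).aestronglyMeasurable
    (‖controlOf ω‖ * M) (Eventually.of_forall fun s => (controlOf ω).le_opNorm_of_le (hM s))

/-- The solution of the controlled equation for the datum `y₀` and the control `v`: Duhamel's
formula in the moving frame, transported back to the original variables. -/
noncomputable def solution (hω : NullMeasurableSet ω volume) (y₀ : State) (v : ℝ → CState)
    (t : ℝ) : State :=
  reState (shearOp (-t) (duhamel 0 (ofRealState y₀) (source hω v) t))

theorem continuous_solution (hω : NullMeasurableSet ω volume) (hv : StronglyMeasurable v)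
    (hM : ∀ s, ‖v s‖ ≤ M) (y₀ : State) : Continuous (solution hω y₀ v) :=
  Continuous.comp (g := reState)
    (f := fun t => shearOp (-t) (duhamel 0 (ofRealState y₀) (source hω v) t)) reState.continuous
    (continuous_shearOp_comp continuous_neg
      (continuous_duhamel (stronglyMeasurable_source hω hv) (norm_source_le hω hM) 0 _))

theorem isSolution_solution (hω : NullMeasurableSet ω volume) (hv : StronglyMeasurable v)
    (hM : ∀ s, ‖v s‖ ≤ M) (T : ℝ) (y₀ : State) :
    IsSolution T ω y₀ (fun s => controlOf ω (v s)) (solution hω y₀ v) := by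
  have hg := stronglyMeasurable_source hω hv
  have hgM := norm_source_le hω hM
  have hinitial : solution hω y₀ v 0 = y₀ := by
    simp only [solution, duhamel_self, neg_zero, shearOp_zero_apply, reState_ofRealState]
  refine ⟨(continuous_solution hω hv hM y₀).continuousOn, hinitial, fun φ hφ hs τ hτ => ?_⟩
  have hweak := congrArg Complex.re (pairing_duhamel_sub hg hgM hφ hs (ofRealState y₀) hτ.1)
  have hdatum : ∫ p, y₀ p * φ (0, p) = (pairing hφ.continuous hs 0 (ofRealState y₀)).re := by
    rw [← integral_reState_mul hφ.continuous hs, neg_zero, shearOp_zero_apply,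
      reState_ofRealState]
  rw [Complex.sub_re, Complex.add_re, ← Complex.reCLM_apply, ← Complex.reCLM_apply (∫ _ in _.._, _),
    ← Complex.reCLM_apply (∫ _ in _.._, _),
    ← ContinuousLinearMap.intervalIntegral_comp_comm _
      (intervalIntegrable_pairing_of_continuousOn _ _ (continuous_duhamel hg hgM 0 _).continuousOn),
    ← ContinuousLinearMap.intervalIntegral_comp_comm _
      (intervalIntegrable_pairing _ _ hg.aestronglyMeasurable fun s _ => hgM s)] at hweak
  simp_rw [solution, integral_reState_mul hφ.continuous hs,
    integral_controlOf_mul hω hφ.continuous hs,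
    integral_reState_mul (continuous_adjointOp hφ) (hasCompactSupport_adjointOp hs), hdatum]
  exact hweak

end Existence

section CompactlySupportedKernels

open FourierTransform

variable {V : Type*} [NormedAddCommGroup V] [InnerProductSpace ℝ V]

theorem half_le_cos_two_pi_inner {K : ℝ} (hK : 0 < K) {p ζ : V} (hp : ‖p‖ ≤ 1 / (8 * K))
    (hζ : ‖ζ‖ ≤ K) : 1 / 2 ≤ Real.cos (2 * Real.pi * inner ℝ p ζ) := by
  have hinner : |inner ℝ p ζ| ≤ 1 / 8 := calc
    |inner ℝ p ζ| ≤ ‖p‖ * ‖ζ‖ := abs_real_inner_le_norm p ζ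
    _ ≤ 1 / (8 * K) * K := by gcongr
    _ = 1 / 8 := by field_simp
  have hangle : |2 * Real.pi * inner ℝ p ζ| ≤ 1 := by
    rw [abs_mul, abs_of_pos (by positivity)]
    nlinarith [Real.pi_lt_four, Real.pi_pos, abs_nonneg (inner ℝ p ζ)]
  have hcos := Real.one_sub_sq_div_two_le_cos (x := 2 * Real.pi * inner ℝ p ζ)
  have hsq := (sq_le_one_iff_abs_le_one _).2 hangle
  linarith

variable [FiniteDimensional ℝ V] [MeasurableSpace V] [BorelSpace V]

theorem exists_norm_pow_mul_norm_fourierInv_le {f : V → ℂ} (hf : ContDiff ℝ (⊤ : ℕ∞) f)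
    (hs : HasCompactSupport f) (k : ℕ) : ∃ C, ∀ ζ, ‖ζ‖ ^ k * ‖𝓕⁻ f ζ‖ ≤ C := by
  obtain ⟨C, -, hC⟩ := (𝓕⁻ (hs.toSchwartzMap hf)).decay k 0
  refine ⟨C, fun ζ => ?_⟩
  have hdecay := hC ζ
  rwa [norm_iteratedFDeriv_zero, SchwartzMap.fourierInv_coe] at hdecay

theorem integrable_exp_mul_ofReal {b : V → ℝ} (hb : Integrable b) (ζ : V) : Integrable fun p =>
    Complex.exp (↑(2 * Real.pi * inner ℝ p ζ) * Complex.I) * (b p : ℂ) :=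
  hb.ofReal.bdd_mul (c := 1) (by fun_prop) (Eventually.of_forall fun p => by
    rw [Complex.norm_exp_ofReal_mul_I])

theorem re_fourierInv_ofReal {b : V → ℝ} (hb : Integrable b) (ζ : V) :
    (𝓕⁻ (fun p => (b p : ℂ)) ζ).re = ∫ p, b p * Real.cos (2 * Real.pi * inner ℝ p ζ) := by
  rw [Real.fourierInv_eq']
  simp only [smul_eq_mul]
  rw [← Complex.reCLM_apply, ← Complex.reCLM.integral_comp_comm (integrable_exp_mul_ofReal hb ζ)]
  refine integral_congr_ae (Eventually.of_forall fun p => ?_)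
  simp only [Complex.reCLM_apply, Complex.re_mul_ofReal, Complex.exp_ofReal_mul_I_re]
  exact mul_comm _ _

theorem exists_fourierInv_ne_zero_on_closedBall {K : ℝ} (hK : 0 < K) :
    ∃ ρ : V → ℝ, ContDiff ℝ (⊤ : ℕ∞) ρ ∧ HasCompactSupport ρ ∧
      ∀ ζ ∈ Metric.closedBall (0 : V) K, 𝓕⁻ (fun p => (ρ p : ℂ)) ζ ≠ 0 := by
  obtain ⟨b, hb⟩ : ∃ b : ContDiffBump (0 : V), b.rOut = 1 / (8 * K) :=
    ⟨⟨1 / (16 * K), 1 / (8 * K), by positivity, by gcongr; norm_num⟩, rfl⟩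
  have hcos (ζ : V) (hζ : ζ ∈ Metric.closedBall (0 : V) K) (p : V) :
      b p * (1 / 2) ≤ b p * Real.cos (2 * Real.pi * inner ℝ p ζ) := by
    by_cases hp : b p = 0
    · rw [hp, zero_mul, zero_mul]
    have hball : p ∈ Metric.ball (0 : V) b.rOut := b.support_eq ▸ hp
    rw [mem_ball_zero_iff, hb] at hball
    exact mul_le_mul_of_nonneg_left
      (half_le_cos_two_pi_inner hK hball.le (mem_closedBall_zero_iff.1 hζ)) b.nonneg
  refine ⟨b, b.contDiff, b.hasCompactSupport, fun ζ hζ hzero => ?_⟩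
  have hInt : Integrable fun p : V => b p * Real.cos (2 * Real.pi * inner ℝ p ζ) :=
    b.integrable.mul_bdd (c := 1) (by fun_prop) (Eventually.of_forall fun p => by
      rw [Real.norm_eq_abs]
      exact Real.abs_cos_le_one _)
  have hmono := integral_mono (b.integrable.mul_const (1 / 2)) hInt (hcos ζ hζ)
  rw [integral_mul_const, ← re_fourierInv_ofReal b.integrable, hzero, Complex.zero_re] at hmono
  linarith [b.integral_pos (μ := (volume : Measure V))]

open Convolution in
theorem fourierInv_convolution {ρ k : V → ℝ} (hρ : Integrable ρ) (hk : Integrable k)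
    (ζ : V) :
    𝓕⁻ (fun p => ((ρ ⋆[ContinuousLinearMap.mul ℝ ℝ] k) p : ℂ)) ζ =
      𝓕⁻ (fun p => (ρ p : ℂ)) ζ * 𝓕⁻ (fun p => (k p : ℂ)) ζ := by
  have hconv : (fun p => ((ρ ⋆[ContinuousLinearMap.mul ℝ ℝ] k) p : ℂ)) =
      (fun p => (ρ p : ℂ)) ⋆[ContinuousLinearMap.mul ℂ ℂ] fun p => (k p : ℂ) := by
    funext p
    simp only [convolution_def, ContinuousLinearMap.mul_apply', ← integral_complex_ofReal,
      Complex.ofReal_mul]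
  rw [hconv]
  simp only [Real.fourierInv_eq_fourier_neg]
  exact Real.fourier_mul_convolution_eq hρ.ofReal hk.ofReal (-ζ)

end CompactlySupportedKernels

section MovingTestFunctions

open FourierTransform

/-- The test function `θ(t) r(x - t z, z)`, whose profile `r` follows the transport. -/
noncomputable def movingTest (θ : ℝ → ℝ) (r : Plane → ℝ) : ℝ × Plane → ℝ :=
  fun q => θ q.1 * r (shearMap (-q.1) q.2)

variable {θ : ℝ → ℝ} {r : Plane → ℝ}

theorem contDiff_movingTest (hθ : ContDiff ℝ (⊤ : ℕ∞) θ) (hr : ContDiff ℝ (⊤ : ℕ∞) r) :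
    ContDiff ℝ (⊤ : ℕ∞) (movingTest θ r) := by
  have hcoord (i : Fin 2) : ContDiff ℝ (⊤ : ℕ∞) fun q : ℝ × Plane => q.2 i :=
    (EuclideanSpace.proj (𝕜 := ℝ) i).contDiff.comp contDiff_snd
  have hshear : ContDiff ℝ (⊤ : ℕ∞) fun q : ℝ × Plane => shearMap (-q.1) q.2 := by
    rw [contDiff_euclidean]
    intro i
    fin_cases i
    · simpa using (hcoord 0).add (contDiff_fst.neg.mul (hcoord 1))
    · simpa using hcoord 1
  exact (hθ.comp contDiff_fst).mul (hr.comp hshear)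

theorem hasCompactSupport_movingTest (hθ : HasCompactSupport θ) (hr : HasCompactSupport r) :
    HasCompactSupport (movingTest θ r) := by
  have hprod : HasCompactSupport fun q : ℝ × Plane => θ q.1 * r q.2 := by
    refine HasCompactSupport.intro (hθ.isCompact.prod hr.isCompact) fun q hq => ?_
    rw [mem_prod, not_and_or] at hq
    rcases hq with h | h
    · rw [image_eq_zero_of_notMem_tsupport h, zero_mul]
    · rw [image_eq_zero_of_notMem_tsupport h, mul_zero]
  exact hprod.comp_homeomorph spaceTimeShear.symm

theorem sheared_movingTest (θ : ℝ → ℝ) (r : Plane → ℝ) (t : ℝ) (p : Plane) :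
    sheared (movingTest θ r) (t, p) = θ t * r p := by
  rw [sheared_apply, movingTest, shearMap_neg_shearMap]

theorem testTransform_movingTest {t : ℝ} (ht : θ t = 1) (ζ : Plane) :
    testTransform (movingTest θ r) t ζ = 𝓕⁻ (fun p => (r p : ℂ)) ζ := by
  simp only [testTransform, sheared_movingTest, ht, one_mul]

theorem testTransform_transportOp_movingTest (hθ : ContDiff ℝ (⊤ : ℕ∞) θ)
    (hθs : HasCompactSupport θ) (hr : ContDiff ℝ (⊤ : ℕ∞) r) (hrs : HasCompactSupport r) {t : ℝ}
    (ht : ∀ᶠ s in 𝓝 t, θ s = 1) (ζ : Plane) :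
    testTransform (transportOp (movingTest θ r)) t ζ = 0 := by
  refine (hasDerivAt_testTransform (contDiff_movingTest hθ hr)
    (hasCompactSupport_movingTest hθs hrs) t ζ).unique ?_
  refine (hasDerivAt_const t (𝓕⁻ (fun p => (r p : ℂ)) ζ)).congr_of_eventuallyEq ?_
  filter_upwards [ht] with s hs
  exact testTransform_movingTest hs ζ

end MovingTestFunctions

section EnergyEstimate

variable {E : Type*} [NormedAddCommGroup E] [InnerProductSpace ℝ E] [CompleteSpace E]

theorem eq_zero_of_eq_neg_integral_of_inner_nonneg {Z F : ℝ → E} {T : ℝ}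
    (hF : ContinuousOn F (Icc 0 T)) (hZ : ∀ t ∈ Icc 0 T, Z t = -∫ s in (0 : ℝ)..t, F s)
    (hinner : ∀ t ∈ Icc 0 T, 0 ≤ inner ℝ (Z t) (F t)) {t : ℝ} (ht : t ∈ Icc 0 T) : Z t = 0 := by
  have hT : (0 : ℝ) ≤ T := ht.1.trans ht.2
  have hZc : ContinuousOn Z (Icc 0 T) := by
    refine ContinuousOn.congr ?_ hZ
    rw [← uIcc_of_le hT] at hF ⊢
    exact (intervalIntegral.continuousOn_primitive_interval hF.integrableOn_uIcc).neg
  have hZd (s : ℝ) (hs : s ∈ Ioo 0 T) : HasDerivAt Z (-F s) s := by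
    have hsub : uIcc 0 s ⊆ Icc 0 T := by
      rw [uIcc_of_le hs.1.le]
      exact Icc_subset_Icc_right hs.2.le
    have hprim := intervalIntegral.integral_hasDerivAt_right
      ((hF.mono hsub).intervalIntegrable)
      ((hF.mono Ioo_subset_Icc_self).stronglyMeasurableAtFilter isOpen_Ioo s hs)
      (hF.continuousAt (Icc_mem_nhds hs.1 hs.2))
    refine hprim.fun_neg.congr_of_eventuallyEq ?_
    filter_upwards [Icc_mem_nhds hs.1 hs.2] with r hr using hZ r hr
  have hanti : AntitoneOn (fun s => ‖Z s‖ ^ 2) (Icc 0 T) := by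
    refine antitoneOn_of_deriv_nonpos (convex_Icc 0 T) (hZc.norm.pow 2) ?_ ?_ <;>
      rw [interior_Icc] <;> intro s hs
    · exact (hZd s hs).norm_sq.differentiableAt.differentiableWithinAt
    · rw [(hZd s hs).norm_sq.deriv, inner_neg_right]
      linarith [hinner s (Ioo_subset_Icc_self hs)]
  have hle := hanti (left_mem_Icc.2 hT) ht ht.1
  simp only [hZ 0 (left_mem_Icc.2 hT), intervalIntegral.integral_same, neg_zero, norm_zero] at hle
  exact norm_eq_zero.1 (pow_eq_zero_iff two_ne_zero |>.1
    (le_antisymm (hle.trans_eq (zero_pow two_ne_zero)) (sq_nonneg _)))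

end EnergyEstimate

section Mollification

open FourierTransform

variable {ρ : Plane → ℝ} (hρ : ContDiff ℝ (⊤ : ℕ∞) ρ) (hs : HasCompactSupport ρ)

include hρ hs

theorem memLp_top_mul_fourierInv {m : Plane → ℝ} (hm : Continuous m) {k : ℕ}
    (hk : ∀ ζ, |m ζ| ≤ ‖ζ‖ ^ k) :
    MemLp (fun ζ => (m ζ : ℂ) * 𝓕⁻ (fun p => (ρ p : ℂ)) ζ) ∞ volume := by
  obtain ⟨C, hC⟩ := exists_norm_pow_mul_norm_fourierInv_le (Complex.ofRealCLM.contDiff.comp hρ)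
    (hs.comp_left Complex.ofReal_zero) k
  have hcont : Continuous (𝓕⁻ fun p => (ρ p : ℂ)) :=
    continuous_fourierInv_of_integrable (hρ.continuous.integrable_of_hasCompactSupport hs).ofReal
  refine memLp_top_of_bound (by fun_prop : Continuous fun ζ =>
    (m ζ : ℂ) * 𝓕⁻ (fun p => (ρ p : ℂ)) ζ).aestronglyMeasurable C
    (Eventually.of_forall fun ζ => ?_)
  rw [norm_mul, Complex.norm_real, Real.norm_eq_abs]
  exact (mul_le_mul_of_nonneg_right (hk ζ) (norm_nonneg _)).trans (hC ζ)

theorem memLp_top_fourierInv : MemLp (𝓕⁻ fun p => (ρ p : ℂ)) ∞ (volume : Measure Plane) := by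
  simpa using memLp_top_mul_fourierInv hρ hs (m := fun _ => 1) continuous_const (k := 0) (by simp)

theorem memLp_top_coord_mul_coord_mul_fourierInv (i j : Fin 2) :
    MemLp (fun ζ : Plane => ((ζ i * ζ j : ℝ) : ℂ) * 𝓕⁻ (fun p => (ρ p : ℂ)) ζ) ∞ volume :=
  memLp_top_mul_fourierInv hρ hs (by fun_prop) fun ζ => by
    rw [abs_mul, sq]
    exact mul_le_mul (abs_apply_le_norm ζ i) (abs_apply_le_norm ζ j) (abs_nonneg _)
      (norm_nonneg _)

/-- Convolution with the reflected kernel `p ↦ ρ (-p)`. The reflection makes its symbol `𝓕⁻ ρ`, the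
transform that occurs in `testTransform`. -/
noncomputable def mollify : CState →L[ℂ] CState := fourierMultiplier (memLp_top_fourierInv hρ hs)

/-- The mollified second derivative `-(4π²)⁻¹ ∂ᵢ∂ⱼ`. -/
noncomputable def mollifiedSecond (i j : Fin 2) : CState →L[ℂ] CState :=
  fourierMultiplier (memLp_top_coord_mul_coord_mul_fourierInv hρ hs i j)

/-- The mollification of the moving-frame diffusion `-(∂_z - t ∂_x)²`. -/
noncomputable def mollifiedDiffusion (t : ℝ) : CState →L[ℂ] CState :=
  (4 * Real.pi ^ 2 : ℂ) • (mollifiedSecond hρ hs 1 1 - (2 * t : ℂ) • mollifiedSecond hρ hs 0 1 +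
    (t ^ 2 : ℂ) • mollifiedSecond hρ hs 0 0)

theorem continuous_mollifiedDiffusion :
    Continuous fun z : ℝ × CState => mollifiedDiffusion hρ hs z.1 z.2 := by
  simp only [mollifiedDiffusion, smul_apply, add_apply, sub_apply]
  fun_prop

theorem fourier_mollify (f : CState) : (𝓕 (mollify hρ hs f) : CState) =ᵐ[volume] fun ζ =>
    𝓕⁻ (fun p => (ρ p : ℂ)) ζ * (𝓕 f : CState) ζ := by
  rw [mollify, fourier_fourierMultiplier]
  exact coeFn_mulOp _ _

theorem fourier_mollifiedSecond (i j : Fin 2) (f : CState) :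
    (𝓕 (mollifiedSecond hρ hs i j f) : CState) =ᵐ[volume] fun ζ =>
      ((ζ i * ζ j : ℝ) : ℂ) * (𝓕 (mollify hρ hs f) : CState) ζ := by
  rw [mollifiedSecond, fourier_fourierMultiplier]
  filter_upwards [coeFn_mulOp (memLp_top_coord_mul_coord_mul_fourierInv hρ hs i j) (𝓕 f : CState),
    fourier_mollify hρ hs f] with ζ hsecond hmollify
  rw [hsecond, hmollify, smul_eq_mul, mul_assoc]

theorem fourier_mollifiedDiffusion (t : ℝ) (f : CState) :
    (𝓕 (mollifiedDiffusion hρ hs t f) : CState) =ᵐ[volume] fun ζ =>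
      ((4 * Real.pi ^ 2 * (ζ 1 - t * ζ 0) ^ 2 : ℝ) : ℂ) * (𝓕 (mollify hρ hs f) : CState) ζ := by
  set A := (𝓕 (mollifiedSecond hρ hs 1 1 f) : CState) with hA
  set B := (𝓕 (mollifiedSecond hρ hs 0 1 f) : CState) with hB
  set C := (𝓕 (mollifiedSecond hρ hs 0 0 f) : CState) with hC
  have hexpand : (𝓕 (mollifiedDiffusion hρ hs t f) : CState) =
      (4 * Real.pi ^ 2 : ℂ) • (A - (2 * t : ℂ) • B + (t ^ 2 : ℂ) • C) := by
    simp only [mollifiedDiffusion, smul_apply, add_apply, sub_eq_add_neg, ← neg_smul,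
      FourierTransform.fourier_smul, FourierTransform.fourier_add, hA, hB, hC]
  rw [hexpand]
  filter_upwards [Lp.coeFn_smul (4 * Real.pi ^ 2 : ℂ) (A - (2 * t : ℂ) • B + (t ^ 2 : ℂ) • C),
    Lp.coeFn_add (A - (2 * t : ℂ) • B) ((t ^ 2 : ℂ) • C), Lp.coeFn_sub A ((2 * t : ℂ) • B),
    Lp.coeFn_smul (2 * t : ℂ) B, Lp.coeFn_smul (t ^ 2 : ℂ) C, fourier_mollifiedSecond hρ hs 1 1 f,
    fourier_mollifiedSecond hρ hs 0 1 f, fourier_mollifiedSecond hρ hs 0 0 f]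
    with ζ hsmul hadd hsub hsmulB hsmulC hAζ hBζ hCζ
  rw [hsmul, Pi.smul_apply, hadd, Pi.add_apply, hsub, Pi.sub_apply, hsmulB, hsmulC, Pi.smul_apply,
    Pi.smul_apply, hAζ, hBζ, hCζ]
  simp only [smul_eq_mul]
  push_cast
  ring

theorem inner_mollify_mollifiedDiffusion_nonneg (t : ℝ) (f : CState) :
    0 ≤ inner ℝ (mollify hρ hs f) (mollifiedDiffusion hρ hs t f) := by
  have hinner : inner ℂ (mollify hρ hs f) (mollifiedDiffusion hρ hs t f) = ∫ ζ : Plane,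
      ((4 * Real.pi ^ 2 * (ζ 1 - t * ζ 0) ^ 2 *
        ‖(𝓕 (mollify hρ hs f) : CState) ζ‖ ^ 2 : ℝ) : ℂ) := by
    rw [← Lp.inner_fourier_eq, L2.inner_def]
    refine integral_congr_ae ?_
    filter_upwards [fourier_mollifiedDiffusion hρ hs t f] with ζ hζ
    rw [hζ, RCLike.inner_apply, mul_assoc, Complex.mul_conj, Complex.normSq_eq_norm_sq,
      ← Complex.ofReal_mul]
  rw [real_inner_eq_norm_add_mul_self_sub_norm_mul_self_sub_norm_mul_self_div_two,
    ← re_inner_eq_norm_add_mul_self_sub_norm_mul_self_sub_norm_mul_self_div_two (𝕜 := ℂ), hinner,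
    integral_complex_ofReal]
  exact integral_nonneg fun ζ => by positivity

end Mollification

section WeakUniqueness

open FourierTransform

theorem exists_contDiff_eventually_eq_one {V : Type*} [NormedAddCommGroup V]
    [InnerProductSpace ℝ V] [FiniteDimensional ℝ V] {K : Set V} (hK : Bornology.IsBounded K) :
    ∃ θ : V → ℝ, ContDiff ℝ (⊤ : ℕ∞) θ ∧ HasCompactSupport θ ∧
      ∀ p ∈ K, ∀ᶠ q in 𝓝 p, θ q = 1 := by
  obtain ⟨R, hR, hKR⟩ := hK.subset_ball_lt 0 0
  let b : ContDiffBump (0 : V) := ⟨R, R + 1, hR, by linarith⟩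
  exact ⟨b, b.contDiff, b.hasCompactSupport, fun p hp => b.eventuallyEq_one_of_mem_ball (hKR hp)⟩

/-- The weak form of `y_t + z y_x - y_zz = 0` with `y(0) = 0`, for the moving-frame unknown
`W(t) = shearOp t (y t)`. -/
def IsFreeWeakSolution (T : ℝ) (W : ℝ → CState) : Prop :=
  ∀ (φ : ℝ × Plane → ℝ) (hφ : ContDiff ℝ (⊤ : ℕ∞) φ) (hs : HasCompactSupport φ), ∀ τ ∈ Icc 0 T,
    pairing hφ.continuous hs τ (W τ) = ∫ s in (0 : ℝ)..τ,
      pairing (continuous_adjointOp hφ) (hasCompactSupport_adjointOp hs) s (W s)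

section MovingPairing

variable {θ : ℝ → ℝ} {r k : Plane → ℝ}

theorem pairing_zero_movingTest {hc : Continuous (movingTest θ k)}
    {hs : HasCompactSupport (movingTest θ k)} (hθ₀ : θ 0 = 1) (f : CState) :
    pairing hc hs 0 f = ∫ p, k p • f p := by
  rw [pairing_eq_integral, neg_zero, shearOp_zero_apply]
  refine integral_congr_ae (Eventually.of_forall fun p => ?_)
  have hshear : shearMap (-0) p = p := by
    ext i
    fin_cases i <;> simp
  simp only [movingTest, hshear, hθ₀, one_mul]
  rw [Complex.real_smul, mul_comm]

variable {ρ : Plane → ℝ} (hρ : ContDiff ℝ (⊤ : ℕ∞) ρ) (hρs : HasCompactSupport ρ)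
  (hrk : ∀ ζ, 𝓕⁻ (fun p => (r p : ℂ)) ζ = 𝓕⁻ (fun p => (ρ p : ℂ)) ζ * 𝓕⁻ (fun p => (k p : ℂ)) ζ)
  {hc' : Continuous (movingTest θ k)} {hs' : HasCompactSupport (movingTest θ k)}

include hrk in
theorem pairing_movingTest_eq_mollify {hc : Continuous (movingTest θ r)}
    {hs : HasCompactSupport (movingTest θ r)} {t : ℝ} (hθ₀ : θ 0 = 1) (ht : θ t = 1) (f : CState) :
    pairing hc hs t f = pairing hc' hs' 0 (mollify hρ hρs f) := by
  rw [pairing_eq_integral_fourier, pairing_eq_integral_fourier]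
  refine integral_congr_ae ?_
  filter_upwards [fourier_mollify hρ hρs f] with ζ hζ
  rw [testTransform_movingTest ht, testTransform_movingTest hθ₀, hrk, hζ]
  ring

include hrk in
theorem pairing_adjointOp_movingTest_eq_mollifiedDiffusion (hθ : ContDiff ℝ (⊤ : ℕ∞) θ)
    (hθs : HasCompactSupport θ) (hr : ContDiff ℝ (⊤ : ℕ∞) r) (hrs : HasCompactSupport r)
    {hc : Continuous (adjointOp (movingTest θ r))}
    {hs : HasCompactSupport (adjointOp (movingTest θ r))} {t : ℝ}
    (hθ₀ : θ 0 = 1) (ht : ∀ᶠ s in 𝓝 t, θ s = 1) (f : CState) :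
    pairing hc hs t f = -pairing hc' hs' 0 (mollifiedDiffusion hρ hρs t f) := by
  rw [pairing_eq_integral_fourier, pairing_eq_integral_fourier, ← integral_neg]
  refine integral_congr_ae ?_
  filter_upwards [fourier_mollify hρ hρs f, fourier_mollifiedDiffusion hρ hρs t f]
    with ζ hmollify hdiffusion
  rw [testTransform_adjointOp (contDiff_movingTest hθ hr) (hasCompactSupport_movingTest hθs hrs),
    testTransform_transportOp_movingTest hθ hθs hr hrs ht, testTransform_movingTest ht.self_of_nhds,
    testTransform_movingTest hθ₀, hrk, hdiffusion, hmollify]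
  ring

end MovingPairing

theorem continuousOn_mollifiedDiffusion {ρ : Plane → ℝ} (hρ : ContDiff ℝ (⊤ : ℕ∞) ρ)
    (hρs : HasCompactSupport ρ) {W : ℝ → CState} {s : Set ℝ} (hW : ContinuousOn W s) :
    ContinuousOn (fun t => mollifiedDiffusion hρ hρs t (W t)) s :=
  Continuous.comp_continuousOn (g := fun z : ℝ × CState => mollifiedDiffusion hρ hρs z.1 z.2)
    (f := fun t => (t, W t)) (continuous_mollifiedDiffusion hρ hρs) (continuousOn_id.prodMk hW)

open Convolution in
theorem IsFreeWeakSolution.integral_smul_mollify_add_eq_zero {T : ℝ} {W : ℝ → CState}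
    (h : IsFreeWeakSolution T W) (hW : ContinuousOn W (Icc 0 T)) {ρ k : Plane → ℝ}
    (hρ : ContDiff ℝ (⊤ : ℕ∞) ρ) (hρs : HasCompactSupport ρ) (hk : ContDiff ℝ (⊤ : ℕ∞) k)
    (hks : HasCompactSupport k) {τ : ℝ} (hτ : τ ∈ Icc 0 T) :
    ∫ p, k p • (mollify hρ hρs (W τ) +
      ∫ s in (0 : ℝ)..τ, mollifiedDiffusion hρ hρs s (W s) : CState) p = 0 := by
  obtain ⟨θ, hθ, hθs, hθ_one⟩ := exists_contDiff_eventually_eq_one (Metric.isBounded_Icc 0 T)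
  have hθ₀ : θ 0 = 1 := (hθ_one 0 (left_mem_Icc.2 (hτ.1.trans hτ.2))).self_of_nhds
  set r : Plane → ℝ := ρ ⋆[ContinuousLinearMap.mul ℝ ℝ] k
  have hr : ContDiff ℝ (⊤ : ℕ∞) r :=
    hks.contDiff_convolution_right _ hρ.continuous.locallyIntegrable hk
  have hrs : HasCompactSupport r := hρs.convolution _ hks
  have hrk := fourierInv_convolution (hρ.continuous.integrable_of_hasCompactSupport hρs)
    (hk.continuous.integrable_of_hasCompactSupport hks)
  have hc' := (contDiff_movingTest hθ hk).continuous
  have hs' := hasCompactSupport_movingTest hθs hks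
  have hsub : uIcc 0 τ ⊆ Icc 0 T := by
    rw [uIcc_of_le hτ.1]
    exact Icc_subset_Icc_right hτ.2
  have hweak := h _ (contDiff_movingTest hθ hr) (hasCompactSupport_movingTest hθs hrs) τ hτ
  rw [pairing_movingTest_eq_mollify hρ hρs hrk (hc' := hc') (hs' := hs') hθ₀
      (hθ_one τ hτ).self_of_nhds,
    intervalIntegral.integral_congr fun s hs =>
      pairing_adjointOp_movingTest_eq_mollifiedDiffusion hρ hρs hrk (hc' := hc') (hs' := hs')
        hθ hθs hr hrs hθ₀ (hθ_one s (hsub hs)) (W s),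
    intervalIntegral.integral_neg, ContinuousLinearMap.intervalIntegral_comp_comm _
      ((continuousOn_mollifiedDiffusion hρ hρs hW).mono hsub).intervalIntegrable,
    eq_neg_iff_add_eq_zero, ← map_add, pairing_zero_movingTest hθ₀] at hweak
  exact hweak

theorem IsFreeWeakSolution.mollify_eq {T : ℝ} {W : ℝ → CState} (h : IsFreeWeakSolution T W)
    (hW : ContinuousOn W (Icc 0 T)) {ρ : Plane → ℝ} (hρ : ContDiff ℝ (⊤ : ℕ∞) ρ)
    (hρs : HasCompactSupport ρ) {τ : ℝ} (hτ : τ ∈ Icc 0 T) :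
    mollify hρ hρs (W τ) = -∫ s in (0 : ℝ)..τ, mollifiedDiffusion hρ hρs s (W s) := by
  rw [eq_neg_iff_add_eq_zero]
  refine Lp.ext (EventuallyEq.trans ?_ (Lp.coeFn_zero _ _ _).symm)
  exact ae_eq_zero_of_integral_contDiff_smul_eq_zero
    ((Lp.memLp _).locallyIntegrable one_le_two) fun k hk hks =>
      h.integral_smul_mollify_add_eq_zero hW hρ hρs hk hks hτ

theorem IsFreeWeakSolution.mollify_eq_zero {T : ℝ} {W : ℝ → CState} (h : IsFreeWeakSolution T W)
    (hW : ContinuousOn W (Icc 0 T)) {ρ : Plane → ℝ} (hρ : ContDiff ℝ (⊤ : ℕ∞) ρ)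
    (hρs : HasCompactSupport ρ) {τ : ℝ} (hτ : τ ∈ Icc 0 T) : mollify hρ hρs (W τ) = 0 :=
  eq_zero_of_eq_neg_integral_of_inner_nonneg (Z := fun t => mollify hρ hρs (W t))
    (continuousOn_mollifiedDiffusion hρ hρs hW) (fun _ ht => h.mollify_eq hW hρ hρs ht)
    (fun t _ => inner_mollify_mollifiedDiffusion_nonneg hρ hρs t (W t)) hτ

theorem IsFreeWeakSolution.eq_zero {T : ℝ} {W : ℝ → CState} (h : IsFreeWeakSolution T W)
    (hW : ContinuousOn W (Icc 0 T)) {τ : ℝ} (hτ : τ ∈ Icc 0 T) : W τ = 0 := by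
  have hball (n : ℕ) : ∀ᵐ ζ : Plane, ζ ∈ Metric.closedBall (0 : Plane) (n + 1) →
      (𝓕 (W τ) : CState) ζ = 0 := by
    obtain ⟨ρ, hρ, hρs, hne⟩ :=
      exists_fourierInv_ne_zero_on_closedBall (V := Plane) n.cast_add_one_pos (K := n + 1)
    have hfourier := fourier_mollify hρ hρs (W τ)
    rw [h.mollify_eq_zero hW hρ hρs hτ, FourierTransform.fourier_zero] at hfourier
    filter_upwards [hfourier, Lp.coeFn_zero ℂ 2 (volume : Measure Plane)] with ζ hζ hzero hmem
    rw [hzero, Pi.zero_apply] at hζ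
    exact (mul_eq_zero.1 hζ.symm).resolve_left (hne ζ hmem)
  have hfourier : (𝓕 (W τ) : CState) = 0 := by
    refine Lp.ext ?_
    filter_upwards [ae_all_iff.2 hball, Lp.coeFn_zero ℂ 2 (volume : Measure Plane)]
      with ζ hζ hzero
    obtain ⟨n, hn⟩ := exists_nat_ge ‖ζ‖
    rw [hzero, Pi.zero_apply]
    exact hζ n (mem_closedBall_zero_iff.2 (by linarith))
  rw [← norm_eq_zero, ← Lp.norm_fourier_eq, hfourier, norm_zero]

theorem integral_mul_eq_pairing {Φ : ℝ × Plane → ℝ} (hc : Continuous Φ) (hs : HasCompactSupport Φ)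
    (t : ℝ) (f : State) : ((∫ p, f p * Φ (t, p) : ℝ) : ℂ) =
      pairing hc hs t (shearOp t (ofRealState f)) := by
  rw [pairing_eq_integral, shearOp_neg_shearOp, ← integral_complex_ofReal]
  refine integral_congr_ae ?_
  filter_upwards [coeFn_ofRealState f] with p hp
  rw [hp, Complex.ofReal_mul]

theorem continuousOn_shearOp_ofRealState {y : ℝ → State} {s : Set ℝ} (hy : ContinuousOn y s) :
    ContinuousOn (fun t => shearOp t (ofRealState (y t))) s :=
  Continuous.comp_continuousOn (g := fun z : ℝ × CState => shearOp z.1 z.2)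
    (f := fun t => (t, ofRealState (y t))) continuous_shearOp
    (continuousOn_id.prodMk (ofRealState.continuous.comp_continuousOn hy))

section Solutions

variable {T : ℝ} {ω : Set Plane} {y₀ : State} {u : ℝ → Control ω} {y y' : ℝ → State}

theorem IsSolution.isFreeWeakSolution_sub (h : IsSolution T ω y₀ u y)
    (h' : IsSolution T ω y₀ u y') : IsFreeWeakSolution T fun t =>
      shearOp t (ofRealState (y' t)) - shearOp t (ofRealState (y t)) := by
  intro φ hφ hs t ht
  have hmono : uIcc 0 t ⊆ Icc 0 T := by
    rw [uIcc_of_le ht.1]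
    exact Icc_subset_Icc_right ht.2
  have hc := (continuousOn_shearOp_ofRealState h.continuousOn).mono hmono
  have hc' := (continuousOn_shearOp_ofRealState h'.continuousOn).mono hmono
  have hweak := congrArg (fun x : ℝ => (x : ℂ)) (sub_eq_zero.2 (h.weak φ hφ hs t ht))
  have hweak' := congrArg (fun x : ℝ => (x : ℂ)) (sub_eq_zero.2 (h'.weak φ hφ hs t ht))
  simp only [Complex.ofReal_sub, Complex.ofReal_add, Complex.ofReal_zero,
    integral_mul_eq_pairing hφ.continuous hs, ← intervalIntegral.integral_ofReal,
    integral_mul_eq_pairing (continuous_adjointOp hφ) (hasCompactSupport_adjointOp hs)]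
    at hweak hweak'
  simp only [map_sub]
  rw [intervalIntegral.integral_sub (intervalIntegrable_pairing_of_continuousOn _ _ hc')
    (intervalIntegrable_pairing_of_continuousOn _ _ hc)]
  linear_combination hweak' - hweak

theorem IsSolution.eqOn (h : IsSolution T ω y₀ u y) (h' : IsSolution T ω y₀ u y') :
    EqOn y' y (Icc 0 T) := by
  intro τ hτ
  have hzero := (h.isFreeWeakSolution_sub h').eq_zero
    ((continuousOn_shearOp_ofRealState h'.continuousOn).sub
      (continuousOn_shearOp_ofRealState h.continuousOn)) hτ
  rw [← reState_ofRealState (y' τ), (shearOp τ).injective (sub_eq_zero.1 hzero),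
    reState_ofRealState]

end Solutions

end WeakUniqueness

section Steering

variable {ω : Set Plane} {hω : NullMeasurableSet ω volume}

/-- The localization on `ω` has, on the frequencies at most `K`, a right inverse of norm at most
`2 exp (C K)`. -/
def HasLowPassLift (hω : NullMeasurableSet ω volume) (C : ℝ) : Prop :=
  ∀ K, 1 ≤ K → ∃ L : CState →L[ℂ] CState, (∀ f, lowPass K (cutOp hω (L f)) = lowPass K f) ∧
    ∀ f, ‖L f‖ ≤ 2 * Real.exp (C * K) * ‖f‖

theorem hasLowPassLift_of_isThick {γ a : ℝ} (hγ₀ : 0 < γ) (hγ₁ : γ ≤ 1) (ha : 0 < a)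
    (hω : NullMeasurableSet ω volume) (hthick : IsThick γ a ω) :
    ∃ C, 1 ≤ C ∧ HasLowPassLift hω C := by
  obtain ⟨C, hC, hspec⟩ := spectral_inequality hγ₀ hγ₁ ha hω hthick
  refine ⟨C + 1, by linarith, fun K hK => exists_lift_of_spectral hω
    (Real.one_le_exp (by positivity)) fun f hf => (hspec K hK f hf).trans ?_⟩
  gcongr
  linarith

/-- The control at time `s` which, acting from time `r` to time `m`, removes the low frequencies of
the state `w` at a constant rate. The operator `L` is a lift as in `HasLowPassLift`. -/
noncomputable def feedback (L : CState →L[ℂ] CState) (r m : ℝ) (w : CState) (s : ℝ) : CState :=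
  L (shearOp (-s) (-((m - r)⁻¹ : ℂ) • evo r s w))

variable {L : CState →L[ℂ] CState} {r m K T : ℝ}

theorem continuous_feedback (L : CState →L[ℂ] CState) (r m : ℝ) (w : CState) :
    Continuous (feedback L r m w) :=
  L.continuous.comp (continuous_shearOp_comp continuous_neg
    ((continuous_evo_comp continuous_const continuous_id continuous_const).fun_const_smul _))

theorem norm_feedback_le {N : ℝ} (hN : 0 ≤ N) (hL : ∀ f, ‖L f‖ ≤ N * ‖f‖) (hrm : r < m)
    (w : CState) (s : ℝ) : ‖feedback L r m w s‖ ≤ (m - r)⁻¹ * (N * ‖w‖) := by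
  refine (hL _).trans ?_
  rw [LinearIsometry.norm_map, norm_smul, norm_neg, norm_inv, ← Complex.ofReal_sub,
    Complex.norm_real, Real.norm_eq_abs, abs_of_pos (sub_pos.2 hrm), mul_left_comm]
  have := inv_nonneg.2 (sub_pos.2 hrm).le
  gcongr
  exact norm_evo_apply_le r s w

theorem lowPass_source_feedback
    (hL : ∀ f, lowPass ((1 + T) * K) (cutOp hω (L f)) = lowPass ((1 + T) * K) f) {s : ℝ}
    (hs : |s| ≤ T) (w : CState) : lowPass K (source hω (feedback L r m w) s) =
      -((m - r)⁻¹ : ℂ) • lowPass K (evo r s w) := by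
  rw [source, feedback, ← lowPass_shearOp_lowPass hs le_rfl, hL, lowPass_shearOp_lowPass hs le_rfl,
    shearOp_shearOp_neg, map_smul]

theorem lowPass_duhamel_feedback
    (hL : ∀ f, lowPass ((1 + T) * K) (cutOp hω (L f)) = lowPass ((1 + T) * K) f) (hr : 0 ≤ r)
    (hrm : r < m) (hm : m ≤ T) (w : CState) :
    lowPass K (duhamel r w (source hω (feedback L r m w)) m) = 0 := by
  have hV := continuous_feedback L r m w
  have hInt : IntervalIntegrable (fun s => evo s m (source hω (feedback L r m w) s)) volume r m :=
    (continuous_evo_comp continuous_id continuous_const (continuous_shearOp_comp continuous_id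
      ((cutOp hω).continuous.comp hV))).intervalIntegrable _ _
  have hrate : ∀ s ∈ uIcc r m, lowPass K (evo s m (source hω (feedback L r m w) s)) =
      -((m - r)⁻¹ : ℂ) • lowPass K (evo r m w) := fun s hs => by
    rw [uIcc_of_le hrm.le, mem_Icc] at hs
    rw [lowPass_evo, lowPass_source_feedback hL (abs_le.2 ⟨by linarith, by linarith⟩), map_smul,
      lowPass_evo, evo_evo hs.1 hs.2, ← lowPass_evo]
  have hcancel : ∀ f : CState, (m - r) • -((m - r)⁻¹ : ℂ) • f = -f := fun f => by
    have hne : (m - r : ℂ) ≠ 0 := by exact_mod_cast (sub_pos.2 hrm).ne'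
    rw [← smul_assoc, Complex.real_smul, Complex.ofReal_sub, mul_neg, mul_inv_cancel₀ hne,
      neg_one_smul ℂ f]
  rw [duhamel, map_add, ← ContinuousLinearMap.intervalIntegral_comp_comm _ hInt,
    intervalIntegral.integral_congr hrate, intervalIntegral.integral_const]
  exact add_eq_zero_iff_eq_neg'.2 (hcancel _)

theorem norm_duhamel_feedback_le {N : ℝ} (hN : 1 ≤ N) (hL : ∀ f, ‖L f‖ ≤ 2 * N * ‖f‖)
    (hrm : r < m) (w : CState) :
    ‖duhamel r w (source hω (feedback L r m w)) m‖ ≤ 3 * N * ‖w‖ := by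
  have h := norm_duhamel_le
    (norm_source_le hω (norm_feedback_le (by positivity) hL hrm w)) hrm.le w
  rw [mul_inv_cancel_left₀ (sub_pos.2 hrm).ne'] at h
  linarith [le_mul_of_one_le_left (norm_nonneg w) hN]

theorem duhamel_source_indicator_Iio {V : ℝ → CState} {M t : ℝ} (hV : StronglyMeasurable V)
    (hM : ∀ s, ‖V s‖ ≤ M) (hrm : r ≤ m) (hmt : m ≤ t) (w : CState) :
    duhamel r w (source hω ((Iio m).indicator V)) t =
      evo m t (duhamel r w (source hω V) m) := by
  have hg := stronglyMeasurable_source hω (hV.indicator (measurableSet_Iio (a := m)))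
  have hgM := norm_source_le hω fun s =>
    (norm_indicator_le_norm_self (s := Iio m) V s).trans (hM s)
  have hon : EqOn ((Iio m).indicator V) V (Ico r m) := fun s hs =>
    indicator_of_mem (mem_Iio.2 hs.2) V
  have hoff : ∀ s ∈ Ico m t, source hω ((Iio m).indicator V) s = 0 := fun s hs => by
    rw [source, indicator_of_notMem (notMem_Iio.2 hs.1), map_zero, map_zero]
  rw [← duhamel_duhamel hg hgM hrm hmt, duhamel_eq_evo hmt hoff,
    duhamel_congr hrm (eqOn_source hω hon)]

-- On the first half of the interval the control removes the low frequencies, and on the second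
-- half, without control, dissipation damps the remaining high frequencies.
theorem exists_control_norm_duhamel_le {C t : ℝ} (hlift : HasLowPassLift hω C) (hC : 0 ≤ C)
    (hK : 1 ≤ K) (hr : 0 ≤ r) (hrt : r < t) (ht : t ≤ T) (w : CState) :
    ∃ V : ℝ → CState, StronglyMeasurable V ∧
      (∀ s, ‖V s‖ ≤ 4 / (t - r) * (Real.exp (C * ((1 + T) * K)) * ‖w‖)) ∧
      ‖duhamel r w (source hω V) t‖ ≤ 3 * Real.exp (C * ((1 + T) * K)) *
        Real.exp (-(((t - r) / 2) ^ 3 / (2 * T ^ 2 + 1) * K ^ 2)) * ‖w‖ := by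
  have hT : 0 ≤ T := by linarith
  obtain ⟨L, hL, hLn⟩ := hlift ((1 + T) * K) (by nlinarith)
  have hN : 1 ≤ Real.exp (C * ((1 + T) * K)) := Real.one_le_exp (by positivity)
  obtain ⟨m, hm⟩ : ∃ m, m = (r + t) / 2 := ⟨_, rfl⟩
  have hmr : m - r = (t - r) / 2 := by rw [hm]; ring
  have htm : t - m = (t - r) / 2 := by rw [hm]; ring
  have hrm : r < m := by linarith
  have hmt : m ≤ t := by linarith
  have hF := (continuous_feedback L r m w).stronglyMeasurable
  have hFn := norm_feedback_le (by positivity) hLn hrm w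
  refine ⟨_, hF.indicator (measurableSet_Iio (a := m)), fun s =>
    (norm_indicator_le_norm_self _ s).trans ((hFn s).trans_eq (by rw [hmr]; field)), ?_⟩
  rw [duhamel_source_indicator_Iio hF hFn hrm.le hmt]
  have hdamp := norm_evo_sub_lowPass_le (hr.trans hrm.le) hmt ht (zero_le_one.trans hK)
    (duhamel r w (source hω (feedback L r m w)) m)
  rw [lowPass_evo, lowPass_duhamel_feedback hL hr hrm (hmt.trans ht), map_zero, sub_zero,
    htm] at hdamp
  calc _ ≤ _ := hdamp
    _ ≤ Real.exp (-(((t - r) / 2) ^ 3 / (2 * T ^ 2 + 1) * K ^ 2)) *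
        (3 * Real.exp (C * ((1 + T) * K)) * ‖w‖) := by
      gcongr
      exact norm_duhamel_feedback_le hN hLn hrm w
    _ = _ := by ring

end Steering

section DyadicSchedule

theorem exists_stronglyMeasurable_eqOn {ι α E : Type*} [Countable ι] [MeasurableSpace α]
    [NormedAddCommGroup E] {I : ι → Set α} (hI : ∀ j, MeasurableSet (I j))
    (hdisj : Pairwise (Function.onFun Disjoint I)) {V : ι → α → E}
    (hV : ∀ j, StronglyMeasurable (V j)) {M : ℝ} (hM₀ : 0 ≤ M) (hM : ∀ j s, ‖V j s‖ ≤ M) :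
    ∃ v : α → E, StronglyMeasurable v ∧ (∀ s, ‖v s‖ ≤ M) ∧ ∀ j, EqOn v (V j) (I j) := by
  have hvalue : ∀ s, ∃ x, HasSum (fun i => (I i).indicator (V i) s) x ∧ ‖x‖ ≤ M ∧
      ∀ j, s ∈ I j → x = V j s := fun s => by
    by_cases h : ∃ j, s ∈ I j
    · obtain ⟨j, hj⟩ := h
      have hother : ∀ i, i ≠ j → s ∉ I i := fun i hij hi => disjoint_left.1 (hdisj hij) hi hj
      refine ⟨V j s, ?_, hM j s, fun i hi => ?_⟩
      · rw [← indicator_of_mem hj (V j)]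
        exact hasSum_single j fun i hij => indicator_of_notMem (hother i hij) _
      · rw [not_imp_not.1 (hother i) hi]
    · simp only [not_exists] at h
      refine ⟨0, ?_, by rwa [norm_zero], fun j hj => absurd hj (h j)⟩
      simp only [indicator_of_notMem (h _)]
      exact hasSum_zero
  choose v hsum hbound heq using hvalue
  exact ⟨v, stronglyMeasurable_of_tendsto atTop (fun F => Finset.stronglyMeasurable_fun_sum F
    fun i _ => (hV i).indicator (hI i)) (tendsto_pi_nhds.2 hsum), hbound, fun j s hs => heq s j hs⟩

theorem le_mul_exp_of_recursion {a x y : ℕ → ℝ} (ha : ∀ j, 0 ≤ a j)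
    (hxy : ∀ j, 2 * x (j + 1) + 2 ≤ x j + y j)
    (h : ∀ j, a (j + 1) ≤ 3 * Real.exp (x j) * Real.exp (-y j) * a j) (j : ℕ) :
    a j ≤ a 0 * Real.exp (2 * x 0) * Real.exp (-(2 * x j)) := by
  induction j with
  | zero => rw [mul_assoc, ← Real.exp_add, add_neg_cancel, Real.exp_zero, mul_one]
  | succ j ih =>
    have hthree : (3 : ℝ) ≤ Real.exp 2 := by linarith [Real.add_one_le_exp (2 : ℝ)]
    have ha₀ := ha 0
    have haj := ha j
    calc a (j + 1) ≤ 3 * Real.exp (x j) * Real.exp (-y j) * a j := h j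
      _ ≤ Real.exp 2 * Real.exp (x j) * Real.exp (-y j) *
          (a 0 * Real.exp (2 * x 0) * Real.exp (-(2 * x j))) := by gcongr
      _ = a 0 * Real.exp (2 * x 0) * Real.exp (2 + x j + -y j + -(2 * x j)) := by
        simp only [Real.exp_add]
        ring
      _ ≤ a 0 * Real.exp (2 * x 0) * Real.exp (-(2 * x (j + 1))) := by
        gcongr
        linarith [hxy j]

theorem exp_neg_le_half_pow {x : ℝ} {j : ℕ} (h : (16 : ℝ) ^ j ≤ x) :
    Real.exp (-x) ≤ (1 / 2) ^ j := by
  rw [Real.exp_neg, one_div, inv_pow]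
  refine inv_anti₀ (by positivity) ?_
  have hpow : (2 : ℝ) ^ j ≤ 16 ^ j := by gcongr; norm_num
  linarith [Real.add_one_le_exp x]

theorem exp_mul_le_of_recursion {a x y : ℕ → ℝ} (ha : ∀ j, 0 ≤ a j) (hx : ∀ j, (16 : ℝ) ^ j ≤ x j)
    (hxy : ∀ j, 2 * x (j + 1) + 2 ≤ x j + y j)
    (h : ∀ j, a (j + 1) ≤ 3 * Real.exp (x j) * Real.exp (-y j) * a j) (j : ℕ) :
    Real.exp (x j) * a j ≤ a 0 * Real.exp (2 * x 0) * (1 / 2) ^ j := by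
  have ha₀ := ha 0
  calc Real.exp (x j) * a j
      ≤ Real.exp (x j) * (a 0 * Real.exp (2 * x 0) * Real.exp (-(2 * x j))) := by
        gcongr
        exact le_mul_exp_of_recursion ha hxy h j
    _ = a 0 * Real.exp (2 * x 0) * Real.exp (-x j) := by
      rw [mul_left_comm, ← Real.exp_add]
      ring_nf
    _ ≤ a 0 * Real.exp (2 * x 0) * (1 / 2) ^ j := by
      gcongr
      exact exp_neg_le_half_pow (hx j)

-- The frequencies `K j` are proportional to `16 ^ j`, so that the dissipation exponent, of order
-- `(16 ^ 2 / 2 ^ 3) ^ j = 32 ^ j`, eventually beats the cost exponent, of order `16 ^ j`.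
theorem exists_frequency_seq {A c : ℝ} (hA : 1 ≤ A) (hc : 0 < c) :
    ∃ K : ℕ → ℝ, ∀ j, (16 : ℝ) ^ j ≤ K j ∧
      2 * (A * K (j + 1)) + 2 ≤ A * K j + c * ((1 / 2) ^ j) ^ 3 * K j ^ 2 := by
  obtain ⟨B, hB⟩ : ∃ B, B = 1 + 33 * A / c := ⟨_, rfl⟩
  have hB₁ : 1 ≤ B := by
    rw [hB, le_add_iff_nonneg_right]
    positivity
  have hcB : 33 * A ≤ c * B := by
    rw [hB, mul_add, mul_div_cancel₀ _ hc.ne']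
    linarith
  refine ⟨fun j => B * 16 ^ j, fun j => ?_⟩
  beta_reduce
  have h16 : (1 : ℝ) ≤ 16 ^ j := one_le_pow₀ (by norm_num)
  refine ⟨le_mul_of_one_le_left (by positivity) hB₁, ?_⟩
  have hAK : 1 ≤ A * (B * 16 ^ j) :=
    one_le_mul_of_one_le_of_one_le hA (one_le_mul_of_one_le_of_one_le hB₁ h16)
  have hpow : ((1 / 2 : ℝ) ^ j) ^ 3 * (16 ^ j) ^ 2 = 32 ^ j := by
    rw [← pow_mul, ← pow_mul, mul_comm j 3, mul_comm j 2, pow_mul, pow_mul, ← mul_pow]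
    norm_num
  have hdissipation : 33 * (A * (B * 16 ^ j)) ≤ c * ((1 / 2) ^ j) ^ 3 * (B * 16 ^ j) ^ 2 :=
    calc 33 * (A * (B * 16 ^ j)) = 33 * A * (B * 16 ^ j) := by ring
      _ ≤ c * B * (B * 32 ^ j) := by
        gcongr
        norm_num
      _ = c * ((1 / 2) ^ j) ^ 3 * (B * 16 ^ j) ^ 2 := by rw [← hpow]; ring
  rw [pow_succ (16 : ℝ)]
  linarith

/-- The times `T (1 - 2⁻ʲ)`, which increase to `T`. -/
noncomputable def gridTime (T : ℝ) (j : ℕ) : ℝ := T * (1 - (1 / 2) ^ j)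

variable {T : ℝ}

theorem gridTime_zero (T : ℝ) : gridTime T 0 = 0 := by simp [gridTime]

theorem gridTime_succ_sub (T : ℝ) (j : ℕ) :
    gridTime T (j + 1) - gridTime T j = T / 2 * (1 / 2) ^ j := by
  rw [gridTime, gridTime, pow_succ]
  ring

theorem strictMono_gridTime (hT : 0 < T) : StrictMono (gridTime T) :=
  strictMono_nat_of_lt_succ fun j => by
    rw [← sub_pos, gridTime_succ_sub]
    positivity

theorem gridTime_nonneg (hT : 0 < T) (j : ℕ) : 0 ≤ gridTime T j :=
  (gridTime_zero T).symm.trans_le ((strictMono_gridTime hT).monotone (Nat.zero_le j))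

theorem gridTime_le (hT : 0 ≤ T) (j : ℕ) : gridTime T j ≤ T :=
  mul_le_of_le_one_right hT (sub_le_self 1 (by positivity))

theorem tendsto_gridTime (T : ℝ) : Tendsto (gridTime T) atTop (𝓝 T) := by
  have h := ((tendsto_pow_atTop_nhds_zero_of_lt_one (by norm_num : (0 : ℝ) ≤ 1 / 2)
    (by norm_num)).const_sub 1).const_mul T
  rwa [sub_zero, mul_one] at h

end DyadicSchedule

section NullControl

variable {ω : Set Plane} {hω : NullMeasurableSet ω volume} {C T : ℝ}

theorem exists_control_seq (hlift : HasLowPassLift hω C) (hC : 1 ≤ C) (hT : 0 < T) (w₀ : CState) :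
    ∃ (V : ℕ → ℝ → CState) (w : ℕ → CState) (D : ℝ), w 0 = w₀ ∧ 0 ≤ D ∧
      (∀ j, w (j + 1) = duhamel (gridTime T j) (w j) (source hω (V j)) (gridTime T (j + 1))) ∧
      (∀ j, StronglyMeasurable (V j)) ∧ (∀ j s, ‖V j s‖ ≤ 8 / T * D) ∧
      ∀ j, ‖w j‖ ≤ D * (1 / 2) ^ j := by
  have hA : 1 ≤ C * (1 + T) := by nlinarith
  obtain ⟨K, hK⟩ := exists_frequency_seq (c := (T / 4) ^ 3 / (2 * T ^ 2 + 1)) hA (by positivity)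
  have hK₁ : ∀ j, 1 ≤ K j := fun j => (one_le_pow₀ (by norm_num)).trans (hK j).1
  have hx : ∀ j, (16 : ℝ) ^ j ≤ C * ((1 + T) * K j) := fun j => by
    rw [← mul_assoc]
    exact (hK j).1.trans (le_mul_of_one_le_left (zero_le_one.trans (hK₁ j)) hA)
  choose V hV hVnorm hdecay using fun (j : ℕ) (w : CState) => exists_control_norm_duhamel_le hlift
    (zero_le_one.trans hC) (hK₁ j) (gridTime_nonneg hT j)
    (strictMono_gridTime hT (Nat.lt_succ_self j)) (gridTime_le hT.le (j + 1)) w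
  obtain ⟨w, hw₀, hw⟩ : ∃ w : ℕ → CState, w 0 = w₀ ∧ ∀ j, w (j + 1) =
      duhamel (gridTime T j) (w j) (source hω (V j (w j))) (gridTime T (j + 1)) :=
    ⟨fun j => Nat.rec w₀ (fun i f =>
      duhamel (gridTime T i) f (source hω (V i f)) (gridTime T (i + 1))) j, rfl, fun j => rfl⟩
  have hcost := exp_mul_le_of_recursion (a := fun j => ‖w j‖)
    (x := fun j => C * ((1 + T) * K j))
    (y := fun j => (T / 4 * (1 / 2) ^ j) ^ 3 / (2 * T ^ 2 + 1) * K j ^ 2) (fun j => norm_nonneg _)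
    hx (fun j => by convert (hK j).2 using 1 <;> ring) fun j => by
      have h := hdecay j (w j)
      rwa [← hw, gridTime_succ_sub, show T / 2 * (1 / 2) ^ j / 2 = T / 4 * (1 / 2) ^ j by ring] at h
  refine ⟨fun j => V j (w j), w, _, hw₀, by positivity, hw, fun j => hV j (w j), fun j s => ?_,
    fun j => (le_mul_of_one_le_left (norm_nonneg _) (Real.one_le_exp ?_)).trans (hcost j)⟩
  · refine (hVnorm j (w j) s).trans ?_
    rw [gridTime_succ_sub]
    refine (mul_le_mul_of_nonneg_left (hcost j) (by positivity)).trans_eq ?_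
    field
  · exact (by positivity : (0 : ℝ) ≤ 16 ^ j).trans (hx j)

theorem exists_null_control (hlift : HasLowPassLift hω C) (hC : 1 ≤ C) (hT : 0 < T)
    (w₀ : CState) : ∃ (v : ℝ → CState) (M : ℝ), StronglyMeasurable v ∧ (∀ s, ‖v s‖ ≤ M) ∧
      duhamel 0 w₀ (source hω v) T = 0 := by
  obtain ⟨V, w, D, rfl, hD, hw, hV, hVM, hwD⟩ := exists_control_seq hlift hC hT w₀
  have hmono := (strictMono_gridTime hT).monotone
  obtain ⟨v, hv, hvM, hvV⟩ := exists_stronglyMeasurable_eqOn (fun j => measurableSet_Ico)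
    hmono.pairwise_disjoint_on_Ico_succ hV (by positivity) hVM
  have hg := stronglyMeasurable_source hω hv
  have hgM := norm_source_le hω hvM
  have hgrid : ∀ j, duhamel 0 (w 0) (source hω v) (gridTime T j) = w j := fun j => by
    induction j with
    | zero => rw [gridTime_zero, duhamel_self]
    | succ j ih =>
      have hj := hmono (Nat.le_succ j)
      rw [← duhamel_duhamel hg hgM (gridTime_nonneg hT j) hj, ih, hw,
        duhamel_congr hj (eqOn_source hω (hvV j))]
  have hw_lim : Tendsto w atTop (𝓝 0) := by
    refine squeeze_zero_norm hwD ?_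
    simpa using (tendsto_pow_atTop_nhds_zero_of_lt_one (by norm_num : (0 : ℝ) ≤ 1 / 2)
      (by norm_num)).const_mul D
  have hlim := ((continuous_duhamel hg hgM 0 (w 0)).tendsto T).comp (tendsto_gridTime T)
  exact ⟨v, _, hv, hvM, tendsto_nhds_unique hlim (hw_lim.congr fun j => (hgrid j).symm)⟩

end NullControl

end KolmogorovControl

theorem mainTheorem7 (γ a : ℝ) (hγ₀ : 0 < γ) (hγ₁ : γ ≤ 1) (ha : 0 < a)
    (ω : Set (EuclideanSpace ℝ (Fin 2))) (hω : NullMeasurableSet ω volume)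
    (hthick : KolmogorovControl.IsThick γ a ω) :
    KolmogorovControl.SmallTimeNullControllable ω := by
  intro T hT y₀
  obtain ⟨C, hC, hlift⟩ := KolmogorovControl.hasLowPassLift_of_isThick hγ₀ hγ₁ ha hω hthick
  obtain ⟨v, M, hv, hM, hzero⟩ :=
    KolmogorovControl.exists_null_control hlift hC hT (KolmogorovControl.ofRealState y₀)
  have hsol := KolmogorovControl.isSolution_solution hω hv hM T y₀
  refine ⟨_, KolmogorovControl.memLp_controlOf hv hM T, _, hsol, ?_, fun y' hy' => hsol.eqOn hy'⟩
  simp only [KolmogorovControl.solution, hzero, map_zero]
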